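/- Fix a finite set $\mathcal F$ of \emph{faces}. Algebras are complex, associative, not necessarily unital; $\sqcup$ denotes their free product (coproduct). A \emph{multi-faced algebra} is an algebra $A$ freely generated by given subalgebras $A^{c}$, $c\in\mathcal F$, i.e. the canonical homomorphism $\bigsqcup_{c\in\mathcal F}A^c\to A$ is an isomorphism. A multi-faced homomorphism is an algebra homomorphism mapping faces into the corresponding faces, and $(A\sqcup B)^c:=A^c\sqcup B^c$. A \emph{multi-faced $*$-algebra} has in addition an involution for which the faces are $*$-subalgebras. A linear functional on a $*$-algebra is a \emph{restricted state} if its unital extension to the unitization is positive. A \emph{multi-faced universal product} $\odot$ assigns to linear functionals $\varphi_1,\varphi_2$ on multi-faced algebras $A_1,A_2$ a linear functional $\varphi_1\odot\varphi_2$ on $A_1\sqcup A_2$ such that $(\varphi_1\circ h_1)\odot(\varphi_2\circ h_2)=(\varphi_1\odot\varphi_2)\circ(h_1\sqcup h_2)$ for all multi-faced homomorphisms $h_i\colon B_i\to A_i$, $(\varphi_1\odot\varphi_2)\odot\varphi_3=\varphi_1\odot(\varphi_2\odot\varphi_3)$, and $(\varphi_1\odot\varphi_2)|_{A_i}=\varphi_i$.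 It is \emph{positive} if the product of restricted states on multi-faced $*$-algebras is a restricted state. Symmetry is not assumed. For $k,n\ge1$ and $\mathbf s=\mathbf b\times\mathbf f\in([k]\times\mathcal F)^n$ put $\beta_\kappa(\mathbf s)=\{\ell:\mathbf b(\ell)=\kappa\}$. A set partition $\pi$ of $[n]$ is \emph{adapted} to $\mathbf s$, $\pi\prec\mathbf s$, if each block of $\pi$ lies in some $\beta_\kappa(\mathbf s)$ and $i,i+1$ lie in the same block whenever $\mathbf s(i)=\mathbf s(i+1)$. The \emph{coefficients} of $\odot$ are numbers $\alpha^\pi_{\mathbf s}\in\mathbb C$ ($\pi\prec\mathbf s$) such that for all linear functionals $\varphi_\kappa$ on multi-faced algebras $A_\kappa$ ($\kappa\in[k]$) and all $a_i\in A_{\mathbf b(i)}^{\mathbf f(i)}$, $$(\varphi_1\odot\cdots\odot\varphi_k)(a_1\cdots a_n)=\sum_{\pi\prec\mathbf s}\alpha^\pi_{\mathbf s}\prod_{\kappa\in[k]}\ \prod_{\beta\in\pi,\ \beta\subset\beta_\kappa(\mathbf s)}\varphi_\kappa\Bigl(\overrightarrow{\prod}_{\ell\in\beta}a_\ell\Bigr),$$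 where $\overrightarrow{\prod}$ is the product in increasing order of $\ell$. An \emph{ordered multi-faced partition} $\pi=\{\beta_1<\dots<\beta_k\}$ is a face structure $\mathbf f\in\mathcal F^n$, $n\ge1$, together with a set partition of $[n]$ and a total order between its blocks. The \emph{highest coefficient} $\alpha_\pi$ is $\alpha_{\mathbf s_\pi}^{\sigma}$, where $\mathbf s_\pi(\ell)=(\kappa,\mathbf f(\ell))$ for $\ell\in\beta_\kappa$, and $\sigma=\{\beta_1,\dots,\beta_k\}$ is the maximal partition adapted to $\mathbf s_\pi$. \textbf{Theorem.} Let $\odot$ be a positive multi-faced universal product. Then its highest coefficients $\alpha_\pi$ exist, are uniquely determined, and satisfy: (i) $\alpha_\pi=1$ for every one-block partition $\pi$. (ii) $\alpha_{(\{\{1\}<\{2\}\},\mathbf f)}=\alpha_{(\{\{2\}<\{1\}\},\mathbf f)}=1$ for every $\mathbf f\in\mathcal F^2$. (iii) $\alpha_\pi=\alpha_{\pi_{\mathrm{red}}}$, where $\pi_{\mathrm{red}}$ is obtained from $\pi$ by collapsing every maximal interval of points of the same face and the same block to a single point. (iv) If $\beta<\beta'$ are nearest neighbours in the block order of $\pi$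 and there are $i\in\beta$, $j\in\beta'$ with $|i-j|=1$ and $\mathbf f(i)=\mathbf f(j)$, then $\alpha_\pi=\alpha_{\pi_{\beta\smile\beta'}}\cdot\alpha_{\{\beta<\beta'\}}$, where $\pi_{\beta\smile\beta'}$ arises from $\pi$ by uniting $\beta$ and $\beta'$ to one block at their place in the block order, and $\{\beta<\beta'\}$ is the induced ordered two-block partition of $\beta\cup\beta'$ (relabelled increasingly). (v) $\alpha_\pi=\alpha_\sigma$ whenever $\pi$ and $\sigma$ differ only in the faces of the extremal (first and last) points. (vi) $\alpha_{\overline\pi}=\overline{\alpha_\pi}$, where $\overline\pi$ is the image of $\pi$ under $\ell\mapsto n-\ell+1$, with non-reversed block order. -/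

import Mathlib

universe u v w

open scoped ComplexOrder ComplexConjugate

noncomputable section

set_option linter.unusedSectionVars false

namespace MultiFaced

/-! ### The free product of not necessarily unital algebras -/

section FreeProd

open scoped Classical

variable {ι : Type v} (A : ι → Type u) [∀ i, NonUnitalRing (A i)] [∀ i, Module ℂ (A i)]
  [∀ i, IsScalarTower ℂ (A i) (A i)] [∀ i, SMulCommClass ℂ (A i) (A i)]

/-- The unital free product of the unitizations of the algebras `A i`. -/
def Ambient : Type (max u v) :=
  LinearAlgebra.FreeProduct ℂ (fun i => Unitization ℂ (A i))

instance : Ring (Ambient A) :=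
  inferInstanceAs (Ring (LinearAlgebra.FreeProduct ℂ (fun i => Unitization ℂ (A i))))

instance : Algebra ℂ (Ambient A) :=
  inferInstanceAs (Algebra ℂ (LinearAlgebra.FreeProduct ℂ (fun i => Unitization ℂ (A i))))

/-- The inclusion of `A i` into the unital free product of the unitizations. -/
def ambientOf (i : ι) : A i →ₙₐ[ℂ] Ambient A :=
  NonUnitalAlgHom.comp
    ((show Unitization ℂ (A i) →ₐ[ℂ] Ambient A from
      LinearAlgebra.FreeProduct.ι ℂ (fun i => Unitization ℂ (A i)) i :
      Unitization ℂ (A i) →ₐ[ℂ] Ambient A) : Unitization ℂ (A i) →ₙₐ[ℂ] Ambient A)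
    (Unitization.inrNonUnitalAlgHom ℂ (A i))

theorem exists_ambientLift {C : Type w} [Ring C] [Algebra ℂ C] (g : ∀ i, A i →ₙₐ[ℂ] C) :
    ∃ h : Ambient A →ₐ[ℂ] C, ∀ i a, h (ambientOf A i a) = g i a := by
  refine ⟨LinearAlgebra.FreeProduct.lift ℂ (fun i => Unitization ℂ (A i))
    (fun {i} => Unitization.lift (g i)), fun i a => ?_⟩
  have := LinearAlgebra.FreeProduct.lift_comp_ι ℂ (fun i => Unitization ℂ (A i))
    (fun {i} => Unitization.lift (g i)) (i := i)
  have h2 := DFunLike.congr_fun this (a : Unitization ℂ (A i))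
  have h3 : Unitization.lift (g i) (a : Unitization ℂ (A i)) = g i a := by simp
  exact h2.trans h3

/-- The subalgebra generated by all `A i` inside the unital free product of the unitizations. -/
def freeProdSubalgebra : NonUnitalSubalgebra ℂ (Ambient A) :=
  NonUnitalAlgebra.adjoin ℂ (⋃ i, Set.range (ambientOf A i))

/-- The (non-unital) free product of a family of algebras, i.e. their coproduct in the category
of not necessarily unital associative complex algebras (see `FreeProd.lift`, `FreeProd.lift_of`
and `FreeProd.hom_ext` for the universal property). -/
def FreeProd : Type (max u v) := freeProdSubalgebra A

namespace FreeProd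

instance : NonUnitalRing (FreeProd A) := inferInstanceAs (NonUnitalRing (freeProdSubalgebra A))
instance : Module ℂ (FreeProd A) := inferInstanceAs (Module ℂ (freeProdSubalgebra A))
instance : IsScalarTower ℂ (FreeProd A) (FreeProd A) :=
  inferInstanceAs (IsScalarTower ℂ (freeProdSubalgebra A) (freeProdSubalgebra A))
instance : SMulCommClass ℂ (FreeProd A) (FreeProd A) :=
  inferInstanceAs (SMulCommClass ℂ (freeProdSubalgebra A) (freeProdSubalgebra A))

/-- The inclusion of the free product into the ambient unital algebra. -/
def toAmbient : FreeProd A →ₙₐ[ℂ] Ambient A :=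
  NonUnitalSubalgebraClass.subtype (freeProdSubalgebra A)

theorem toAmbient_injective : Function.Injective (toAmbient A) := Subtype.val_injective

variable {A}

/-- The canonical homomorphism `A i → ⨆ A i`. -/
def of (i : ι) : A i →ₙₐ[ℂ] FreeProd A :=
  NonUnitalAlgHom.codRestrict (ambientOf A i) (freeProdSubalgebra A)
    (fun a => NonUnitalAlgebra.subset_adjoin ℂ (Set.mem_iUnion.2 ⟨i, a, rfl⟩))

@[elab_as_elim]
theorem induction {p : FreeProd A → Prop} (hof : ∀ i a, p (of i a))
    (hadd : ∀ x y, p x → p y → p (x + y)) (hzero : p 0)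
    (hmul : ∀ x y, p x → p y → p (x * y)) (hsmul : ∀ (c : ℂ) x, p x → p (c • x))
    (x : FreeProd A) : p x := by
  obtain ⟨x, hx⟩ := x
  refine NonUnitalAlgebra.adjoin_induction (p := fun x hx => p ⟨x, hx⟩) ?_ ?_ hzero ?_ ?_ hx
  · intro x hx
    obtain ⟨i, a, rfl⟩ := Set.mem_iUnion.1 hx
    exact hof i a
  · exact fun x y hx hy => hadd ⟨x, hx⟩ ⟨y, hy⟩
  · exact fun x y hx hy => hmul ⟨x, hx⟩ ⟨y, hy⟩
  · exact fun c x hx => hsmul c ⟨x, hx⟩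

section lift

variable {C : Type w} [NonUnitalRing C] [Module ℂ C] [IsScalarTower ℂ C C] [SMulCommClass ℂ C C]

theorem hom_ext {g h : FreeProd A →ₙₐ[ℂ] C} (H : ∀ i a, g (of i a) = h (of i a)) : g = h := by
  ext x
  induction x using FreeProd.induction with
  | hof i a => exact H i a
  | hadd x y hx hy => simp [hx, hy]
  | hzero => simp
  | hmul x y hx hy => simp [hx, hy]
  | hsmul c x hx => simp [hx]

theorem exists_lift (g : ∀ i, A i →ₙₐ[ℂ] C) :
    ∃ h : FreeProd A →ₙₐ[ℂ] C, ∀ i a, h (of i a) = g i a := by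
  obtain ⟨k, hk⟩ := exists_ambientLift A (C := Unitization ℂ C)
    (fun i => (Unitization.inrNonUnitalAlgHom ℂ C).comp (g i))
  have key : ∀ x : FreeProd A, k (toAmbient A x) = ((k (toAmbient A x)).snd : Unitization ℂ C) := by
    intro x
    induction x using FreeProd.induction with
    | hof i a =>
      have := hk i a
      change k (ambientOf A i a) = ((k (ambientOf A i a)).snd : Unitization ℂ C)
      rw [this]; simp
    | hadd x y hx hy => rw [map_add, map_add, hx, hy]; simp
    | hzero => simp
    | hmul x y hx hy =>
      rw [map_mul, map_mul, hx, hy, ← Unitization.inr_mul]; simp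
    | hsmul c x hx => rw [map_smul, map_smul, hx]; simp
  refine ⟨{ toFun := fun x => (k (toAmbient A x)).snd
            map_smul' := by intro c x; simp
            map_zero' := by simp
            map_add' := by intro x y; simp
            map_mul' := ?_ }, ?_⟩
  · intro x y
    have : k (toAmbient A (x * y)) = k (toAmbient A x) * k (toAmbient A y) := by
      rw [map_mul, map_mul]
    rw [this]
    conv_lhs => rw [key x, key y, ← Unitization.inr_mul]
    simp
  · intro i a
    change (k (ambientOf A i a)).snd = g i a
    rw [hk]; simp

/-- The universal property of the free product: the homomorphism with prescribed restrictions. -/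
def lift (g : ∀ i, A i →ₙₐ[ℂ] C) : FreeProd A →ₙₐ[ℂ] C := (exists_lift g).choose

@[simp] theorem lift_of (g : ∀ i, A i →ₙₐ[ℂ] C) (i : ι) (a : A i) : lift g (of i a) = g i a :=
  (exists_lift g).choose_spec i a

end lift

end FreeProd

end FreeProd

/-! ### The involution on a free product of `*`-algebras -/

/-- The opposite algebra of `C`, with the complex conjugate scalar multiplication. -/
def ConjOp (C : Type u) : Type u := Cᵐᵒᵖ

namespace ConjOp

variable (C : Type u) [NonUnitalRing C] [Module ℂ C] [IsScalarTower ℂ C C] [SMulCommClass ℂ C C]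

instance : NonUnitalRing (ConjOp C) := inferInstanceAs (NonUnitalRing Cᵐᵒᵖ)

instance : Module ℂ (ConjOp C) := Module.compHom Cᵐᵒᵖ (starRingEnd ℂ)

variable {C}

/-- The identity of `C`, viewed as an antilinear antihomomorphism to `ConjOp C`. -/
def mk (x : C) : ConjOp C := MulOpposite.op x

/-- The inverse of `ConjOp.mk`. -/
def un (x : ConjOp C) : C := MulOpposite.unop x

instance : IsScalarTower ℂ (ConjOp C) (ConjOp C) :=
  ⟨fun c x y => MulOpposite.unop_injective (by
    change un y * (conj c • un x) = conj c • (un y * un x)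
    rw [mul_smul_comm])⟩

instance : SMulCommClass ℂ (ConjOp C) (ConjOp C) :=
  ⟨fun c x y => MulOpposite.unop_injective (by
    change conj c • (un y * un x) = (conj c • un y) * un x
    rw [smul_mul_assoc])⟩

end ConjOp

section StarFreeProd

variable {ι : Type v} {A : ι → Type u} [∀ i, NonUnitalRing (A i)] [∀ i, Module ℂ (A i)]
  [∀ i, IsScalarTower ℂ (A i) (A i)] [∀ i, SMulCommClass ℂ (A i) (A i)]
  [∀ i, StarRing (A i)] [∀ i, StarModule ℂ (A i)]

namespace FreeProd

/-- The involution of the free product, as a homomorphism to the conjugate opposite algebra. -/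
def starHom : FreeProd A →ₙₐ[ℂ] ConjOp (FreeProd A) :=
  lift (fun i =>
    { toFun := fun a => ConjOp.mk (of i (star a))
      map_smul' := fun c a => by
        change ConjOp.mk (of i (star (c • a))) = ConjOp.mk (conj c • of i (star a))
        rw [star_smul, map_smul]; rfl
      map_zero' := by
        rw [star_zero, map_zero]; rfl
      map_add' := fun a b => by
        rw [star_add, map_add]; rfl
      map_mul' := fun a b => by
        rw [star_mul, map_mul]; rfl })

/-- The involution of the free product of `*`-algebras: the antilinear antimultiplicative map
which extends the involutions of the factors (see `FreeProd.star_of`). -/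
instance : Star (FreeProd A) := ⟨fun x => ConjOp.un (starHom x)⟩

theorem star_of (i : ι) (a : A i) : star (of i a) = of i (star a) := by
  change ConjOp.un (starHom (of i a)) = _
  rw [starHom, lift_of]; rfl

theorem star_add' (x y : FreeProd A) : star (x + y) = star x + star y := by
  change ConjOp.un (starHom (x + y)) = _
  rw [map_add]; rfl

theorem star_mul' (x y : FreeProd A) : star (x * y) = star y * star x := by
  change ConjOp.un (starHom (x * y)) = _
  rw [map_mul]; rfl

theorem star_smul' (c : ℂ) (x : FreeProd A) : star (c • x) = star c • star x := by
  change ConjOp.un (starHom (c • x)) = _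
  rw [map_smul]; rfl

theorem star_zero' : star (0 : FreeProd A) = 0 := by
  change ConjOp.un (starHom (0 : FreeProd A)) = _
  rw [map_zero]; rfl

theorem star_star' (x : FreeProd A) : star (star x) = x := by
  induction x using FreeProd.induction with
  | hof i a => rw [star_of, star_of, star_star]
  | hadd x y hx hy => rw [star_add', star_add', hx, hy]
  | hzero => rw [star_zero', star_zero']
  | hmul x y hx hy => rw [star_mul', star_mul', hx, hy]
  | hsmul c x hx => rw [star_smul', star_smul', hx, star_star]

instance : StarRing (FreeProd A) where
  star_involutive := star_star'
  star_mul := star_mul'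
  star_add := star_add'

instance : StarModule ℂ (FreeProd A) := ⟨star_smul'⟩

end FreeProd

end StarFreeProd

/-! ### Multi-faced algebras -/

/-- A multi-faced algebra with set of faces `F`: a complex algebra `A` (not necessarily unital)
which is freely generated by subalgebras `A.face f`, `f : F`, i.e. the canonical homomorphism
from the free product of the `A.face f` to `A` is bijective. -/
structure MFAlg (F : Type v) where
  carrier : Type u
  [ring : NonUnitalRing carrier]
  [module : Module ℂ carrier]
  [tower : IsScalarTower ℂ carrier carrier]
  [comm : SMulCommClass ℂ carrier carrier]
  face : F → NonUnitalSubalgebra ℂ carrier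
  free : Function.Bijective
    (FreeProd.lift (A := fun f => face f) (fun f => NonUnitalSubalgebraClass.subtype (face f)))

attribute [instance] MFAlg.ring MFAlg.module MFAlg.tower MFAlg.comm

variable {F : Type v}

instance : CoeSort (MFAlg.{u} F) (Type u) := ⟨MFAlg.carrier⟩

/-- A multi-faced algebra homomorphism: an algebra homomorphism which maps faces to faces. -/
structure MFHom (A B : MFAlg.{u} F) where
  hom : A →ₙₐ[ℂ] B
  map_face : ∀ f, ∀ x ∈ A.face f, hom x ∈ B.face f

namespace MFAlg

/-- Homomorphisms out of a multi-faced algebra may be prescribed on the faces. -/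
theorem exists_hom (A : MFAlg.{u} F) {C : Type w} [NonUnitalRing C] [Module ℂ C]
    [IsScalarTower ℂ C C] [SMulCommClass ℂ C C] (g : ∀ f, A.face f →ₙₐ[ℂ] C) :
    ∃ h : A →ₙₐ[ℂ] C, ∀ f (x : A.face f), h x = g f x := by
  let L := FreeProd.lift (A := fun f => A.face f)
    (fun f => NonUnitalSubalgebraClass.subtype (A.face f))
  let e := Equiv.ofBijective L A.free
  have he : ∀ x, e.symm (L x) = x := fun x => e.symm_apply_apply x
  have hs : Function.Surjective L := A.free.2
  refine ⟨(FreeProd.lift g).comp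
    { toFun := e.symm
      map_smul' := ?_
      map_zero' := ?_
      map_add' := ?_
      map_mul' := ?_ }, ?_⟩
  · intro c x
    obtain ⟨x, rfl⟩ := hs x
    rw [← map_smul, he, he]; rfl
  · change e.symm 0 = 0
    rw [← map_zero L, he]
  · intro x y
    obtain ⟨x, rfl⟩ := hs x
    obtain ⟨y, rfl⟩ := hs y
    change e.symm (L x + L y) = e.symm (L x) + e.symm (L y)
    rw [← map_add, he, he, he]
  · intro x y
    obtain ⟨x, rfl⟩ := hs x
    obtain ⟨y, rfl⟩ := hs y
    change e.symm (L x * L y) = e.symm (L x) * e.symm (L y)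
    rw [← map_mul, he, he, he]
  · intro f x
    have hx : L (FreeProd.of (A := fun f => A.face f) f x) = x :=
      FreeProd.lift_of (A := fun f => A.face f)
        (fun f => NonUnitalSubalgebraClass.subtype (A.face f)) f x
    change FreeProd.lift g (e.symm x) = g f x
    rw [← hx, he, FreeProd.lift_of]

/-- Homomorphisms out of a multi-faced algebra which agree on the faces are equal. -/
theorem hom_ext (A : MFAlg.{u} F) {C : Type w} [NonUnitalRing C] [Module ℂ C]
    [IsScalarTower ℂ C C] [SMulCommClass ℂ C C] {g h : A →ₙₐ[ℂ] C} (H : ∀ f, ∀ x ∈ A.face f, g x = h x) : g = h := by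
  let L := FreeProd.lift (A := fun f => A.face f)
    (fun f => NonUnitalSubalgebraClass.subtype (A.face f))
  have key : g.comp L = h.comp L := FreeProd.hom_ext (fun f x => by
    have hx : L (FreeProd.of (A := fun f => A.face f) f x) = x :=
      FreeProd.lift_of (A := fun f => A.face f)
        (fun f => NonUnitalSubalgebraClass.subtype (A.face f)) f x
    change g (L _) = h (L _)
    rw [hx]; exact H f x x.2)
  ext x
  obtain ⟨y, rfl⟩ := A.free.2 x
  exact DFunLike.congr_fun key y

/-- The two-element family `A, B`, indexed by `true` and `false`. -/
abbrev pair (A B : MFAlg.{u} F) (b : Bool) : MFAlg.{u} F := cond b A B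

/-- The underlying algebra of the free product of two multi-faced algebras. -/
abbrev CoprodCarrier (A B : MFAlg.{u} F) : Type u := FreeProd (fun b => (pair A B b).carrier)

section

variable (A B : MFAlg.{u} F)

/-- The canonical homomorphism `A → A ⊔ B` -/
def inlHom : A →ₙₐ[ℂ] CoprodCarrier A B := FreeProd.of (A := fun b => (pair A B b).carrier) true

/-- The canonical homomorphism `B → A ⊔ B` -/
def inrHom : B →ₙₐ[ℂ] CoprodCarrier A B := FreeProd.of (A := fun b => (pair A B b).carrier) false

/-- The face `(A ⊔ B).face f = A.face f ⊔ B.face f`, as a subalgebra of `A ⊔ B`: the subalgebra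
generated by the images of `A.face f` and `B.face f`. -/
def coprodFace (f : F) : NonUnitalSubalgebra ℂ (CoprodCarrier A B) :=
  NonUnitalAlgebra.adjoin ℂ (inlHom A B '' A.face f ∪ inrHom A B '' B.face f)

variable {A B} {C : Type w} [NonUnitalRing C] [Module ℂ C]
  [IsScalarTower ℂ C C] [SMulCommClass ℂ C C]

/-- The homomorphism `A ⊔ B → C` with given restrictions to `A` and `B`. -/
def coprodLift (g : A →ₙₐ[ℂ] C) (h : B →ₙₐ[ℂ] C) : CoprodCarrier A B →ₙₐ[ℂ] C :=
  FreeProd.lift (A := fun b => (pair A B b).carrier)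
    (fun b => match b with
      | true => g
      | false => h)

@[simp] theorem coprodLift_inl (g : A →ₙₐ[ℂ] C) (h : B →ₙₐ[ℂ] C) (a : A) :
    coprodLift g h (inlHom A B a) = g a :=
  FreeProd.lift_of (A := fun b => (pair A B b).carrier) _ true a

@[simp] theorem coprodLift_inr (g : A →ₙₐ[ℂ] C) (h : B →ₙₐ[ℂ] C) (b : B) :
    coprodLift g h (inrHom A B b) = h b :=
  FreeProd.lift_of (A := fun b => (pair A B b).carrier) _ false b

theorem coprod_hom_ext {g h : CoprodCarrier A B →ₙₐ[ℂ] C}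
    (hl : ∀ a, g (inlHom A B a) = h (inlHom A B a))
    (hr : ∀ b, g (inrHom A B b) = h (inrHom A B b)) : g = h :=
  FreeProd.hom_ext (A := fun b => (pair A B b).carrier) (fun b => match b with
      | true => hl
      | false => hr)

variable (A B)

theorem coprod_free : Function.Bijective (FreeProd.lift (A := fun f => coprodFace A B f)
    (fun f => NonUnitalSubalgebraClass.subtype (coprodFace A B f))) := by
  set L := FreeProd.lift (A := fun f => coprodFace A B f)
    (fun f => NonUnitalSubalgebraClass.subtype (coprodFace A B f)) with hL
  have hLof : ∀ f (x : coprodFace A B f), L (FreeProd.of (A := fun f => coprodFace A B f) f x) = x :=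
    fun f x => FreeProd.lift_of (A := fun f => coprodFace A B f)
      (fun f => NonUnitalSubalgebraClass.subtype (coprodFace A B f)) f x
  have ml : ∀ f (x : A.face f), inlHom A B x ∈ coprodFace A B f := fun f x =>
    NonUnitalAlgebra.subset_adjoin ℂ (Or.inl ⟨x, x.2, rfl⟩)
  have mr : ∀ f (x : B.face f), inrHom A B x ∈ coprodFace A B f := fun f x =>
    NonUnitalAlgebra.subset_adjoin ℂ (Or.inr ⟨x, x.2, rfl⟩)
  obtain ⟨g, hg⟩ := A.exists_hom (C := FreeProd (fun f => coprodFace A B f))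
    (fun f => (FreeProd.of (A := fun f => coprodFace A B f) f).comp
      (NonUnitalAlgHom.codRestrict
        ((inlHom A B).comp (NonUnitalSubalgebraClass.subtype (A.face f))) (coprodFace A B f)
        (ml f)))
  obtain ⟨h, hh⟩ := B.exists_hom (C := FreeProd (fun f => coprodFace A B f))
    (fun f => (FreeProd.of (A := fun f => coprodFace A B f) f).comp
      (NonUnitalAlgHom.codRestrict
        ((inrHom A B).comp (NonUnitalSubalgebraClass.subtype (B.face f))) (coprodFace A B f)
        (mr f)))
  have hg' : ∀ f (x : A.face f), g x = FreeProd.of (A := fun f => coprodFace A B f) f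
      ⟨inlHom A B x, ml f x⟩ := hg
  have hh' : ∀ f (x : B.face f), h x = FreeProd.of (A := fun f => coprodFace A B f) f
      ⟨inrHom A B x, mr f x⟩ := hh
  let M := coprodLift g h
  have hM : ∀ f x (hx : x ∈ coprodFace A B f),
      M x = FreeProd.of (A := fun f => coprodFace A B f) f ⟨x, hx⟩ := by
    intro f x hx
    refine NonUnitalAlgebra.adjoin_induction
      (p := fun x hx => M x = FreeProd.of (A := fun f => coprodFace A B f) f ⟨x, hx⟩)
      ?_ ?_ ?_ ?_ ?_ hx
    · rintro x (⟨a, ha, rfl⟩ | ⟨b, hb, rfl⟩)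
      · exact (coprodLift_inl g h a).trans (hg' f ⟨a, ha⟩)
      · exact (coprodLift_inr g h b).trans (hh' f ⟨b, hb⟩)
    · intro x y hx hy h1 h2
      rw [map_add, h1, h2, ← map_add]; rfl
    · rw [map_zero]; exact (map_zero _).symm
    · intro x y hx hy h1 h2
      rw [map_mul, h1, h2, ← map_mul]; rfl
    · intro c x hx h1
      rw [map_smul, h1, ← map_smul]; rfl
  have h1 : ∀ x, M (L x) = x := by
    intro x
    have : M.comp L = NonUnitalAlgHom.id ℂ _ := FreeProd.hom_ext (fun f x => by
      change M (L _) = FreeProd.of (A := fun f => coprodFace A B f) f x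
      rw [hLof]; exact hM f x x.2)
    exact DFunLike.congr_fun this x
  have h2 : ∀ x, L (M x) = x := by
    intro x
    have : L.comp M = NonUnitalAlgHom.id ℂ _ := by
      apply coprod_hom_ext
      · intro a
        have : (L.comp g) = inlHom A B := A.hom_ext (fun f x hx => by
          change L (g x) = _
          rw [hg' f ⟨x, hx⟩, hLof])
        change L (coprodLift g h _) = _
        rw [coprodLift_inl]
        exact DFunLike.congr_fun this a
      · intro b
        have : (L.comp h) = inrHom A B := B.hom_ext (fun f x hx => by
          change L (h x) = _
          rw [hh' f ⟨x, hx⟩, hLof])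
        change L (coprodLift g h _) = _
        rw [coprodLift_inr]
        exact DFunLike.congr_fun this b
    exact DFunLike.congr_fun this x
  exact Function.bijective_iff_has_inverse.2 ⟨M, h1, h2⟩

end

/-- The free product `A ⊔ B` of two multi-faced algebras, with faces `A.face f ⊔ B.face f`. -/
def coprod (A B : MFAlg.{u} F) : MFAlg.{u} F where
  carrier := CoprodCarrier A B
  face := coprodFace A B
  free := coprod_free A B

/-- The canonical inclusion `A → A ⊔ B`. -/
def inl (A B : MFAlg.{u} F) : MFHom A (coprod A B) where
  hom := inlHom A B
  map_face := fun f x hx => show inlHom A B x ∈ coprodFace A B f from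
    NonUnitalAlgebra.subset_adjoin ℂ (Or.inl ⟨x, hx, rfl⟩)

/-- The canonical inclusion `B → A ⊔ B`. -/
def inr (A B : MFAlg.{u} F) : MFHom B (coprod A B) where
  hom := inrHom A B
  map_face := fun f x hx => show inrHom A B x ∈ coprodFace A B f from
    NonUnitalAlgebra.subset_adjoin ℂ (Or.inr ⟨x, hx, rfl⟩)

/-- The homomorphism `g ⊔ h : A ⊔ B → C` with restriction `g` to `A` and `h` to `B`. -/
def desc {A B C : MFAlg.{u} F} (g : A →ₙₐ[ℂ] C) (h : B →ₙₐ[ℂ] C) : coprod A B →ₙₐ[ℂ] C :=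
  coprodLift g h

@[simp] theorem desc_inl {A B C : MFAlg.{u} F} (g : A →ₙₐ[ℂ] C) (h : B →ₙₐ[ℂ] C) (a : A) :
    desc g h ((inl A B).hom a) = g a := coprodLift_inl g h a

@[simp] theorem desc_inr {A B C : MFAlg.{u} F} (g : A →ₙₐ[ℂ] C) (h : B →ₙₐ[ℂ] C) (b : B) :
    desc g h ((inr A B).hom b) = h b := coprodLift_inr g h b

theorem desc_ext {A B C : MFAlg.{u} F} {g h : coprod A B →ₙₐ[ℂ] C}
    (hl : ∀ a, g ((inl A B).hom a) = h ((inl A B).hom a))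
    (hr : ∀ b, g ((inr A B).hom b) = h ((inr A B).hom b)) : g = h := coprod_hom_ext hl hr

/-- The homomorphism `h₁ ⊔ h₂ : B₁ ⊔ B₂ → A₁ ⊔ A₂`. -/
def coprodMap {A₁ A₂ B₁ B₂ : MFAlg.{u} F} (h₁ : MFHom B₁ A₁) (h₂ : MFHom B₂ A₂) :
    coprod B₁ B₂ →ₙₐ[ℂ] coprod A₁ A₂ :=
  desc ((inl A₁ A₂).hom.comp h₁.hom) ((inr A₁ A₂).hom.comp h₂.hom)

/-- The canonical isomorphism `(A ⊔ B) ⊔ C → A ⊔ (B ⊔ C)`. -/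
def coprodAssoc (A B C : MFAlg.{u} F) :
    coprod (coprod A B) C →ₙₐ[ℂ] coprod A (coprod B C) :=
  desc (desc (inl A (coprod B C)).hom ((inr A (coprod B C)).hom.comp (inl B C).hom))
    ((inr A (coprod B C)).hom.comp (inr B C).hom)

end MFAlg

/-- A multi-faced `*`-algebra: a multi-faced algebra with an involution such that each face is a
`*`-subalgebra. -/
structure MFStarAlg (F : Type v) extends MFAlg.{u} F where
  [starRing : StarRing carrier]
  [starModule : StarModule ℂ carrier]
  star_mem_face : ∀ f, ∀ x ∈ face f, star x ∈ face f

attribute [instance] MFStarAlg.starRing MFStarAlg.starModule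

namespace MFStarAlg

instance pairStarRing (A B : MFStarAlg.{u} F) :
    ∀ b, StarRing (MFAlg.pair A.toMFAlg B.toMFAlg b).carrier
  | true => A.starRing
  | false => B.starRing

instance pairStarModule (A B : MFStarAlg.{u} F) :
    ∀ b, StarModule ℂ (MFAlg.pair A.toMFAlg B.toMFAlg b).carrier
  | true => A.starModule
  | false => B.starModule

instance coprodStarRing (A B : MFStarAlg.{u} F) :
    StarRing (MFAlg.coprod A.toMFAlg B.toMFAlg).carrier :=
  inferInstanceAs (StarRing (FreeProd fun b => (MFAlg.pair A.toMFAlg B.toMFAlg b).carrier))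

instance coprodStarModule (A B : MFStarAlg.{u} F) :
    StarModule ℂ (MFAlg.coprod A.toMFAlg B.toMFAlg).carrier :=
  inferInstanceAs (StarModule ℂ (FreeProd fun b => (MFAlg.pair A.toMFAlg B.toMFAlg b).carrier))

theorem star_inl (A B : MFStarAlg.{u} F) (a : A.carrier) :
    star ((MFAlg.inl A.toMFAlg B.toMFAlg).hom a) = (MFAlg.inl A.toMFAlg B.toMFAlg).hom (star a) :=
  FreeProd.star_of (A := fun b => (MFAlg.pair A.toMFAlg B.toMFAlg b).carrier) true a

theorem star_inr (A B : MFStarAlg.{u} F) (b : B.carrier) :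
    star ((MFAlg.inr A.toMFAlg B.toMFAlg).hom b) = (MFAlg.inr A.toMFAlg B.toMFAlg).hom (star b) :=
  FreeProd.star_of (A := fun b => (MFAlg.pair A.toMFAlg B.toMFAlg b).carrier) false b

theorem coprod_star_mem_face (A B : MFStarAlg.{u} F) (f : F)
    (x : MFAlg.CoprodCarrier A.toMFAlg B.toMFAlg)
    (hx : x ∈ MFAlg.coprodFace A.toMFAlg B.toMFAlg f) :
    star x ∈ MFAlg.coprodFace A.toMFAlg B.toMFAlg f := by
  refine NonUnitalAlgebra.adjoin_induction
    (p := fun x _ => star x ∈ MFAlg.coprodFace A.toMFAlg B.toMFAlg f) ?_ ?_ ?_ ?_ ?_ hx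
  · rintro x (⟨a, ha, rfl⟩ | ⟨b, hb, rfl⟩)
    · have h := (MFAlg.inl A.toMFAlg B.toMFAlg).map_face f _ (A.star_mem_face f a ha)
      rw [← star_inl] at h
      exact h
    · have h := (MFAlg.inr A.toMFAlg B.toMFAlg).map_face f _ (B.star_mem_face f b hb)
      rw [← star_inr] at h
      exact h
  · intro x y _ _ h1 h2
    rw [FreeProd.star_add']
    exact add_mem h1 h2
  · rw [FreeProd.star_zero']
    exact zero_mem _
  · intro x y _ _ h1 h2
    rw [FreeProd.star_mul']
    exact mul_mem h2 h1
  · intro c x _ h1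
    rw [FreeProd.star_smul']
    exact SMulMemClass.smul_mem _ h1

/-- The free product of multi-faced `*`-algebras, with the involution which extends the
involutions of the factors. -/
def coprod (A B : MFStarAlg.{u} F) : MFStarAlg.{u} F where
  toMFAlg := MFAlg.coprod A.toMFAlg B.toMFAlg
  starRing := coprodStarRing A B
  starModule := coprodStarModule A B
  star_mem_face := coprod_star_mem_face A B

end MFStarAlg

/-! ### Universal products -/

/-- The linear functionals on a multi-faced algebra. -/
abbrev Functional (A : MFAlg.{u} F) : Type u := A →ₗ[ℂ] ℂ

/-- The composition `φ ∘ h` of a linear functional with an algebra homomorphism. -/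
def Functional.comp {A B : MFAlg.{u} F} (φ : Functional A) (h : B →ₙₐ[ℂ] A) : Functional B :=
  LinearMap.comp φ (h : B →ₗ[ℂ] A)

/-- A multi-faced universal product: it associates with linear functionals `φ₁`, `φ₂` on arbitrary
multi-faced algebras `A₁`, `A₂` a linear functional on `A₁ ⊔ A₂`. -/
structure UniversalProduct (F : Type v) where
  prod : ∀ {A₁ A₂ : MFAlg.{u} F}, Functional A₁ → Functional A₂ → Functional (A₁.coprod A₂)
  /-- universality -/
  universal : ∀ {A₁ A₂ B₁ B₂ : MFAlg.{u} F} (h₁ : MFHom B₁ A₁) (h₂ : MFHom B₂ A₂)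
    (φ₁ : Functional A₁) (φ₂ : Functional A₂),
    prod (φ₁.comp h₁.hom) (φ₂.comp h₂.hom) = (prod φ₁ φ₂).comp (MFAlg.coprodMap h₁ h₂)
  /-- associativity -/
  assoc : ∀ {A₁ A₂ A₃ : MFAlg.{u} F} (φ₁ : Functional A₁) (φ₂ : Functional A₂)
    (φ₃ : Functional A₃),
    prod (prod φ₁ φ₂) φ₃ = (prod φ₁ (prod φ₂ φ₃)).comp (MFAlg.coprodAssoc A₁ A₂ A₃)
  /-- restriction property -/
  restrict_left : ∀ {A₁ A₂ : MFAlg.{u} F} (φ₁ : Functional A₁) (φ₂ : Functional A₂),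
    (prod φ₁ φ₂).comp (MFAlg.inl A₁ A₂).hom = φ₁
  restrict_right : ∀ {A₁ A₂ : MFAlg.{u} F} (φ₁ : Functional A₁) (φ₂ : Functional A₂),
    (prod φ₁ φ₂).comp (MFAlg.inr A₁ A₂).hom = φ₂

/-- The unital extension `λ + a ↦ λ + φ a` of a linear functional to the unitization. -/
def unitalExt {A : MFAlg.{u} F} (φ : Functional A) (x : Unitization ℂ A) : ℂ := x.fst + φ x.snd

/-- A linear functional on a multi-faced `*`-algebra is a restricted state if its unital extension
to the unitization is positive. -/
def IsRestrictedState (A : MFStarAlg.{u} F) (φ : Functional A.toMFAlg) : Prop :=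
  ∀ x : Unitization ℂ A.carrier, 0 ≤ unitalExt φ (star x * x)

namespace UniversalProduct

/-- A universal product is positive if the product of restricted states on multi-faced
`*`-algebras is a restricted state on the free product `*`-algebra. -/
def IsPositive (P : UniversalProduct.{u} F) : Prop :=
  ∀ (A B : MFStarAlg.{u} F) (φ : Functional A.toMFAlg) (ψ : Functional B.toMFAlg),
    IsRestrictedState A φ → IsRestrictedState B ψ → IsRestrictedState (A.coprod B) (P.prod φ ψ)

end UniversalProduct

/-! ### Products of several functionals

Families of `K ≥ 1` algebras are indexed by `Fin (k + 1)`, `K = k + 1`. -/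

/-- The free product `A 0 ⊔ A 1 ⊔ ⋯ ⊔ A k` (bracketed from the left). -/
def iterAlg : (k : ℕ) → (Fin (k + 1) → MFAlg.{u} F) → MFAlg.{u} F
  | 0, A => A 0
  | k + 1, A => (iterAlg k (fun i => A i.castSucc)).coprod (A (Fin.last (k + 1)))

/-- The canonical inclusion of `A i` into `A 0 ⊔ ⋯ ⊔ A k`. -/
def iterIncl : (k : ℕ) → (A : Fin (k + 1) → MFAlg.{u} F) → (i : Fin (k + 1)) →
    (A i →ₙₐ[ℂ] iterAlg k A)
  | 0, A, i => Fin.cases (motive := fun i => A i →ₙₐ[ℂ] iterAlg 0 A)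
      (NonUnitalAlgHom.id ℂ (A 0)) (fun j => j.elim0) i
  | k + 1, A, i => Fin.lastCases (motive := fun i => A i →ₙₐ[ℂ] iterAlg (k + 1) A)
      (MFAlg.inr (iterAlg k (fun i => A i.castSucc)) (A (Fin.last (k + 1)))).hom
      (fun j => (MFAlg.inl (iterAlg k (fun i => A i.castSucc)) (A (Fin.last (k + 1)))).hom.comp
        (iterIncl k (fun i => A i.castSucc) j)) i

/-- The product functional `φ 0 ⊙ φ 1 ⊙ ⋯ ⊙ φ k` on `A 0 ⊔ ⋯ ⊔ A k`. -/
def UniversalProduct.iterProd (P : UniversalProduct.{u} F) :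
    (k : ℕ) → (A : Fin (k + 1) → MFAlg.{u} F) → (∀ i, Functional (A i)) →
      Functional (iterAlg k A)
  | 0, _, φ => φ 0
  | k + 1, A, φ =>
      P.prod (UniversalProduct.iterProd P k (fun i => A i.castSucc) (fun i => φ i.castSucc))
        (φ (Fin.last (k + 1)))

/-- The product, from left to right, of a nonempty list of elements of an algebra which need not
have a unit (the value `0` for the empty list is never used). -/
def orderedProd {A : Type w} [Mul A] [Zero A] : List A → A
  | [] => 0
  | [a] => a
  | a :: b :: l => a * orderedProd (b :: l)

/-! ### Coefficients of a universal product

A word `s = b × f` in `([K] × F)^*` is a list of pairs (block index, face). -/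

section Coefficients

open scoped Classical

/-- The set `β_κ(s)` of positions of `s` with block index `κ`. -/
def blockSet {k : ℕ} (s : List (Fin (k + 1) × F)) (κ : Fin (k + 1)) : Finset (Fin s.length) :=
  Finset.univ.filter (fun i => (s.get i).1 = κ)

/-- The set partition `π` of the set of positions of `s` is adapted to `s`. -/
structure Adapted {k : ℕ} (s : List (Fin (k + 1) × F))
    (π : Finpartition (Finset.univ : Finset (Fin s.length))) : Prop where
  refines : ∀ β ∈ π.parts, ∃ κ, β ⊆ blockSet s κ
  neighbours : ∀ i j : Fin s.length, (i : ℕ) + 1 = j → s.get i = s.get j →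
    ∃ β ∈ π.parts, i ∈ β ∧ j ∈ β

/-- The maximal partition adapted to `s`, whose blocks are the nonempty sets among the
`β_κ(s)`. -/
def maxPartition {k : ℕ} (s : List (Fin (k + 1) × F)) :
    Finpartition (Finset.univ : Finset (Fin s.length)) :=
  Finpartition.ofSetoid (Setoid.ker (fun i => (s.get i).1))

/-- Families of complex numbers `α k s π`, to be used for words `s` in `([k + 1] × F)^*` and set
partitions `π` adapted to `s`. -/
abbrev CoeffFamily (F : Type v) : Type v :=
  ∀ (k : ℕ) (s : List (Fin (k + 1) × F)),
    Finpartition (Finset.univ : Finset (Fin s.length)) → ℂ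

/-- The family `α` consists of the coefficients of the universal product `P`: for all functionals
`φ κ` on multi-faced algebras `A κ` and all `a = a_1 ⋯ a_n` with
`a_i ∈ (A (b i)).face (f i)`, where `s = b × f`, the value
`(φ 0 ⊙ ⋯ ⊙ φ k) a` is the sum over all `π` adapted to `s` of `α k s π` times the product, over all
`κ` and all blocks `β ∈ π` with `β ⊆ β_κ(s)`, of the moments `φ κ (∏ a_ℓ, ℓ ∈ β)`, the factors
`a_ℓ` being multiplied in increasing order of `ℓ`.

Here the element `a_i` is `x (b i) i`; the values `x κ i` with `κ ≠ b i` play no role. -/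
def UniversalProduct.IsCoefficients (P : UniversalProduct.{u} F) (α : CoeffFamily F) : Prop :=
  ∀ (k : ℕ) (s : List (Fin (k + 1) × F)), s ≠ [] →
  ∀ (A : Fin (k + 1) → MFAlg.{u} F) (φ : ∀ κ, Functional (A κ))
    (x : ∀ κ, Fin s.length → A κ),
    (∀ i, x (s.get i).1 i ∈ (A (s.get i).1).face (s.get i).2) →
    P.iterProd k A φ
        (orderedProd (List.ofFn (fun i => iterIncl k A (s.get i).1 (x (s.get i).1 i)))) =
      ∑ π ∈ Finset.univ.filter (Adapted s),
        α k s π * ∏ κ, ∏ β ∈ π.parts.filter (fun β => β ⊆ blockSet s κ),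
          φ κ (orderedProd (((List.finRange s.length).filter (fun l => l ∈ β)).map (x κ)))

end Coefficients

/-! ### Ordered multi-faced partitions -/

/-- A (nonempty) ordered multi-faced partition `π = {β_0 < β_1 < ⋯ < β_k}` with `k + 1` blocks: a
face structure on `{1, …, n}` together with a set partition of `{1, …, n}` and a total order
between the blocks. It is encoded by the word whose `ℓ`-th entry is the pair formed by
the number `κ` of the block `β_κ` which contains `ℓ` and by the face of `ℓ`;
every `κ` has to occur, since blocks are nonempty. -/
@[ext] structure OrderedPartition (F : Type v) (k : ℕ) where
  word : List (Fin (k + 1) × F)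
  block_nonempty : ∀ κ, ∃ f, (κ, f) ∈ word

namespace OrderedPartition

theorem mem_destutter_ne {α : Type w} [DecidableEq α] {x : α} :
    ∀ (l : List α) (a : α), x ∈ a :: l → x ∈ l.destutter' (· ≠ ·) a
  | [], a, h => by simpa using h
  | b :: l, a, h => by
    by_cases hab : a = b
    · subst hab
      rw [List.destutter'_cons_neg _ (by simp)]
      exact mem_destutter_ne l a (by simpa using h)
    · rw [List.destutter'_cons_pos _ (by exact hab)]
      rcases List.mem_cons.1 h with rfl | h
      · exact List.mem_cons_self
      · exact List.mem_cons_of_mem _ (mem_destutter_ne l b h)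

open scoped Classical in
/-- The reduction `π_red`: each maximal interval of legs in the same face and in the same block is
replaced by a single leg, i.e. consecutive repetitions in the word are removed. -/
def red {k : ℕ} (π : OrderedPartition F k) : OrderedPartition F k where
  word := π.word.destutter (· ≠ ·)
  block_nonempty := fun κ => by
    obtain ⟨f, hf⟩ := π.block_nonempty κ
    refine ⟨f, ?_⟩
    cases hw : π.word with
    | nil => rw [hw] at hf; simp at hf
    | cons a l => rw [hw] at hf; exact mem_destutter_ne l a hf

/-- The mirror image of `π`: the order of the legs is reversed, the block order is not. -/
def mirror {k : ℕ} (π : OrderedPartition F k) : OrderedPartition F k where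
  word := π.word.reverse
  block_nonempty := fun κ => by simpa using π.block_nonempty κ

/-- For the neighbouring blocks `β_κ < β_{κ+1}` of `π`, the ordered partition
`{β_0 < ⋯ < β_κ ∪ β_{κ+1} < ⋯}` obtained by uniting them. -/
def unite {k : ℕ} (π : OrderedPartition F (k + 1)) (κ : Fin (k + 1)) : OrderedPartition F k where
  word := π.word.map (fun p => (κ.predAbove p.1, p.2))
  block_nonempty := fun j => by
    obtain ⟨i, rfl⟩ := Fin.predAbove_surjective κ j
    obtain ⟨f, hf⟩ := π.block_nonempty i
    exact ⟨f, List.mem_map.2 ⟨(i, f), hf, rfl⟩⟩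

/-- For the neighbouring blocks `β_κ < β_{κ+1}` of `π`, the ordered partition
`{β_κ < β_{κ+1}}` of the multi-faced set `β_κ ∪ β_{κ+1}`. -/
def restrictPair {k : ℕ} (π : OrderedPartition F (k + 1)) (κ : Fin (k + 1)) :
    OrderedPartition F 1 where
  word := π.word.filterMap (fun p =>
    if p.1 = κ.castSucc then some (0, p.2) else if p.1 = κ.succ then some (1, p.2) else none)
  block_nonempty := fun j => by
    obtain ⟨f, hf⟩ := π.block_nonempty κ.castSucc
    obtain ⟨g, hg⟩ := π.block_nonempty κ.succ
    have hne : κ.succ ≠ κ.castSucc := Fin.castSucc_lt_succ.ne'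
    match j with
    | 0 => exact ⟨f, List.mem_filterMap.2 ⟨_, hf, by simp⟩⟩
    | 1 => exact ⟨g, List.mem_filterMap.2 ⟨_, hg, by simp [hne]⟩⟩

/-- The blocks `β_κ < β_{κ+1}` of `π` have neighbouring legs in the same face. -/
def HasNeighbouringLegs {k : ℕ} (π : OrderedPartition F (k + 1)) (κ : Fin (k + 1)) : Prop :=
  ∃ i j : Fin π.word.length, ((i : ℕ) + 1 = j ∨ (j : ℕ) + 1 = i) ∧
    (π.word.get i).1 = κ.castSucc ∧ (π.word.get j).1 = κ.succ ∧
    (π.word.get i).2 = (π.word.get j).2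

/-- `π` and `σ` only differ in the faces of the extremal (i.e. first and last) legs. -/
def DifferInExtremalFaces {k : ℕ} (π σ : OrderedPartition F k) : Prop :=
  π.word.map Prod.fst = σ.word.map Prod.fst ∧
    ∀ i : ℕ, 0 < i → i + 1 < π.word.length → π.word[i]? = σ.word[i]?

/-- The ordered partition `{{1} < {2}}` with face structure `f g`. -/
def twoPoints (f g : F) : OrderedPartition F 1 where
  word := [(0, f), (1, g)]
  block_nonempty := fun j => match j with
    | 0 => ⟨f, by simp⟩
    | 1 => ⟨g, by simp⟩

/-- The ordered partition `{{2} < {1}}` with face structure `f g`. -/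
def twoPointsRev (f g : F) : OrderedPartition F 1 where
  word := [(1, f), (0, g)]
  block_nonempty := fun j => match j with
    | 0 => ⟨g, by simp⟩
    | 1 => ⟨f, by simp⟩

end OrderedPartition

/-- Weights on ordered partitions: `w k π` is the weight of the ordered multi-faced partition `π`
with `k + 1` blocks. -/
abbrev Weights (F : Type v) : Type v := ∀ k : ℕ, OrderedPartition F k → ℂ

/-- `w` is the family of highest coefficients of the universal product `P`: `w k π` is the
coefficient of `P` for the word `s_π` and the maximal partition adapted to it. -/
def UniversalProduct.IsHighestCoefficients (P : UniversalProduct.{u} F) (w : Weights F) : Prop :=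
  ∃ α : CoeffFamily F, P.IsCoefficients α ∧
    ∀ (k : ℕ) (π : OrderedPartition F k), w k π = α k π.word (maxPartition π.word)

end MultiFaced

end

open MultiFaced

/-!
The values of products of functionals on words are studied through a single kind of data: a unital
algebra `C`, unital functionals `Φ κ` on `C`, one for each factor, and words whose letters
`((κ, f), c)` are elements `c` of `C` placed into the face `f` of the factor `κ`. Universality
reduces arbitrary multi-faced algebras to this case, with `copies F C` as the factors
(`iterProd_eq_wordValue`), and it shows that the value `wordValue P Φ l` only depends on the
moments of the letters (`wordValue_congr`).

*Existence of the coefficients.* Only moments without repetition of a letter matter: tensoring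
a letter with `2 × 2` matrices, and using that a letter all of whose moments vanish may be replaced
by `0`, one may change the moments with repetitions (`exists_truncation`). The remaining moments
can be prescribed in one fixed model: a direct sum of matrix algebras, one for each word without
repetitions, with a vector state (`wordState_prod`). Multilinear expansion in this model gives
a formula for the value of a word, with universal coefficients times products of moments
(`wordValue_eq_sum`). A coefficient vanishes unless it belongs to an adapted set partition with
increasingly ordered blocks. Vanishing moments give the decomposition into blocks. Their order is
where positivity enters: if the letters of a block are multiplied in the wrong order, then some
final part `x` of the word satisfies `ψ (x⋆ x) = 0`, where `ψ` is the positive product functional,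
and then `ψ (y x) = 0` for all `y` by the Cauchy-Schwarz inequality
(`isChain_of_elementaryValue_ne_zero`).

*Properties of the highest coefficients.* Take for `Φ κ` the mean over the roots of unity whose
order is the size of the block `κ`, and for all letters the identity function `z`. Then the moments
of all proper parts of the blocks vanish, and the moments of the full blocks are `1`, so the value
of the word is exactly the highest coefficient (`wordValue_rootVariable`). This shows uniqueness,
and all properties follow by computing values of words in this model.
One-block partitions reduce to the restriction property. For a block of one point,
`z` has the moments of `1`. Neighbouring equal letters multiply to `z ^ 2`, which does not change
the highest coefficient (`highest_append_cons_cons`). For the extremal faces, an element of one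
factor acts on the cyclic vector in the same way through all faces
(`wordValue_append_singleton`). Mirror images come from the hermiticity of the product functional.
For neighbouring blocks with neighbouring legs in the same face, associativity allows to
multiply the two factors first. In the free product of these, the two neighbouring legs are merged
to one letter of the united block; then again the moments of proper parts vanish, while the
moment of the full united block is the highest coefficient of the pair (`highest_unite`).
-/

noncomputable section

namespace MultiFaced

/-! ### Copies of one algebra as faces -/

section Copies

variable (F : Type v) [Finite F] (C : Type u) [NonUnitalRing C] [Module ℂ C]
  [IsScalarTower ℂ C C] [SMulCommClass ℂ C C]

/-- The free product of copies of `C`, one for each face. The copies are indexed by `Fin` instead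
of `F` in order to stay in the universe of `C`. -/
abbrev CopiesCarrier : Type u := FreeProd (fun _ : Fin (Nat.card F) => C)

/-- The inclusion of `C` as the copy which belongs to the face `f`. -/
def copiesEmb (f : F) : C →ₙₐ[ℂ] CopiesCarrier F C :=
  FreeProd.of (A := fun _ : Fin (Nat.card F) => C) (Finite.equivFin F f)

/-- The subalgebra formed by the copy of `C` which belongs to the face `f`. -/
def copiesFace (f : F) : NonUnitalSubalgebra ℂ (CopiesCarrier F C) :=
  NonUnitalAlgHom.range (copiesEmb F C f)

theorem copiesEmb_mem (f : F) (c : C) : copiesEmb F C f c ∈ copiesFace F C f := ⟨c, rfl⟩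

/-- Up to the choice of the index set, the free product of the copies is the free product of the
faces. -/
theorem copies_free : Function.Bijective (FreeProd.lift (A := fun f => copiesFace F C f)
    (fun f => NonUnitalSubalgebraClass.subtype (copiesFace F C f))) := by
  set L := FreeProd.lift (A := fun f => copiesFace F C f)
    (fun f => NonUnitalSubalgebraClass.subtype (copiesFace F C f))
  have hL : ∀ f (x : copiesFace F C f), L (FreeProd.of (A := fun f => copiesFace F C f) f x) = x :=
    fun f x => FreeProd.lift_of (A := fun f => copiesFace F C f)
      (fun f => NonUnitalSubalgebraClass.subtype (copiesFace F C f)) f x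
  let M : CopiesCarrier F C →ₙₐ[ℂ] FreeProd (fun f => copiesFace F C f) :=
    FreeProd.lift (A := fun _ : Fin (Nat.card F) => C) (fun i =>
      (FreeProd.of (A := fun f => copiesFace F C f) ((Finite.equivFin F).symm i)).comp
        (NonUnitalAlgHom.codRestrict (copiesEmb F C ((Finite.equivFin F).symm i))
          (copiesFace F C _) (copiesEmb_mem F C _)))
  have hM : ∀ f c, M (copiesEmb F C f c) =
      FreeProd.of (A := fun f => copiesFace F C f) f ⟨_, copiesEmb_mem F C f c⟩ := by
    intro f c
    have h1 : M (copiesEmb F C f c) = FreeProd.of (A := fun f => copiesFace F C f)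
        ((Finite.equivFin F).symm (Finite.equivFin F f)) ⟨_, copiesEmb_mem F C _ c⟩ :=
      FreeProd.lift_of (A := fun _ : Fin (Nat.card F) => C) _ (Finite.equivFin F f) c
    rw [h1]
    have h2 : ∀ f', f' = f → FreeProd.of (A := fun f => copiesFace F C f) f'
        ⟨_, copiesEmb_mem F C f' c⟩ = FreeProd.of (A := fun f => copiesFace F C f) f
        ⟨_, copiesEmb_mem F C f c⟩ := by
      rintro f' rfl; rfl
    exact h2 _ (Equiv.symm_apply_apply _ _)
  have h1 : M.comp L = NonUnitalAlgHom.id ℂ _ := FreeProd.hom_ext (fun f x => by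
    change M (L _) = FreeProd.of (A := fun f => copiesFace F C f) f x
    obtain ⟨x, c, rfl⟩ := x
    rw [hL]
    exact hM f c)
  have h2 : L.comp M = NonUnitalAlgHom.id ℂ _ :=
      FreeProd.hom_ext (A := fun _ : Fin (Nat.card F) => C) (fun i c => by
    obtain ⟨f, rfl⟩ := (Finite.equivFin F).surjective i
    change L (M (copiesEmb F C f c)) = copiesEmb F C f c
    rw [hM, hL])
  exact Function.bijective_iff_has_inverse.2
    ⟨M, fun x => DFunLike.congr_fun h1 x, fun x => DFunLike.congr_fun h2 x⟩

/-- The multi-faced algebra all of whose faces are copies of `C`. -/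
def copies : MFAlg.{u} F where
  carrier := CopiesCarrier F C
  face := copiesFace F C
  free := copies_free F C

variable {F C}

/-- The inclusion of `C` as the face `f` of `copies F C`. -/
def emb (f : F) : C →ₙₐ[ℂ] copies F C := copiesEmb F C f

theorem emb_mem (f : F) (c : C) : (emb f c : copies F C) ∈ (copies F C).face f := ⟨c, rfl⟩

section lift

variable {D : Type w} [NonUnitalRing D] [Module ℂ D] [IsScalarTower ℂ D D] [SMulCommClass ℂ D D]

theorem copies_hom_ext {g h : copies F C →ₙₐ[ℂ] D} (H : ∀ f c, g (emb f c) = h (emb f c)) :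
    g = h :=
  (copies F C).hom_ext (fun f x hx => by
    obtain ⟨c, rfl⟩ := hx
    exact H f c)

/-- The homomorphism on `copies F C` which equals `g` on each copy of `C`. -/
def fold (g : C →ₙₐ[ℂ] D) : copies F C →ₙₐ[ℂ] D :=
  FreeProd.lift (A := fun _ : Fin (Nat.card F) => C) (fun _ => g)

@[simp] theorem fold_emb (g : C →ₙₐ[ℂ] D) (f : F) (c : C) : fold g (emb f c : copies F C) = g c :=
  FreeProd.lift_of (A := fun _ : Fin (Nat.card F) => C) _ _ _

theorem exists_copies_lift (g : F → C →ₙₐ[ℂ] D) :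
    ∃ h : copies F C →ₙₐ[ℂ] D, ∀ f c, h (emb f c) = g f c := by
  refine ⟨FreeProd.lift (A := fun _ : Fin (Nat.card F) => C)
    (fun i => g ((Finite.equivFin F).symm i)), fun f c => ?_⟩
  have h := FreeProd.lift_of (A := fun _ : Fin (Nat.card F) => C)
    (fun i => g ((Finite.equivFin F).symm i)) (Finite.equivFin F f) c
  simp only [Equiv.symm_apply_apply] at h
  exact h

end lift

/-- Homomorphisms `C → D` induce multi-faced homomorphisms `copies F C → copies F D`. -/
theorem exists_copiesMap {D : Type u} [NonUnitalRing D] [Module ℂ D] [IsScalarTower ℂ D D]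
    [SMulCommClass ℂ D D] (h : C →ₙₐ[ℂ] D) :
    ∃ H : MFHom (copies F C) (copies F D), ∀ f c, H.hom (emb f c) = emb f (h c) := by
  obtain ⟨H, hH⟩ := exists_copies_lift (C := C) (D := copies F D) (fun f : F => (emb f).comp h)
  refine ⟨⟨H, ?_⟩, hH⟩
  rintro f _ ⟨c, rfl⟩
  exact ⟨h c, (hH f c).symm⟩

end Copies

section StarCopies

variable (F : Type v) [Finite F] (C : Type u) [NonUnitalRing C] [Module ℂ C]
  [IsScalarTower ℂ C C] [SMulCommClass ℂ C C] [StarRing C] [StarModule ℂ C]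

/-- The multi-faced `*`-algebra all of whose faces are copies of the `*`-algebra `C`. -/
def starCopies : MFStarAlg.{u} F where
  toMFAlg := copies F C
  starRing := inferInstanceAs (StarRing (FreeProd (fun _ : Fin (Nat.card F) => C)))
  starModule := inferInstanceAs (StarModule ℂ (FreeProd (fun _ : Fin (Nat.card F) => C)))
  star_mem_face := by
    rintro f _ ⟨c, rfl⟩
    exact ⟨star c, (FreeProd.star_of (A := fun _ : Fin (Nat.card F) => C) _ c).symm⟩

variable {F C}

theorem star_emb (f : F) (c : C) :
    @star (starCopies F C).carrier _ (emb f c) = emb f (star c) :=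
  FreeProd.star_of (A := fun _ : Fin (Nat.card F) => C) _ c

theorem fold_star {D : Type w} [NonUnitalRing D] [Module ℂ D] [IsScalarTower ℂ D D]
    [SMulCommClass ℂ D D] [StarRing D] [StarModule ℂ D] (g : C →ₙₐ[ℂ] D)
    (hg : ∀ c, g (star c) = star (g c)) (x : (starCopies F C).carrier) :
    fold (F := F) g (@star (starCopies F C).carrier _ x) = star (fold (F := F) g x) := by
  induction x using FreeProd.induction (A := fun _ : Fin (Nat.card F) => C) with
  | hof i c =>
    obtain ⟨f, rfl⟩ := (Finite.equivFin F).surjective i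
    have h := star_emb f c
    change fold g (@star (starCopies F C).carrier _ (emb f c)) = star (fold g (emb f c))
    rw [h, fold_emb, fold_emb, hg]
  | hadd x y hx hy =>
    have h := star_add (R := (starCopies F C).carrier) x y
    refine (congrArg (fold (F := F) g) h).trans ?_
    refine (map_add (fold (F := F) g) _ _).trans ?_
    refine (congrArg₂ (· + ·) hx hy).trans ?_
    exact (star_add _ _).symm.trans (congrArg star (map_add (fold (F := F) g) x y).symm)
  | hzero =>
    refine (congrArg (fold (F := F) g) (star_zero (starCopies F C).carrier)).trans ?_
    refine (map_zero (fold (F := F) g)).trans ?_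
    exact (star_zero _).symm.trans (congrArg star (map_zero (fold (F := F) g)).symm)
  | hmul x y hx hy =>
    have h := star_mul (R := (starCopies F C).carrier) x y
    refine (congrArg (fold (F := F) g) h).trans ?_
    refine (map_mul (fold (F := F) g) _ _).trans ?_
    refine (congrArg₂ (· * ·) hy hx).trans ?_
    exact (star_mul _ _).symm.trans (congrArg star (map_mul (fold (F := F) g) x y).symm)
  | hsmul c x hx =>
    have h := star_smul (A := (starCopies F C).carrier) c x
    refine (congrArg (fold (F := F) g) h).trans ?_
    refine (map_smul (fold (F := F) g) _ _).trans ?_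
    refine (congrArg (star c • ·) hx).trans ?_
    exact (star_smul _ _).symm.trans (congrArg star (map_smul (fold (F := F) g) c x).symm)

end StarCopies

/-! ### Products of several functionals and homomorphisms -/

section Iterated

variable {F : Type v}

theorem Functional.comp_apply {A B : MFAlg.{u} F} (φ : Functional A) (h : B →ₙₐ[ℂ] A) (x : B) :
    φ.comp h x = φ (h x) := rfl

/-- The homomorphism out of a free product with given restrictions, as a multi-faced
homomorphism. -/
def MFHom.desc {A₁ A₂ B : MFAlg.{u} F} (h₁ : MFHom A₁ B) (h₂ : MFHom A₂ B) :
    MFHom (A₁.coprod A₂) B where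
  hom := MFAlg.desc h₁.hom h₂.hom
  map_face := by
    intro f x hx
    have : MFAlg.coprodFace A₁ A₂ f ≤ (B.face f).comap (MFAlg.desc h₁.hom h₂.hom) := by
      refine NonUnitalAlgebra.adjoin_le ?_
      rintro x (⟨a, ha, rfl⟩ | ⟨a, ha, rfl⟩)
      · have h : MFAlg.desc h₁.hom h₂.hom (MFAlg.inlHom A₁ A₂ a) = h₁.hom a := MFAlg.desc_inl _ _ a
        exact (congrArg (· ∈ B.face f) h).mpr (h₁.map_face f a ha)
      · have h : MFAlg.desc h₁.hom h₂.hom (MFAlg.inrHom A₁ A₂ a) = h₂.hom a := MFAlg.desc_inr _ _ a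
        exact (congrArg (· ∈ B.face f) h).mpr (h₂.map_face f a ha)
    exact this hx

@[simp] theorem MFHom.desc_inl {A₁ A₂ B : MFAlg.{u} F} (h₁ : MFHom A₁ B) (h₂ : MFHom A₂ B)
    (a : A₁) : (h₁.desc h₂).hom ((MFAlg.inl A₁ A₂).hom a) = h₁.hom a := MFAlg.desc_inl _ _ a

@[simp] theorem MFHom.desc_inr {A₁ A₂ B : MFAlg.{u} F} (h₁ : MFHom A₁ B) (h₂ : MFHom A₂ B)
    (a : A₂) : (h₁.desc h₂).hom ((MFAlg.inr A₁ A₂).hom a) = h₂.hom a := MFAlg.desc_inr _ _ a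

/-- The composition of multi-faced homomorphisms. -/
def MFHom.comp {A B C : MFAlg.{u} F} (g : MFHom B C) (h : MFHom A B) : MFHom A C where
  hom := g.hom.comp h.hom
  map_face := fun f x hx => g.map_face f _ (h.map_face f x hx)

@[simp] theorem MFHom.comp_hom_apply {A B C : MFAlg.{u} F} (g : MFHom B C) (h : MFHom A B)
    (a : A) : (g.comp h).hom a = g.hom (h.hom a) := rfl

/-- The free product of two multi-faced homomorphisms. -/
def MFHom.coprod {A₁ A₂ B₁ B₂ : MFAlg.{u} F} (h₁ : MFHom B₁ A₁) (h₂ : MFHom B₂ A₂) :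
    MFHom (B₁.coprod B₂) (A₁.coprod A₂) :=
  ((MFAlg.inl A₁ A₂).comp h₁).desc ((MFAlg.inr A₁ A₂).comp h₂)

/-- The associativity isomorphism, as a multi-faced homomorphism. -/
def MFHom.assoc (A B C : MFAlg.{u} F) :
    MFHom ((A.coprod B).coprod C) (A.coprod (B.coprod C)) :=
  ((MFAlg.inl A (B.coprod C)).desc ((MFAlg.inr A (B.coprod C)).comp (MFAlg.inl B C))).desc
    ((MFAlg.inr A (B.coprod C)).comp (MFAlg.inr B C))

theorem iterIncl_castSucc (k : ℕ) (A : Fin (k + 2) → MFAlg.{u} F) (i : Fin (k + 1))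
    (a : A i.castSucc) :
    iterIncl (k + 1) A i.castSucc a =
      (MFAlg.inl (iterAlg k (fun i => A i.castSucc)) (A (Fin.last (k + 1)))).hom
        (iterIncl k (fun i => A i.castSucc) i a) :=
  DFunLike.congr_fun
    (Fin.lastCases_castSucc (motive := fun i => A i →ₙₐ[ℂ] iterAlg (k + 1) A) i) a

theorem iterIncl_last (k : ℕ) (A : Fin (k + 2) → MFAlg.{u} F) (a : A (Fin.last (k + 1))) :
    iterIncl (k + 1) A (Fin.last (k + 1)) a =
      (MFAlg.inr (iterAlg k (fun i => A i.castSucc)) (A (Fin.last (k + 1)))).hom a :=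
  DFunLike.congr_fun
    (Fin.lastCases_last (motive := fun i => A i →ₙₐ[ℂ] iterAlg (k + 1) A)) a

variable (P : UniversalProduct.{u} F)

/-- Associativity and universality combined: if `φ₁ ⊙ φ₂` is induced by `ψ`, then `(φX ⊙ φ₁) ⊙ φ₂`
is induced by `ψY ⊙ ψ`. -/
theorem exists_prod_assoc {X Y A B : MFAlg.{u} F} (H : MFHom X Y) {φX : Functional X}
    {ψY : Functional Y} {φ₁ φ₂ : Functional A} {ψ : Functional B} (g₁ g₂ : MFHom A B)
    (hX : φX = ψY.comp H.hom) (hA : P.prod φ₁ φ₂ = ψ.comp (g₁.desc g₂).hom) :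
    ∃ K : MFHom ((X.coprod A).coprod A) (Y.coprod B),
      (∀ x, K.hom ((MFAlg.inl _ _).hom ((MFAlg.inl _ _).hom x)) =
        (MFAlg.inl _ _).hom (H.hom x)) ∧
      (∀ a, K.hom ((MFAlg.inl _ _).hom ((MFAlg.inr _ _).hom a)) =
        (MFAlg.inr _ _).hom (g₁.hom a)) ∧
      (∀ a, K.hom ((MFAlg.inr _ _).hom a) = (MFAlg.inr _ _).hom (g₂.hom a)) ∧
      P.prod (P.prod φX φ₁) φ₂ = (P.prod ψY ψ).comp K.hom := by
  refine ⟨(H.coprod (g₁.desc g₂)).comp (MFHom.assoc _ _ _), fun x => ?_, fun a => ?_,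
    fun a => ?_, ?_⟩
  · simp [MFHom.assoc, MFHom.coprod]
  · simp [MFHom.assoc, MFHom.coprod]
  · simp [MFHom.assoc, MFHom.coprod]
  · rw [P.assoc, hA, hX]
    exact congrArg (fun z => Functional.comp z (MFAlg.coprodAssoc _ _ _))
      (P.universal H (g₁.desc g₂) _ _)

theorem exists_prod_map {X Y A B : MFAlg.{u} F} (H : MFHom X Y) {φX : Functional X}
    {ψY : Functional Y} {φ : Functional A} {ψ : Functional B} (g : MFHom A B)
    (hX : φX = ψY.comp H.hom) (hA : φ = ψ.comp g.hom) :
    ∃ K : MFHom (X.coprod A) (Y.coprod B),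
      (∀ x, K.hom ((MFAlg.inl _ _).hom x) = (MFAlg.inl _ _).hom (H.hom x)) ∧
      (∀ a, K.hom ((MFAlg.inr _ _).hom a) = (MFAlg.inr _ _).hom (g.hom a)) ∧
      P.prod φX φ = (P.prod ψY ψ).comp K.hom := by
  refine ⟨H.coprod g, fun x => ?_, fun a => ?_, ?_⟩
  · simp [MFHom.coprod]
  · simp [MFHom.coprod]
  · rw [hA, hX]
    exact P.universal H g _ _

/-- Universality for products of several functionals. -/
theorem exists_iterMap (k : ℕ) (A B : Fin (k + 1) → MFAlg.{u} F) (g : ∀ i, MFHom (A i) (B i))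
    (ψ : ∀ i, Functional (B i)) :
    ∃ H : MFHom (iterAlg k A) (iterAlg k B),
      (∀ i a, H.hom (iterIncl k A i a) = iterIncl k B i ((g i).hom a)) ∧
      P.iterProd k A (fun i => (ψ i).comp (g i).hom) = (P.iterProd k B ψ).comp H.hom := by
  induction k with
  | zero =>
    refine ⟨g 0, fun i a => ?_, rfl⟩
    obtain rfl : i = 0 := Fin.fin_one_eq_zero i
    rfl
  | succ k ih =>
    obtain ⟨H, h1, h2⟩ := ih (fun i => A i.castSucc) (fun i => B i.castSucc)
      (fun i => g i.castSucc) (fun i => ψ i.castSucc)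
    obtain ⟨K, hK1, hK2, hK⟩ := exists_prod_map P H (g (Fin.last (k + 1))) h2 rfl
    refine ⟨K, fun i => ?_, hK⟩
    refine Fin.lastCases (fun a => ?_) (fun i a => ?_) i
    · rw [iterIncl_last, iterIncl_last]
      exact hK2 a
    · rw [iterIncl_castSucc, iterIncl_castSucc, ← h1]
      exact hK1 _

theorem iterProd_comp_iterIncl (k : ℕ) (A : Fin (k + 1) → MFAlg.{u} F)
    (φ : ∀ i, Functional (A i)) (i : Fin (k + 1)) (a : A i) :
    P.iterProd k A φ (iterIncl k A i a) = φ i a := by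
  induction k with
  | zero =>
    obtain rfl : i = 0 := Fin.fin_one_eq_zero i
    rfl
  | succ k ih =>
    revert a
    refine Fin.lastCases (fun a => ?_) (fun i a => ?_) i
    · rw [iterIncl_last]
      exact LinearMap.congr_fun (P.restrict_right _ (φ (Fin.last (k + 1)))) a
    · rw [iterIncl_castSucc, ← ih (fun i => A i.castSucc) (fun i => φ i.castSucc) i a]
      exact LinearMap.congr_fun (P.restrict_left _ (φ (Fin.last (k + 1)))) _

/-- Neighbouring factors of a product of several functionals may be multiplied first. -/
theorem exists_iterProd_unite (k : ℕ) (κ : Fin (k + 1)) (A B : MFAlg.{u} F)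
    (φ : Fin (k + 2) → Functional A) (ψ : Fin (k + 1) → Functional B)
    (g : Fin (k + 2) → MFHom A B)
    (h1 : ∀ j, j ≠ κ.castSucc → j ≠ κ.succ → φ j = (ψ (κ.predAbove j)).comp (g j).hom)
    (h2 : P.prod (φ κ.castSucc) (φ κ.succ) =
      (ψ κ).comp ((g κ.castSucc).desc (g κ.succ)).hom) :
    ∃ H : MFHom (iterAlg (k + 1) (fun _ => A)) (iterAlg k (fun _ => B)),
      (∀ j a, H.hom (iterIncl (k + 1) (fun _ => A) j a) =
        iterIncl k (fun _ => B) (κ.predAbove j) ((g j).hom a)) ∧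
      P.iterProd (k + 1) (fun _ => A) φ = (P.iterProd k (fun _ => B) ψ).comp H.hom := by
  induction k with
  | zero =>
    obtain rfl : κ = 0 := Fin.fin_one_eq_zero κ
    refine ⟨(g 0).desc (g 1), fun j a => ?_, h2⟩
    have hj : (Fin.predAbove 0 j : Fin 1) = 0 := Fin.fin_one_eq_zero _
    rw [hj]
    revert a
    refine Fin.lastCases (fun a => ?_) (fun i a => ?_) j
    · rw [iterIncl_last]
      exact MFAlg.desc_inr _ _ a
    · obtain rfl : i = 0 := Fin.fin_one_eq_zero i
      rw [iterIncl_castSucc]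
      exact MFAlg.desc_inl _ _ a
  | succ k ih =>
    revert h1 h2
    refine Fin.lastCases (fun h1 h2 => ?_) (fun κ h1 h2 => ?_) κ
    · obtain ⟨H, hH1, hH2⟩ := exists_iterMap P k (fun _ => A) (fun _ => B)
        (fun i => g i.castSucc.castSucc) (fun i => ψ i.castSucc)
      have e0 : P.iterProd k (fun _ => A) (fun i => φ i.castSucc.castSucc) =
          (P.iterProd k (fun _ => B) (fun i => ψ i.castSucc)).comp H.hom := by
        rw [← hH2]
        congr 1
        funext i
        rw [h1 i.castSucc.castSucc]
        · have e : (Fin.last (k + 1)).predAbove i.castSucc.castSucc = i.castSucc := by simp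
          rw [e]
        · intro h
          have := congrArg Fin.val h
          simp at this; omega
        · intro h
          have := congrArg Fin.val h
          simp at this; omega
      obtain ⟨K, hK1, hK2, hK3, hK⟩ := exists_prod_assoc P H _ _ e0 h2
      refine ⟨K, fun j => ?_, hK⟩
      refine Fin.lastCases (fun a => ?_) (fun i => ?_) j
      · rw [iterIncl_last, Fin.predAbove_right_last, iterIncl_last]
        exact hK3 a
      · refine Fin.lastCases (fun a => ?_) (fun i a => ?_) i
        · have e : (Fin.last (k + 1)).predAbove (Fin.last (k + 1)).castSucc =
            Fin.last (k + 1) := by simp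
          rw [e, iterIncl_castSucc, iterIncl_last, iterIncl_last]
          exact hK2 a
        · have e : (Fin.last (k + 1)).predAbove i.castSucc.castSucc = i.castSucc := by simp
          rw [e, iterIncl_castSucc, iterIncl_castSucc, iterIncl_castSucc, ← hH1]
          exact hK1 _
    · obtain ⟨H, hH1, hH2⟩ := ih κ (fun i => φ i.castSucc) (fun i => ψ i.castSucc)
        (fun i => g i.castSucc)
        (fun j hj1 hj2 => by
          rw [h1 j.castSucc (fun h => hj1 (Fin.castSucc_injective _ h))
            (fun h => hj2 (Fin.castSucc_injective _ (h.trans (Fin.succ_castSucc κ))))]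
          rw [Fin.castSucc_predAbove_castSucc])
        h2
      have e1 : φ (Fin.last _) = (ψ (Fin.last _)).comp (g (Fin.last _)).hom := by
        rw [h1 (Fin.last _), Fin.predAbove_right_last]
        · intro h
          have := congrArg Fin.val h
          simp at this; omega
        · intro h
          have := congrArg Fin.val h
          simp at this; omega
      obtain ⟨K, hK1, hK2, hK⟩ := exists_prod_map P H (g (Fin.last _)) hH2 e1
      refine ⟨K, fun j => ?_, hK⟩
      refine Fin.lastCases (fun a => ?_) (fun i a => ?_) j
      · rw [iterIncl_last, Fin.predAbove_right_last, iterIncl_last]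
        exact hK2 a
      · rw [iterIncl_castSucc, Fin.castSucc_predAbove_castSucc, iterIncl_castSucc, ← hH1]
        exact hK1 _

end Iterated

/-! ### Values of product functionals on words -/

section WordValue

variable {F : Type v}

/-- The unital extension of a functional, as a linear map. -/
def extend {A : MFAlg.{u} F} (φ : Functional A) : Unitization ℂ A →ₗ[ℂ] ℂ where
  toFun := unitalExt φ
  map_add' := fun x y => by simp [unitalExt]; ring
  map_smul' := fun c x => by simp [unitalExt]; ring

/-- The unital extension of a homomorphism. -/
def unitMap {A : Type u} {B : Type w} [NonUnitalRing A] [Module ℂ A] [IsScalarTower ℂ A A]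
    [SMulCommClass ℂ A A] [NonUnitalRing B] [Module ℂ B] [IsScalarTower ℂ B B]
    [SMulCommClass ℂ B B] (h : A →ₙₐ[ℂ] B) : Unitization ℂ A →ₐ[ℂ] Unitization ℂ B :=
  Unitization.lift ((Unitization.inrNonUnitalAlgHom ℂ B).comp h)

@[simp] theorem unitMap_inr {A : Type u} {B : Type w} [NonUnitalRing A] [Module ℂ A]
    [IsScalarTower ℂ A A] [SMulCommClass ℂ A A] [NonUnitalRing B] [Module ℂ B]
    [IsScalarTower ℂ B B] [SMulCommClass ℂ B B] (h : A →ₙₐ[ℂ] B) (a : A) :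
    unitMap h (a : Unitization ℂ A) = (h a : Unitization ℂ B) := by
  simp [unitMap]

theorem extend_comp {A B : MFAlg.{u} F} (φ : Functional A) (h : B →ₙₐ[ℂ] A)
    (x : Unitization ℂ B) : extend (φ.comp h) x = extend φ (unitMap h x) := by
  induction x using Unitization.ind with
  | inl_add_inr r a =>
    simp [extend, unitalExt, unitMap, Functional.comp_apply, Unitization.algebraMap_eq_inl]

variable [Finite F] {C : Type u} [Ring C] [Algebra ℂ C] {D : Type u} [Ring D] [Algebra ℂ D]

/-- The functional on `copies F C` whose restriction to each copy of `C` equals `Φ`, and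
which factors through the homomorphism `copies F C → C`. -/
def pull (F : Type v) [Finite F] (Φ : C →ₗ[ℂ] ℂ) : Functional (copies F C) :=
  Φ ∘ₗ (fold (F := F) (NonUnitalAlgHom.id ℂ C) : copies F C →ₗ[ℂ] C)

theorem pull_apply (Φ : C →ₗ[ℂ] ℂ) (x : copies F C) :
    pull F Φ x = Φ (fold (NonUnitalAlgHom.id ℂ C) x) := rfl

variable (P : UniversalProduct.{u} F)

/-- The value of the unital extension of the product functional of the functionals `Φ κ` on the
word `l`, whose letters `((κ, f), c)` consist of the number `κ` of a factor, a face `f` and an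
element `c` of the common underlying algebra `C` of all faces of all factors. -/
def wordValue {k : ℕ} (Φ : Fin (k + 1) → C →ₗ[ℂ] ℂ) (l : List ((Fin (k + 1) × F) × C)) : ℂ :=
  extend (P.iterProd k (fun _ => copies F C) (fun κ => pull F (Φ κ)))
    (l.map (fun p => (iterIncl k (fun _ => copies F C) p.1.1 (emb p.1.2 p.2) :
      Unitization ℂ (iterAlg k (fun _ => copies F C))))).prod

theorem wordValue_eq_of_hom {k : ℕ} (Φ : Fin (k + 1) → C →ₗ[ℂ] ℂ) {A : MFAlg.{u} F}
    (ψ : Functional A) (H : iterAlg k (fun _ => copies F C) →ₙₐ[ℂ] A)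
    (h : P.iterProd k (fun _ => copies F C) (fun κ => pull F (Φ κ)) = ψ.comp H)
    (l : List ((Fin (k + 1) × F) × C)) :
    wordValue P Φ l = extend ψ (l.map (fun p =>
      (H (iterIncl k (fun _ => copies F C) p.1.1 (emb p.1.2 p.2)) : Unitization ℂ A))).prod := by
  rw [wordValue, h, extend_comp, map_list_prod, List.map_map]
  congr 3
  funext p
  simp

theorem wordValue_map {k : ℕ} (Φ : Fin (k + 1) → D →ₗ[ℂ] ℂ) (h : Fin (k + 1) → C →ₙₐ[ℂ] D)
    (l : List ((Fin (k + 1) × F) × C)) :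
    wordValue P (fun κ => Φ κ ∘ₗ (h κ : C →ₗ[ℂ] D)) l =
      wordValue P Φ (l.map (fun p => (p.1, h p.1.1 p.2))) := by
  choose g hg using fun κ => exists_copiesMap (F := F) (h κ)
  obtain ⟨H, H1, H2⟩ := exists_iterMap P k (fun _ => copies F C) (fun _ => copies F D) g
    (fun κ => pull F (Φ κ))
  have e : (fun κ => pull F (Φ κ ∘ₗ (h κ : C →ₗ[ℂ] D))) =
      fun κ => (pull F (Φ κ)).comp (g κ).hom := by
    funext κ
    have e : (h κ).comp (fold (F := F) (NonUnitalAlgHom.id ℂ C)) =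
        (fold (NonUnitalAlgHom.id ℂ D)).comp (g κ).hom := by
      apply copies_hom_ext
      intro f c
      simp [hg]
    ext x
    exact congrArg (Φ κ) (DFunLike.congr_fun e x)
  rw [wordValue_eq_of_hom P _ _ H.hom ((congrArg _ e).trans H2), wordValue, List.map_map]
  congr 3
  funext p
  simp only [H1, hg, Function.comp]

theorem wordValue_map_algHom {k : ℕ} (Φ : Fin (k + 1) → D →ₗ[ℂ] ℂ) (h : Fin (k + 1) → C →ₐ[ℂ] D)
    (l : List ((Fin (k + 1) × F) × C)) :
    wordValue P (fun κ => Φ κ ∘ₗ (h κ).toLinearMap) l =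
      wordValue P Φ (l.map (fun p => (p.1, h p.1.1 p.2))) :=
  wordValue_map P Φ (fun κ => (h κ : C →ₙₐ[ℂ] D)) l

theorem wordValue_merge {k : ℕ} (Φ : Fin (k + 1) → C →ₗ[ℂ] ℂ)
    (l₁ l₂ : List ((Fin (k + 1) × F) × C)) (s : Fin (k + 1) × F) (c d : C) :
    wordValue P Φ (l₁ ++ (s, c) :: (s, d) :: l₂) = wordValue P Φ (l₁ ++ (s, c * d) :: l₂) := by
  simp [wordValue, mul_assoc]

/-- The value of a word with fixed factors and faces is multilinear in the elements of `C`. -/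
def wordMultilinear {k n : ℕ} (Φ : Fin (k + 1) → C →ₗ[ℂ] ℂ) (s : Fin n → Fin (k + 1) × F) :
    MultilinearMap ℂ (fun _ : Fin n => C) ℂ :=
  (extend (P.iterProd k (fun _ => copies F C) (fun κ => pull F (Φ κ)))).compMultilinearMap
    ((MultilinearMap.mkPiAlgebraFin ℂ n
      (Unitization ℂ (iterAlg k (fun _ => copies F C)))).compLinearMap (fun i =>
        (((Unitization.inrNonUnitalAlgHom ℂ _).comp
          ((iterIncl k (fun _ => copies F C) (s i).1).comp (emb (s i).2)) :
          C →ₙₐ[ℂ] Unitization ℂ (iterAlg k (fun _ => copies F C))) :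
          C →ₗ[ℂ] Unitization ℂ (iterAlg k (fun _ => copies F C)))))

theorem wordMultilinear_apply {k n : ℕ} (Φ : Fin (k + 1) → C →ₗ[ℂ] ℂ)
    (s : Fin n → Fin (k + 1) × F) (c : Fin n → C) :
    wordMultilinear P Φ s c = wordValue P Φ (List.ofFn (fun i => (s i, c i))) := by
  rw [wordMultilinear, wordValue, List.map_ofFn]
  simp only [LinearMap.compMultilinearMap_apply, MultilinearMap.compLinearMap_apply,
    MultilinearMap.mkPiAlgebraFin_apply]
  rfl

theorem wordValue_zero {k : ℕ} (Φ : Fin (k + 1) → C →ₗ[ℂ] ℂ)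
    (l₁ l₂ : List ((Fin (k + 1) × F) × C)) (s : Fin (k + 1) × F) :
    wordValue P Φ (l₁ ++ (s, 0) :: l₂) = 0 := by
  simp [wordValue]

/-- On words with letters from one factor, the product functional equals the functional of
this factor. -/
theorem wordValue_of_forall_eq {k : ℕ} (Φ : Fin (k + 1) → C →ₗ[ℂ] ℂ) (κ : Fin (k + 1))
    (hΦ : Φ κ 1 = 1) (l : List ((Fin (k + 1) × F) × C)) (hl : ∀ p ∈ l, p.1.1 = κ) :
    wordValue P Φ l = Φ κ (l.map Prod.snd).prod := by
  have e1 : l.map (fun p => (iterIncl k (fun _ => copies F C) p.1.1 (emb p.1.2 p.2) :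
      Unitization ℂ (iterAlg k (fun _ => copies F C)))) =
      (l.map (fun p => ((emb p.1.2 p.2 : copies F C) : Unitization ℂ (copies F C)))).map
        (unitMap (iterIncl k (fun _ => copies F C) κ)) := by
    rw [List.map_map]
    refine List.map_congr_left (fun p hp => ?_)
    rw [hl p hp]
    simp
  rw [wordValue, e1, ← map_list_prod, ← extend_comp]
  have e2 : (P.iterProd k (fun _ => copies F C) (fun κ => pull F (Φ κ))).comp
      (iterIncl k (fun _ => copies F C) κ) = pull F (Φ κ) := by
    ext x
    exact iterProd_comp_iterIncl P k (fun _ => copies F C) _ κ x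
  rw [e2]
  have e3 : ∀ x, extend (pull F (Φ κ)) x =
      Φ κ (Unitization.lift (fold (F := F) (NonUnitalAlgHom.id ℂ C)) x) := by
    intro x
    induction x using Unitization.ind with
    | inl_add_inr r a =>
      simp [extend, unitalExt, pull_apply, Algebra.algebraMap_eq_smul_one, hΦ]
  rw [e3, map_list_prod, List.map_map]
  congr 3
  funext p
  simp

/-- The value of a word only depends on the moments of its letters, since both sides are values of
the same word in the generators of a free algebra. -/
theorem wordValue_congr {k n : ℕ} (s : Fin n → Fin (k + 1) × F) (Φ : Fin (k + 1) → C →ₗ[ℂ] ℂ)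
    (Ψ : Fin (k + 1) → D →ₗ[ℂ] ℂ) (c : Fin n → C) (d : Fin n → D)
    (h : ∀ κ (v : List (Fin n)), (∀ i ∈ v, (s i).1 = κ) →
      Φ κ (v.map c).prod = Ψ κ (v.map d).prod) :
    wordValue P Φ (List.ofFn (fun i => (s i, c i))) =
      wordValue P Ψ (List.ofFn (fun i => (s i, d i))) := by
  classical
  let hc : Fin (k + 1) → MonoidAlgebra ℂ (FreeMonoid (ULift.{u} (Fin n))) →ₐ[ℂ] C := fun κ =>
    MonoidAlgebra.lift ℂ C _ (FreeMonoid.lift (fun i => if (s i.down).1 = κ then c i.down else 0))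
  let hd : Fin (k + 1) → MonoidAlgebra ℂ (FreeMonoid (ULift.{u} (Fin n))) →ₐ[ℂ] D := fun κ =>
    MonoidAlgebra.lift ℂ D _ (FreeMonoid.lift (fun i => if (s i.down).1 = κ then d i.down else 0))
  have e : (fun κ => Φ κ ∘ₗ (hc κ).toLinearMap) = fun κ => Ψ κ ∘ₗ (hd κ).toLinearMap := by
    funext κ
    refine MonoidAlgebra.lhom_ext' (fun v => LinearMap.ext_ring ?_)
    change Φ κ (hc κ (MonoidAlgebra.single v 1)) = Ψ κ (hd κ (MonoidAlgebra.single v 1))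
    simp only [hc, hd, MonoidAlgebra.lift_single, one_smul, FreeMonoid.lift_apply]
    by_cases hv : ∀ i ∈ v.toList, (s i.down).1 = κ
    · have := h κ (v.toList.map ULift.down) (by
        intro i hi
        obtain ⟨j, hj, rfl⟩ := List.mem_map.1 hi
        exact hv j hj)
      rw [List.map_map, List.map_map] at this
      have e1 : v.toList.map (fun i => if (s i.down).1 = κ then c i.down else 0) =
          v.toList.map (c ∘ ULift.down) :=
        List.map_congr_left (fun i hi => if_pos (hv i hi))
      have e2 : v.toList.map (fun i => if (s i.down).1 = κ then d i.down else 0) =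
          v.toList.map (d ∘ ULift.down) :=
        List.map_congr_left (fun i hi => if_pos (hv i hi))
      rw [e1, e2]
      exact this
    · push Not at hv
      obtain ⟨i, hi, hne⟩ := hv
      rw [List.prod_eq_zero (List.mem_map.2 ⟨i, hi, if_neg hne⟩),
        List.prod_eq_zero (List.mem_map.2 ⟨i, hi, if_neg hne⟩), map_zero, map_zero]
  have key := congrArg (fun Θ => wordValue P Θ (List.ofFn (fun i =>
    (s i, MonoidAlgebra.of ℂ _ (FreeMonoid.of (ULift.up i)))))) e
  rw [wordValue_map_algHom, wordValue_map_algHom, List.map_ofFn, List.map_ofFn] at key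
  convert key using 3
  · funext i
    simp [hc]
  · funext i
    simp [hd]

end WordValue

/-! ### Positivity -/

section PositiveFunctional

variable {U : Type u} [Ring U] [Algebra ℂ U] [StarRing U] [StarModule ℂ U] {ψ : U →ₗ[ℂ] ℂ}
  (hψ : ∀ x, 0 ≤ ψ (star x * x))

include hψ

/-- Positive functionals are hermitian, by polarization. -/
theorem apply_star_mul_comm (x y : U) : ψ (star x * y) = conj (ψ (star y * x)) := by
  have key : ∀ t : ℂ, ψ (star (y + t • x) * (y + t • x)) =
      ψ (star y * y) + t * ψ (star y * x) + conj t * ψ (star x * y) +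
        conj t * t * ψ (star x * x) := by
    intro t
    simp only [star_add, star_smul, add_mul, mul_add, smul_mul_assoc, mul_smul_comm, map_add,
      map_smul, smul_eq_mul, Complex.star_def]
    ring
  have h0 := (Complex.le_def.1 (hψ y)).2
  have h1 := (Complex.le_def.1 (hψ x)).2
  have h2 := (Complex.le_def.1 (hψ (y + (1 : ℂ) • x))).2
  have h3 := (Complex.le_def.1 (hψ (y + Complex.I • x))).2
  rw [key] at h2 h3
  simp at h0 h1 h2 h3
  apply Complex.ext
  · simp; linarith
  · simp; linarith

theorem apply_star (x : U) : ψ (star x) = conj (ψ x) := by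
  simpa using apply_star_mul_comm hψ x 1

/-- A consequence of the Cauchy-Schwarz inequality: vectors of norm `0` may be neglected. -/
theorem apply_mul_eq_zero {x : U} (hx : ψ (star x * x) = 0) (y : U) : ψ (y * x) = 0 := by
  -- If `b ≠ 0`, positivity fails at `y⋆ + r b̄ x` for sufficiently negative real `r`.
  set b := ψ (y * x) with hb
  have hb' : ψ (star x * star y) = conj b := by
    simpa using apply_star_mul_comm hψ x (star y)
  have key : ∀ r : ℝ, ψ (star (star y + ((r : ℂ) * conj b) • x) *
      (star y + ((r : ℂ) * conj b) • x)) = ψ (y * star y) + 2 * r * (b * conj b) := by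
    intro r
    simp only [star_add, star_smul, add_mul, mul_add, smul_mul_assoc, mul_smul_comm, map_add,
      map_smul, smul_eq_mul, Complex.star_def, map_mul, Complex.conj_conj, Complex.conj_ofReal,
      star_star, hx, hb', ← hb]
    ring
  by_contra hne
  have hpos : 0 < Complex.normSq b := Complex.normSq_pos.2 hne
  have h := (Complex.le_def.1 (hψ (star y + (((-((ψ (y * star y)).re + 1) /
    (2 * Complex.normSq b) : ℝ) : ℂ) * conj b) • x))).1
  rw [key, Complex.mul_conj] at h
  have e : ((2 : ℂ) * ((-((ψ (y * star y)).re + 1) / (2 * Complex.normSq b) : ℝ) : ℂ) *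
      (Complex.normSq b : ℂ)) = ((-((ψ (y * star y)).re + 1) : ℝ) : ℂ) := by
    rw [← Complex.ofReal_ofNat, ← Complex.ofReal_mul, ← Complex.ofReal_mul]
    congr 1
    field_simp
  rw [e] at h
  simp only [Complex.zero_re, Complex.add_re, Complex.ofReal_re] at h
  linarith

end PositiveFunctional

section Representation

variable {F : Type v}

/-- The identity as a multi-faced homomorphism. -/
def MFHom.id (A : MFAlg.{u} F) : MFHom A A where
  hom := NonUnitalAlgHom.id ℂ A
  map_face := fun _ _ hx => hx

variable {C : Type u} [Ring C] [Algebra ℂ C] [StarRing C] [StarModule ℂ C]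

theorem isRestrictedState_comp (S : MFStarAlg.{u} F) (g : S.carrier →ₙₐ[ℂ] C)
    (hg : ∀ x : S.carrier, g (star x) = star (g x)) {Φ : C →ₗ[ℂ] ℂ} (hΦ : Φ 1 = 1)
    (hpos : ∀ x, 0 ≤ Φ (star x * x)) :
    IsRestrictedState S (Φ ∘ₗ (g : S.carrier →ₗ[ℂ] C)) := by
  intro x
  have e1 : ∀ y : Unitization ℂ S.carrier, unitalExt (A := S.toMFAlg)
      (Φ ∘ₗ (g : S.carrier →ₗ[ℂ] C)) y = Φ (Unitization.lift g y) := by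
    intro y
    induction y using Unitization.ind with
    | inl_add_inr r a =>
      simp [unitalExt, Algebra.algebraMap_eq_smul_one, hΦ]
  have e2 : ∀ y : Unitization ℂ S.carrier,
      Unitization.lift g (star y) = star (Unitization.lift g y) := by
    intro y
    induction y using Unitization.ind with
    | inl_add_inr r a =>
      simp [hg, Algebra.algebraMap_eq_smul_one]
  rw [e1, map_mul, e2]
  exact hpos _

variable [Finite F]

theorem isRestrictedState_pull {Φ : C →ₗ[ℂ] ℂ} (hΦ : Φ 1 = 1)
    (hpos : ∀ x, 0 ≤ Φ (star x * x)) : IsRestrictedState (starCopies F C) (pull F Φ) :=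
  isRestrictedState_comp (starCopies F C) (fold (F := F) (NonUnitalAlgHom.id ℂ C))
    (fold_star (NonUnitalAlgHom.id ℂ C) (fun _ => rfl)) hΦ hpos

variable {P : UniversalProduct.{u} F} (hP : P.IsPositive)
include hP

/-- Products of several states are states. As the iterated free products carry no fixed involution,
the statement provides a multi-faced `*`-algebra `S` to which they map. -/
theorem exists_state {k : ℕ} (Φ : Fin (k + 1) → C →ₗ[ℂ] ℂ) (hΦ : ∀ κ, Φ κ 1 = 1)
    (hpos : ∀ κ x, 0 ≤ Φ κ (star x * x)) :
    ∃ (S : MFStarAlg.{u} F) (H : MFHom (iterAlg k (fun _ => copies F C)) S.toMFAlg)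
      (ψ : Functional S.toMFAlg), IsRestrictedState S ψ ∧
      P.iterProd k (fun _ => copies F C) (fun κ => pull F (Φ κ)) = ψ.comp H.hom ∧
      ∀ κ f c, @star S.carrier _ (H.hom (iterIncl k (fun _ => copies F C) κ (emb f c))) =
        H.hom (iterIncl k (fun _ => copies F C) κ (emb f (star c))) := by
  induction k with
  | zero =>
    refine ⟨starCopies F C, MFHom.id (copies F C), pull F (Φ 0),
      isRestrictedState_pull (hΦ 0) (hpos 0), rfl, fun κ f c => ?_⟩
    obtain rfl := Fin.fin_one_eq_zero κ
    exact star_emb f c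
  | succ k ih =>
    obtain ⟨S, H, ψ, hψ, hH, hs⟩ := ih (fun κ => Φ κ.castSucc) (fun κ => hΦ _) (fun κ => hpos _)
    obtain ⟨K, hK1, hK2, hK⟩ := exists_prod_map P H (MFHom.id (copies F C)) hH
      (φ := pull F (Φ (Fin.last (k + 1)))) (ψ := pull F (Φ (Fin.last (k + 1)))) rfl
    refine ⟨S.coprod (starCopies F C), K, P.prod ψ (pull F (Φ (Fin.last (k + 1)))),
      hP S (starCopies F C) _ _ hψ (isRestrictedState_pull (hΦ _) (hpos _)), hK, fun κ => ?_⟩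
    refine Fin.lastCases (fun f c => ?_) (fun κ f c => ?_) κ
    · rw [iterIncl_last, iterIncl_last]
      refine (congrArg (@star (S.coprod (starCopies F C)).carrier _) (hK2 _)).trans ?_
      refine (MFStarAlg.star_inr S (starCopies F C) (emb f c)).trans ?_
      refine Eq.trans ?_ (hK2 _).symm
      exact congrArg (MFAlg.inr _ _).hom (star_emb f c)
    · rw [iterIncl_castSucc, iterIncl_castSucc]
      refine (congrArg (@star (S.coprod (starCopies F C)).carrier _) (hK1 _)).trans ?_
      refine (MFStarAlg.star_inl S (starCopies F C) _).trans ?_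
      refine Eq.trans ?_ (hK1 _).symm
      exact congrArg (MFAlg.inl _ _).hom (hs κ f c)

/-- For states on a `*`-algebra, the values of words are given by a positive functional on
a `*`-algebra which contains images of all faces of all factors. -/
theorem exists_representation {k : ℕ} (Φ : Fin (k + 1) → C →ₗ[ℂ] ℂ) (hΦ : ∀ κ, Φ κ 1 = 1)
    (hpos : ∀ κ x, 0 ≤ Φ κ (star x * x)) :
    ∃ (U : Type u) (_ : Ring U) (_ : Algebra ℂ U) (_ : StarRing U) (_ : StarModule ℂ U)
      (ψ : U →ₗ[ℂ] ℂ) (θ : Fin (k + 1) × F → C →ₙₐ[ℂ] U), (∀ x, 0 ≤ ψ (star x * x)) ∧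
      (∀ s c, star (θ s c) = θ s (star c)) ∧
      ∀ l : List ((Fin (k + 1) × F) × C),
        wordValue P Φ l = ψ (l.map (fun p => θ p.1 p.2)).prod := by
  obtain ⟨S, H, ψ, hψ, hH, hs⟩ := exists_state hP Φ hΦ hpos
  refine ⟨Unitization ℂ S.carrier, inferInstance, inferInstance, inferInstance, inferInstance,
    extend ψ, fun s => (Unitization.inrNonUnitalAlgHom ℂ S.carrier).comp (H.hom.comp
      ((iterIncl k (fun _ => copies F C) s.1).comp (emb s.2))), hψ, fun s c => ?_, fun l => ?_⟩
  · exact (Unitization.inr_star _).symm.trans (congrArg _ (hs s.1 s.2 c))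
  · exact wordValue_eq_of_hom P Φ ψ H.hom hH l

end Representation

/-! ### Only moments of words without repetitions matter -/

section Truncation

variable {C : Type u} [Ring C] [Algebra ℂ C]

/-- The matrix `τ` with entries multiplied by `c`, i.e. the tensor `c ⊗ τ`. -/
def tensorMatrix (c : C) (τ : Matrix (Fin 2) (Fin 2) ℂ) : Matrix (Fin 2) (Fin 2) C :=
  Matrix.of fun i j => τ i j • c

theorem tensorMatrix_mul (c d : C) (σ τ : Matrix (Fin 2) (Fin 2) ℂ) :
    tensorMatrix c σ * tensorMatrix d τ = tensorMatrix (c * d) (σ * τ) := by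
  ext i j
  simp only [tensorMatrix, Matrix.mul_apply, Matrix.of_apply, smul_mul_smul_comm, Finset.sum_smul]

theorem tensorMatrix_one : tensorMatrix (1 : C) 1 = 1 := by
  ext i j
  simp [tensorMatrix, Matrix.one_apply]

/-- The moments of the letters `c q ⊗ 1` for `q ≠ p` and `c p ⊗ τ`. -/
theorem prod_map_tensorMatrix {ι : Type*} [DecidableEq ι] (c : ι → C) (p : ι)
    (τ : Matrix (Fin 2) (Fin 2) ℂ) (v : List ι) :
    (v.map (Function.update (fun q => tensorMatrix (c q) 1) p (tensorMatrix (c p) τ))).prod =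
      tensorMatrix (v.map c).prod (τ ^ v.count p) := by
  induction v with
  | nil => simp [tensorMatrix_one]
  | cons q v ih =>
    rw [List.map_cons, List.prod_cons, ih, List.map_cons, List.prod_cons]
    by_cases h : q = p
    · subst h
      rw [Function.update_self, tensorMatrix_mul, List.count_cons_self, pow_succ']
    · rw [Function.update_of_ne h, tensorMatrix_mul, List.count_cons_of_ne h, one_mul]

/-- The functional `Φ ⊗ ℓ`, where `ℓ` is the sum of the entries in the first column. -/
def columnFunctional (Φ : C →ₗ[ℂ] ℂ) : Matrix (Fin 2) (Fin 2) C →ₗ[ℂ] ℂ where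
  toFun := fun X => Φ (X 0 0) + Φ (X 1 0)
  map_add' := fun X Y => by simp; ring
  map_smul' := fun a X => by simp; ring

theorem columnFunctional_tensorMatrix (Φ : C →ₗ[ℂ] ℂ) (c : C) (τ : Matrix (Fin 2) (Fin 2) ℂ) :
    columnFunctional Φ (tensorMatrix c τ) = (τ 0 0 + τ 1 0) * Φ c := by
  simp [columnFunctional, tensorMatrix]; ring

variable {F : Type v} [Finite F] (P : UniversalProduct.{u} F)

/-- The moments of words in which the letter `p` is repeated may be replaced by `0`.

Indeed, replace the letter `p` by `c p ⊗ τ`. For `τ = E₁₁` all moments remain the same, and for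
`τ = E₂₁` those with repetitions of `p` vanish. For `τ = E₂₁ - E₁₁` all moments of words which
contain `p` vanish, as if the letter were `0`. -/
theorem exists_truncation {k n : ℕ} (s : Fin n → Fin (k + 1) × F)
    (Φ : Fin (k + 1) → C →ₗ[ℂ] ℂ) (c : Fin n → C) (p : Fin n) :
    ∃ (D : Type u) (_ : Ring D) (_ : Algebra ℂ D) (Ψ : Fin (k + 1) → D →ₗ[ℂ] ℂ) (d : Fin n → D),
      wordValue P Φ (List.ofFn (fun i => (s i, c i))) =
        wordValue P Ψ (List.ofFn (fun i => (s i, d i))) ∧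
      ∀ κ (v : List (Fin n)), Ψ κ (v.map d).prod =
        if v.count p ≤ 1 then Φ κ (v.map c).prod else 0 := by
  let Ψ : Fin (k + 1) → Matrix (Fin 2) (Fin 2) C →ₗ[ℂ] ℂ := fun κ => columnFunctional (Φ κ)
  let d : Matrix (Fin 2) (Fin 2) ℂ → Fin n → Matrix (Fin 2) (Fin 2) C := fun τ =>
    Function.update (fun q => tensorMatrix (c q) 1) p (tensorMatrix (c p) τ)
  have hd : ∀ κ τ (v : List (Fin n)), Ψ κ (v.map (d τ)).prod =
      ((τ ^ v.count p) 0 0 + (τ ^ v.count p) 1 0) * Φ κ (v.map c).prod := by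
    intro κ τ v
    rw [prod_map_tensorMatrix, columnFunctional_tensorMatrix]
  let A : Matrix (Fin 2) (Fin 2) ℂ := !![1, 0; 0, 0]
  let B : Matrix (Fin 2) (Fin 2) ℂ := !![0, 0; 1, 0]
  have hA : ∀ m : ℕ, (A ^ m) 0 0 + (A ^ m) 1 0 = 1 := by
    intro m
    cases m with
    | zero => simp
    | succ m =>
      have : IsIdempotentElem A := by
        ext i j; fin_cases i <;> fin_cases j <;> simp [A, Matrix.mul_apply]
      rw [this.pow_succ_eq]
      simp [A]
  have hB : ∀ m : ℕ, (B ^ m) 0 0 + (B ^ m) 1 0 = if m ≤ 1 then 1 else 0 := by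
    intro m
    match m with
    | 0 => simp
    | 1 => simp [B]
    | m + 2 =>
      have : B ^ 2 = 0 := by
        rw [pow_two]
        ext i j; fin_cases i <;> fin_cases j <;> simp [B, Matrix.mul_apply]
      rw [pow_add, this]
      simp
  have hBA : ∀ m : ℕ, ((B - A) ^ m) 0 0 + ((B - A) ^ m) 1 0 =
      ((0 : Matrix (Fin 2) (Fin 2) ℂ) ^ m) 0 0 + ((0 : Matrix (Fin 2) (Fin 2) ℂ) ^ m) 1 0 := by
    intro m
    cases m with
    | zero => simp
    | succ m =>
      rw [pow_succ', pow_succ']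
      simp [A, B, Matrix.mul_apply]
  have key : wordMultilinear P Ψ s (d (B - A)) = 0 := by
    rw [wordMultilinear_apply, wordValue_congr P s Ψ Ψ (d (B - A)) (d 0)
      (fun κ v _ => by rw [hd, hd, hBA]), ← wordMultilinear_apply]
    apply MultilinearMap.map_coord_zero _ p
    simp only [d, Function.update_self]
    ext i j
    simp [tensorMatrix]
  have hsub : tensorMatrix (c p) (B - A) = tensorMatrix (c p) B - tensorMatrix (c p) A := by
    ext i j
    simp [tensorMatrix, sub_smul]
  simp only [d] at key
  rw [hsub, MultilinearMap.map_update_sub, sub_eq_zero] at key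
  refine ⟨_, inferInstance, inferInstance, Ψ, d B, ?_, fun κ v => ?_⟩
  · rw [← wordMultilinear_apply P Ψ, key, wordMultilinear_apply]
    refine wordValue_congr P s Φ Ψ c (d A) (fun κ v _ => ?_)
    rw [hd, hA, one_mul]
  · rw [hd, hB]
    split_ifs <;> simp

/-- The value of a word only depends on the moments in which the letters from `T` are not
repeated. -/
theorem wordValue_congr_of_count {k n : ℕ} (s : Fin n → Fin (k + 1) × F) (T : Finset (Fin n)) :
    ∀ (C D : Type u) [Ring C] [Algebra ℂ C] [Ring D] [Algebra ℂ D]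
      (Φ : Fin (k + 1) → C →ₗ[ℂ] ℂ) (Ψ : Fin (k + 1) → D →ₗ[ℂ] ℂ) (c : Fin n → C) (d : Fin n → D),
      (∀ κ (v : List (Fin n)), (∀ i ∈ v, (s i).1 = κ) → (∀ p ∈ T, v.count p ≤ 1) →
        Φ κ (v.map c).prod = Ψ κ (v.map d).prod) →
      wordValue P Φ (List.ofFn (fun i => (s i, c i))) =
        wordValue P Ψ (List.ofFn (fun i => (s i, d i))) := by
  induction T using Finset.induction_on with
  | empty =>
    intro C D _ _ _ _ Φ Ψ c d h
    exact wordValue_congr P s Φ Ψ c d (fun κ v hv => h κ v hv (by simp))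
  | insert p T _ ih =>
    intro C D _ _ _ _ Φ Ψ c d h
    obtain ⟨C', _, _, Φ', c', h1, h2⟩ := exists_truncation P s Φ c p
    obtain ⟨D', _, _, Ψ', d', h3, h4⟩ := exists_truncation P s Ψ d p
    rw [h1, h3]
    refine ih C' D' Φ' Ψ' c' d' (fun κ v hv hT => ?_)
    rw [h2, h4]
    split_ifs with hp
    · refine h κ v hv (fun q hq => ?_)
      rcases Finset.mem_insert.1 hq with rfl | hq
      · exact hp
      · exact hT q hq
    · rfl

theorem wordValue_congr_of_nodup {D : Type u} [Ring D] [Algebra ℂ D] {k n : ℕ}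
    (s : Fin n → Fin (k + 1) × F) (Φ : Fin (k + 1) → C →ₗ[ℂ] ℂ) (Ψ : Fin (k + 1) → D →ₗ[ℂ] ℂ)
    (c : Fin n → C) (d : Fin n → D)
    (h : ∀ κ (v : List (Fin n)), v.Nodup → (∀ i ∈ v, (s i).1 = κ) →
      Φ κ (v.map c).prod = Ψ κ (v.map d).prod) :
    wordValue P Φ (List.ofFn (fun i => (s i, c i))) =
      wordValue P Ψ (List.ofFn (fun i => (s i, d i))) :=
  wordValue_congr_of_count P s Finset.univ C D Φ Ψ c d (fun κ v hv hT =>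
    h κ v (List.nodup_iff_count_le_one.2 (fun p => hT p (Finset.mem_univ p))) hv)

end Truncation

/-! ### A state with prescribed moments -/

section WordModel

open Matrix

/-- The words without repetitions in the letters `0, …, n - 1`. -/
abbrev SimpleWord (n : ℕ) : Type := {w : List (Fin n) // w.Nodup}

/-- The matrix units which build up the word `w` from the right: the letter `i` maps
the suffix `u` of `w` to the suffix `i :: u`. -/
def suffixMatrix {n : ℕ} (w : SimpleWord n) (i : Fin n) : Matrix (SimpleWord n) (SimpleWord n) ℂ :=
  Matrix.of fun a b => if a.1 = i :: b.1 ∧ a.1 <:+ w.1 then 1 else 0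

theorem suffixMatrix_apply {n : ℕ} (w : SimpleWord n) (i : Fin n) (a b : SimpleWord n) :
    suffixMatrix w i a b = if a.1 = i :: b.1 ∧ a.1 <:+ w.1 then 1 else 0 := rfl

theorem prod_map_suffixMatrix {n : ℕ} (w : SimpleWord n) (v : List (Fin n)) (hv : v ≠ [])
    (a b : SimpleWord n) : (v.map (suffixMatrix w)).prod a b =
      if a.1 = v ++ b.1 ∧ a.1 <:+ w.1 then 1 else 0 := by
  induction v generalizing a with
  | nil => exact absurd rfl hv
  | cons i v ih =>
    by_cases hv' : v = []
    · subst hv'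
      simp [suffixMatrix_apply]
    · rw [List.map_cons, List.prod_cons, Matrix.mul_apply]
      simp only [ih hv', suffixMatrix_apply]
      by_cases h : a.1 = i :: v ++ b.1 ∧ a.1 <:+ w.1
      · obtain ⟨h1, h2⟩ := h
        have hsuf : v ++ b.1 <:+ a.1 := by rw [h1]; exact List.suffix_cons i _
        rw [if_pos ⟨h1, h2⟩, Finset.sum_eq_single
          (⟨v ++ b.1, a.2.sublist hsuf.sublist⟩ : SimpleWord n)]
        · rw [if_pos ⟨h1, h2⟩, if_pos ⟨rfl, hsuf.trans h2⟩, one_mul]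
        · intro x _ hx
          have : ¬ (x.1 = v ++ b.1) := fun h => hx (Subtype.ext h)
          simp [this]
        · simp
      · rw [if_neg h]
        refine Finset.sum_eq_zero (fun x _ => ?_)
        by_cases h1 : a.1 = i :: x.1 ∧ a.1 <:+ w.1
        · by_cases h2 : x.1 = v ++ b.1 ∧ x.1 <:+ w.1
          · exact absurd ⟨by rw [h1.1, h2.1]; rfl, h1.2⟩ h
          · rw [if_neg h2, mul_zero]
        · rw [if_neg h1, zero_mul]

/-- The sum of the unit vectors of the empty word and of `w`; only one unit vector if `w` is
empty. -/
def endsVector {n : ℕ} (w : SimpleWord n) : SimpleWord n → ℂ :=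
  fun a => if a.1 = [] ∨ a = w then 1 else 0

/-- The only moment of the letters of `w` which does not vanish is that of `w` itself. -/
theorem endsVector_moment {n : ℕ} (w : SimpleWord n) (v : List (Fin n)) (hv : v ≠ []) :
    star (endsVector w) ⬝ᵥ ((v.map (suffixMatrix w)).prod *ᵥ endsVector w) =
      if v = w.1 then 1 else 0 := by
  have e : ∀ a b : SimpleWord n, star (endsVector w) a *
      ((v.map (suffixMatrix w)).prod a b * endsVector w b) =
        if a = w ∧ b.1 = [] ∧ v = w.1 then 1 else 0 := by
    intro a b
    rw [prod_map_suffixMatrix w v hv]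
    have key : (a = w ∧ b.1 = [] ∧ v = w.1) ↔ (a.1 = [] ∨ a = w) ∧
        (a.1 = v ++ b.1 ∧ a.1 <:+ w.1) ∧ (b.1 = [] ∨ b = w) := by
      constructor
      · rintro ⟨rfl, h1, h2⟩
        exact ⟨Or.inr rfl, ⟨by rw [h1, List.append_nil, h2], List.suffix_refl _⟩, Or.inl h1⟩
      · rintro ⟨h1, ⟨h2, -⟩, h3⟩
        rcases h1 with h1 | rfl
        · rw [h1] at h2
          exact absurd (List.append_eq_nil_iff.1 h2.symm).1 hv
        · rcases h3 with h3 | rfl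
          · exact ⟨rfl, h3, by rw [h2, h3, List.append_nil]⟩
          · exact absurd (List.append_left_eq_self.1 h2.symm) hv
    have gen : ∀ (p q r : Prop) [Decidable p] [Decidable q] [Decidable r],
        star (if p then (1 : ℂ) else 0) * ((if q then 1 else 0) * (if r then 1 else 0)) =
          if p ∧ q ∧ r then 1 else 0 := by
      intro p q r _ _ _
      split_ifs <;> simp_all
    exact (gen _ _ _).trans (if_congr key.symm rfl rfl)
  simp only [dotProduct, mulVec, Finset.mul_sum, e]
  split_ifs with h
  · rw [Finset.sum_eq_single w, Finset.sum_eq_single ⟨[], List.nodup_nil⟩]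
    · simp [h]
    · intro b _ hb
      rw [if_neg]
      exact fun h => hb (Subtype.ext h.2.1)
    · simp
    · intro a _ ha
      simp [ha]
    · simp
  · simp [h]

/-- The algebra of families of matrices, one for each word without repetitions. -/
abbrev WordAlgebra (n : ℕ) : Type u :=
  ULift.{u} (SimpleWord n) → Matrix (SimpleWord n) (SimpleWord n) ℂ

/-- The square of the norm of the direct sum of all `endsVector w`. -/
def endsNorm (n : ℕ) : ℂ :=
  ∑ w : ULift.{u} (SimpleWord n), star (endsVector w.down) ⬝ᵥ endsVector w.down

theorem endsNorm_pos (n : ℕ) : 0 < endsNorm.{u} n := by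
  refine Finset.sum_pos' (fun w _ => dotProduct_star_self_nonneg _) ⟨⟨⟨[], List.nodup_nil⟩⟩,
    Finset.mem_univ _, ?_⟩
  refine dotProduct_star_self_pos_iff.2 ?_
  intro h
  have := congrFun h ⟨[], List.nodup_nil⟩
  simp [endsVector] at this

/-- The vector state of the normalization of the direct sum of all `endsVector w`. -/
def wordState (n : ℕ) : WordAlgebra.{u} n →ₗ[ℂ] ℂ where
  toFun := fun d => (endsNorm.{u} n)⁻¹ *
    ∑ w : ULift.{u} (SimpleWord n), star (endsVector w.down) ⬝ᵥ (d w *ᵥ endsVector w.down)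
  map_add' := fun x y => by
    simp only [Pi.add_apply, add_mulVec, dotProduct_add, Finset.sum_add_distrib, mul_add]
  map_smul' := fun c x => by
    simp only [Pi.smul_apply, smul_mulVec, dotProduct_smul, smul_eq_mul, ← Finset.mul_sum,
      RingHom.id_apply]
    ring

theorem wordState_apply (n : ℕ) (d : WordAlgebra.{u} n) : wordState n d = (endsNorm.{u} n)⁻¹ *
    ∑ w : ULift.{u} (SimpleWord n), star (endsVector w.down) ⬝ᵥ (d w *ᵥ endsVector w.down) := rfl

theorem wordState_one (n : ℕ) : wordState.{u} n 1 = 1 := by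
  rw [wordState_apply]
  simp only [Pi.one_apply, one_mulVec]
  exact inv_mul_cancel₀ (endsNorm_pos.{u} n).ne'

theorem wordState_nonneg (n : ℕ) (d : WordAlgebra.{u} n) : 0 ≤ wordState n (star d * d) := by
  rw [wordState_apply]
  refine mul_nonneg (inv_nonneg.2 (endsNorm_pos.{u} n).le) (Finset.sum_nonneg (fun w _ => ?_))
  exact (Matrix.posSemidef_conjTranspose_mul_self (d w)).dotProduct_mulVec_nonneg _

/-- The letter whose component for the word `w` is the matrix `suffixMatrix w i`, multiplied
with `t w`. -/
def wordLetter {n : ℕ} (i : Fin n) (t : SimpleWord n → ℂ) : WordAlgebra.{u} n :=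
  fun w => t w.down • suffixMatrix w.down i

/-- The moment of each nonempty word without repetitions can be prescribed independently, by choice
of the factors `t`, and the moments of words with repetitions vanish. -/
theorem wordState_prod {n : ℕ} (t : Fin n → SimpleWord n → ℂ) (v : List (Fin n)) (hv : v ≠ []) :
    wordState.{u} n (v.map (fun i => wordLetter i (t i))).prod =
      if h : v.Nodup then (endsNorm.{u} n)⁻¹ * (v.map (fun i => t i ⟨v, h⟩)).prod else 0 := by
  have e : ∀ (v : List (Fin n)) (w : ULift.{u} (SimpleWord n)),
      (v.map (fun i => wordLetter i (t i))).prod w =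
        (v.map (fun i => t i w.down)).prod • (v.map (suffixMatrix w.down)).prod := by
    intro v w
    induction v with
    | nil => simp
    | cons i v ih =>
      simp only [List.map_cons, List.prod_cons, Pi.mul_apply, ih, wordLetter,
        smul_mul_smul_comm]
  rw [wordState_apply]
  simp only [e, smul_mulVec, dotProduct_smul, endsVector_moment _ v hv, smul_eq_mul]
  split_ifs with h
  · congr 1
    rw [Finset.sum_eq_single (ULift.up ⟨v, h⟩)]
    · simp
    · intro w _ hw
      rw [if_neg, mul_zero]
      rintro rfl
      exact hw rfl
    · simp
  · rw [Finset.sum_eq_zero, mul_zero]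
    intro w _
    rw [if_neg, mul_zero]
    rintro rfl
    exact h w.down.2

end WordModel

/-! ### Expansion into elementary words -/

section Expansion

open Matrix

variable {F : Type v} [Finite F] (P : UniversalProduct.{u} F)

/-- The value of a word vanishes if all moments of one of its letters, say the letter number `p`,
vanish. -/
theorem wordValue_eq_zero {C : Type u} [Ring C] [Algebra ℂ C] {k n : ℕ}
    (s : Fin n → Fin (k + 1) × F) (Φ : Fin (k + 1) → C →ₗ[ℂ] ℂ) (c : Fin n → C) (p : Fin n)
    (h : ∀ v : List (Fin n), v.Nodup → p ∈ v → (∀ i ∈ v, (s i).1 = (s p).1) →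
      Φ (s p).1 (v.map c).prod = 0) :
    wordValue P Φ (List.ofFn (fun i => (s i, c i))) = 0 := by
  rw [wordValue_congr_of_nodup P s Φ Φ c (Function.update c p 0), ← wordMultilinear_apply]
  · exact MultilinearMap.map_coord_zero _ p (Function.update_self p 0 c)
  · intro κ v hv hκ
    by_cases hp : p ∈ v
    · obtain rfl := hκ p hp
      rw [h v hv hp hκ, List.prod_eq_zero, map_zero]
      exact List.mem_map.2 ⟨p, hp, Function.update_self p 0 c⟩
    · congr 2
      refine List.map_congr_left (fun i hi => ?_)
      rw [Function.update_of_ne]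
      rintro rfl
      exact hp hi

/-- The value of a word vanishes if one of its letters `y` satisfies `y * c = 0` for all other
letters `c`, and if all moments `Φ κ (x * y)` vanish, `κ` being the factor of `y`. -/
theorem wordValue_eq_zero_of_annihilated {C : Type u} [Ring C] [Algebra ℂ C] {k : ℕ}
    (Φ : Fin (k + 1) → C →ₗ[ℂ] ℂ) (l₁ l₂ : List ((Fin (k + 1) × F) × C)) (s : Fin (k + 1) × F)
    (y : C) (h : ∀ p ∈ l₁ ++ l₂, y * p.2 = 0) (hΦ : ∀ x, Φ s.1 (x * y) = 0) :
    wordValue P Φ (l₁ ++ (s, y) :: l₂) = 0 := by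
  set l := l₁ ++ (s, y) :: l₂ with hl
  have hp : l₁.length < l.length := by simp [hl]
  have e : l = List.ofFn (fun i : Fin l.length => ((l.get i).1, (l.get i).2)) := by
    simp
  have hget : l.get ⟨l₁.length, hp⟩ = (s, y) := by simp [hl]
  rw [e]
  refine wordValue_eq_zero P (fun i => (l.get i).1) Φ (fun i => (l.get i).2) ⟨l₁.length, hp⟩
    (fun v hv hpv _ => ?_)
  obtain ⟨v₁, v₂, rfl⟩ := List.append_of_mem hpv
  rw [hget, List.map_append, List.map_cons, List.prod_append, List.prod_cons, hget]
  cases v₂ with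
  | nil => simpa using hΦ _
  | cons q v₂ =>
    have hq : y * (l.get q).2 = 0 := by
      apply h
      have hne : q ≠ ⟨l₁.length, hp⟩ := by
        intro hq
        rw [hq] at hv
        exact (List.nodup_cons.1 (List.nodup_append.1 hv).2.1).1 List.mem_cons_self
      have hne' : (q : ℕ) ≠ l₁.length := fun h => hne (Fin.ext h)
      have hq := q.2
      simp only [List.get_eq_getElem, hl]
      rcases lt_or_gt_of_ne hne' with h1 | h1
      · rw [List.getElem_append_left h1]
        exact List.mem_append_left _ (List.getElem_mem _)
      · rw [List.getElem_append_right h1.le]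
        obtain ⟨m, hm⟩ : ∃ m, (q : ℕ) - l₁.length = m + 1 := ⟨q - l₁.length - 1, by omega⟩
        simp only [hm, List.getElem_cons_succ]
        exact List.mem_append_right _ (List.getElem_mem _)
    rw [List.map_cons, List.prod_cons, ← mul_assoc y, hq, zero_mul, mul_zero, map_zero]

/-- The letter `i` of the model, with only the component for the word `w`. -/
def wordUnit {n : ℕ} (i : Fin n) (w : SimpleWord n) : WordAlgebra.{u} n :=
  wordLetter i (Pi.single w 1)

theorem wordUnit_apply_self {n : ℕ} (i : Fin n) (w : SimpleWord n) :
    wordUnit.{u} i w ⟨w⟩ = suffixMatrix w i := by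
  simp [wordUnit, wordLetter]

theorem wordUnit_apply_ne {n : ℕ} (i : Fin n) {w : SimpleWord n} {w' : ULift.{u} (SimpleWord n)}
    (h : w'.down ≠ w) : wordUnit.{u} i w w' = 0 := by
  simp [wordUnit, wordLetter, h]

theorem eq_of_cons_suffix {α : Type*} {w a b : List α} {j : α} (hw : w.Nodup)
    (ha : j :: a <:+ w) (hb : j :: b <:+ w) : a = b := by
  have key : ∀ a b : List α, (j :: b).Nodup → j :: a <:+ j :: b → a = b := by
    intro a b hb h
    rcases List.suffix_cons_iff.1 h with h | h
    · exact (List.cons.inj h).2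
    · exact absurd (h.subset (List.mem_cons_self)) (List.nodup_cons.1 hb).1
  rcases List.suffix_or_suffix_of_suffix ha hb with h | h
  · exact key a b (hw.sublist hb.sublist) h
  · exact (key b a (hw.sublist ha.sublist) h).symm

theorem wordUnit_mul_wordUnit_of_ne {n : ℕ} (i j : Fin n) {w w' : SimpleWord n} (h : w ≠ w') :
    wordUnit.{u} i w * wordUnit j w' = 0 := by
  funext x
  by_cases hx : x.down = w
  · rw [Pi.mul_apply, wordUnit_apply_ne j (by rw [hx]; exact h), mul_zero]; rfl
  · rw [Pi.mul_apply, wordUnit_apply_ne i hx, zero_mul]; rfl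

theorem wordUnit_mul_star_wordUnit_of_ne {n : ℕ} (i j : Fin n) {w w' : SimpleWord n}
    (h : w ≠ w') : wordUnit.{u} i w * star (wordUnit j w') = 0 := by
  funext x
  by_cases hx : x.down = w
  · rw [Pi.mul_apply, Pi.star_apply, wordUnit_apply_ne j (by rw [hx]; exact h), star_zero,
      mul_zero]; rfl
  · rw [Pi.mul_apply, wordUnit_apply_ne i hx, zero_mul]; rfl

/-- If `w` contains `j` directly to the left of `i`, then the letter `j` vanishes on the ranges of
all other letters than `i`. -/
theorem wordUnit_mul_wordUnit {n : ℕ} {w : SimpleWord n} {i j q : Fin n} {u : List (Fin n)}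
    (hw : j :: i :: u <:+ w.1) (hq : q ≠ i) : wordUnit.{u} j w * wordUnit q w = 0 := by
  funext x
  by_cases hx : x.down = w
  · obtain ⟨x⟩ := x
    obtain rfl : x = w := hx
    rw [Pi.mul_apply, wordUnit_apply_self, wordUnit_apply_self]
    ext a b
    rw [Matrix.mul_apply]
    refine Finset.sum_eq_zero (fun c _ => ?_)
    rw [suffixMatrix_apply, suffixMatrix_apply]
    split_ifs with h1 h2
    · have e := eq_of_cons_suffix x.2 (h1.1 ▸ h1.2) hw
      rw [h2.1] at e
      exact absurd (List.cons.inj e).1 hq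
    all_goals simp
  · rw [Pi.mul_apply, wordUnit_apply_ne j hx, zero_mul]; rfl

/-- The initial subspaces of different letters are orthogonal. -/
theorem wordUnit_mul_star_wordUnit {n : ℕ} (w : SimpleWord n) {j q : Fin n} (hq : j ≠ q) :
    wordUnit.{u} j w * star (wordUnit q w) = 0 := by
  funext x
  by_cases hx : x.down = w
  · obtain ⟨x⟩ := x
    obtain rfl : x = w := hx
    rw [Pi.mul_apply, Pi.star_apply, wordUnit_apply_self, wordUnit_apply_self]
    ext a b
    rw [Matrix.mul_apply]
    refine Finset.sum_eq_zero (fun c _ => ?_)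
    rw [Matrix.star_apply, suffixMatrix_apply, suffixMatrix_apply]
    split_ifs with h1 h2
    · have e1 := h1.1 ▸ h1.2
      have e2 := h2.1 ▸ h2.2
      rcases List.suffix_or_suffix_of_suffix e1 e2 with h | h
      · exact absurd (List.cons.inj (h.eq_of_length (by simp))).1 hq
      · exact absurd (List.cons.inj (h.eq_of_length (by simp))).1 hq.symm
    all_goals simp
  · rw [Pi.mul_apply, wordUnit_apply_ne j hx, zero_mul]; rfl

/-- The last letter of `w` is the only one which does not vanish on the vector of the state. -/
theorem wordState_mul_wordUnit {n : ℕ} {w : SimpleWord n} {i j : Fin n} {u : List (Fin n)}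
    (hw : j :: i :: u <:+ w.1) (y : WordAlgebra.{u} n) : wordState n (y * wordUnit j w) = 0 := by
  rw [wordState_apply, Finset.sum_eq_zero, mul_zero]
  intro x _
  by_cases hx : x.down = w
  · obtain ⟨x⟩ := x
    obtain rfl : x = w := hx
    have : suffixMatrix x j *ᵥ endsVector x = 0 := by
      funext a
      refine Finset.sum_eq_zero (fun b _ => ?_)
      change suffixMatrix x j a b * endsVector x b = 0
      rw [suffixMatrix_apply, endsVector]
      split_ifs with h1 h2
      · have e := eq_of_cons_suffix x.2 (h1.1 ▸ h1.2) hw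
        rcases h2 with h2 | h2
        · rw [h2] at e
          simp at e
        · have hl := hw.length_le
          rw [← h2, e] at hl
          simp at hl
      all_goals simp
    rw [Pi.mul_apply, wordUnit_apply_self, ← mulVec_mulVec, this, mulVec_zero,
      dotProduct_zero]
  · rw [Pi.mul_apply, wordUnit_apply_ne j hx, mul_zero, zero_mulVec, dotProduct_zero]

theorem wordLetter_eq_sum {n : ℕ} (i : Fin n) (t : SimpleWord n → ℂ) :
    wordLetter.{u} i t = ∑ w, t w • wordUnit i w := by
  funext w'
  rw [Finset.sum_apply, Finset.sum_eq_single w'.down]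
  · simp [wordLetter, wordUnit]
  · intro w _ hw
    rw [Pi.smul_apply, wordUnit_apply_ne i hw.symm, smul_zero]
  · simp

/-- The value of the word whose letter number `i` is `wordUnit i (g i)`. -/
def elementaryValue {k n : ℕ} (s : Fin n → Fin (k + 1) × F) (g : Fin n → SimpleWord n) : ℂ :=
  wordValue P (fun _ : Fin (k + 1) => wordState.{u} n)
    (List.ofFn (fun i => (s i, wordUnit i (g i))))

/-- The value of any word is a combination of elementary values. -/
theorem wordValue_eq_sum {C : Type u} [Ring C] [Algebra ℂ C] {k n : ℕ}
    (s : Fin n → Fin (k + 1) × F) (Φ : Fin (k + 1) → C →ₗ[ℂ] ℂ) (hΦ : ∀ κ, Φ κ 1 = 1)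
    (c : Fin n → C) :
    wordValue P Φ (List.ofFn (fun i => (s i, c i))) = ∑ g : Fin n → SimpleWord n,
      (∏ i, if (g i).1.head? = some i then endsNorm.{u} n * Φ (s i).1 ((g i).1.map c).prod
        else 1) * elementaryValue P s g := by
  -- The first letter of a word carries its whole moment.
  let t : Fin n → SimpleWord n → ℂ := fun i w =>
    if w.1.head? = some i then endsNorm.{u} n * Φ (s i).1 (w.1.map c).prod else 1
  rw [wordValue_congr_of_nodup P s Φ (fun _ => wordState n) c (fun i => wordLetter i (t i)),
    ← wordMultilinear_apply]
  · simp only [wordLetter_eq_sum]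
    rw [MultilinearMap.map_sum]
    refine Finset.sum_congr rfl (fun g _ => ?_)
    rw [MultilinearMap.map_smul_univ, wordMultilinear_apply, smul_eq_mul]
    rfl
  · intro κ v hv hκ
    cases v with
    | nil => simp [hΦ, wordState_one]
    | cons i v =>
      rw [wordState_prod t _ (by simp), dif_pos hv]
      have e : v.map (fun j => t j ⟨i :: v, hv⟩) = v.map (fun _ => (1 : ℂ)) := by
        refine List.map_congr_left (fun j hj => if_neg ?_)
        simp only [List.head?_cons, Option.some.injEq]
        rintro rfl
        exact (List.nodup_cons.1 hv).1 hj
      rw [List.map_cons (f := fun j => t j ⟨i :: v, hv⟩), List.prod_cons, e]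
      simp only [List.map_const', List.prod_replicate, one_pow, mul_one, t, List.head?_cons,
        if_true]
      rw [inv_mul_cancel_left₀ (endsNorm_pos.{u} n).ne', hκ i (by simp)]

variable {P}

/-- Elementary values vanish unless the words `g i` form a decomposition of the set of letters
into ordered blocks, each of which belongs to one factor. -/
theorem coherent_of_elementaryValue_ne_zero {k n : ℕ} {s : Fin n → Fin (k + 1) × F}
    {g : Fin n → SimpleWord n} (h : elementaryValue P s g ≠ 0) (p : Fin n) :
    p ∈ (g p).1 ∧ ∀ j ∈ (g p).1, g j = g p ∧ (s j).1 = (s p).1 := by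
  by_contra hcon
  apply h
  refine wordValue_eq_zero P s _ _ p (fun v hv hp hs => ?_)
  have e := wordState_prod.{u} (fun i => Pi.single (g i) (1 : ℂ)) v (List.ne_nil_of_mem hp)
  refine e.trans ?_
  rw [dif_pos hv, List.prod_eq_zero, mul_zero]
  by_contra h0
  have hg : ∀ j ∈ v, g j = ⟨v, hv⟩ := by
    intro j hj
    by_contra hne
    exact h0 (List.mem_map.2 ⟨j, hj, Pi.single_eq_of_ne' hne _⟩)
  apply hcon
  rw [hg p hp]
  exact ⟨hp, fun j hj => ⟨hg j hj, hs j hj⟩⟩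

theorem elementaryValue_eq_zero_of_neighbours {k n : ℕ} {s : Fin n → Fin (k + 1) × F}
    {g : Fin n → SimpleWord n} {i j : Fin n} (hij : (i : ℕ) + 1 = j) (hs : s i = s j)
    (hg : g i ≠ g j) : elementaryValue P s g = 0 := by
  set L := List.ofFn (fun i => (s i, wordUnit.{u} i (g i))) with hL
  have hi : (i : ℕ) < L.length := by simp [hL]
  have hj : (i : ℕ) + 1 < L.length := by simp [hL, hij]
  have e : L = L.take i ++ (s i, wordUnit i (g i)) :: (s i, wordUnit j (g j)) ::
      L.drop (i + 1 + 1) := by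
    conv_lhs => rw [← List.take_append_drop i L, List.drop_eq_getElem_cons hi,
      List.drop_eq_getElem_cons hj]
    have e2 : L[(i : ℕ) + 1] = (s i, wordUnit j (g j)) := by
      have hj' : (⟨(i : ℕ) + 1, by simpa [hL] using hj⟩ : Fin n) = j := Fin.ext hij
      simp only [hL, List.getElem_ofFn, hj', hs]
    rw [e2]
    simp [hL]
  rw [elementaryValue, ← hL, e, wordValue_merge]
  have e0 := wordUnit_mul_wordUnit_of_ne.{u} i j hg
  rw [e0, wordValue_zero]

theorem star_prod_map {U : Type u} [Ring U] [StarRing U] {α : Type*} (θ : α → U) (τ : α → α)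
    (h : ∀ a, star (θ a) = θ (τ a)) (l : List α) :
    star (l.map θ).prod = ((l.reverse.map τ).map θ).prod := by
  induction l with
  | nil => simp
  | cons a l ih => simp [ih, h]

theorem exists_descent {n : ℕ} (l : List (Fin n)) (h : ¬ l.IsChain (· < ·)) :
    ∃ l₁ j i l₂, l = l₁ ++ j :: i :: l₂ ∧ ¬ j < i := by
  induction l with
  | nil => simp at h
  | cons a l ih =>
    cases l with
    | nil => simp at h
    | cons b l =>
      by_cases hab : a < b
      · rw [List.isChain_cons_cons] at h
        obtain ⟨l₁, j, i, l₂, e, hji⟩ := ih (fun h' => h ⟨hab, h'⟩)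
        exact ⟨a :: l₁, j, i, l₂, by rw [e]; rfl, hji⟩
      · exact ⟨[], a, b, l, rfl, hab⟩

/-- Elementary values vanish unless all words `g p` are increasing.

If the letter `j` stands directly to the left of `i < j` in the word `g p`, let `x` be the product
of the letters from the position `j` on. In the word `x⋆ x`, the two copies of the letter `j` merge
to a letter `y`. It vanishes on the vector of the state and on the ranges of all letters except `i`,
which does not occur in `x⋆ x`. So `x` is a null vector. -/
theorem isChain_of_elementaryValue_ne_zero (hP : P.IsPositive) {k n : ℕ}
    {s : Fin n → Fin (k + 1) × F} {g : Fin n → SimpleWord n} (h : elementaryValue P s g ≠ 0)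
    (p : Fin n) : (g p).1.IsChain (· < ·) := by
  by_contra hcon
  obtain ⟨w₁, j, i, w₂, hw, hji⟩ := exists_descent _ hcon
  have hnd := (g p).2
  have hij : i < j := by
    rcases lt_trichotomy i j with h | rfl | h
    · exact h
    · rw [hw] at hnd
      exact absurd List.mem_cons_self (List.nodup_cons.1 (List.nodup_append.1 hnd).2.1).1
    · exact absurd h hji
  have hgj : g j = g p :=
    ((coherent_of_elementaryValue_ne_zero h p).2 j (by rw [hw]; simp)).1
  have hsuf : j :: i :: w₂ <:+ (g p).1 := by rw [hw]; exact List.suffix_append _ _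
  set w := g p with hwdef
  let d : WordAlgebra.{u} n := wordUnit j w
  have hd1 : ∀ q, j < q → d * wordUnit q (g q) = 0 := by
    intro q hq
    by_cases hgq : g q = w
    · rw [hgq]
      exact wordUnit_mul_wordUnit hsuf (by rintro rfl; exact absurd hij hq.asymm)
    · exact wordUnit_mul_wordUnit_of_ne j q (Ne.symm hgq)
  have hd2 : ∀ q, j < q → d * star (wordUnit q (g q)) = 0 := by
    intro q hq
    by_cases hgq : g q = w
    · rw [hgq]
      exact wordUnit_mul_star_wordUnit w hq.ne
    · exact wordUnit_mul_star_wordUnit_of_ne j q (Ne.symm hgq)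
  have hd3 : ∀ x, wordState n (x * d) = 0 := wordState_mul_wordUnit hsuf
  obtain ⟨U, _, _, _, _, ψ, θ, hψ, hθ, hval⟩ := exists_representation (k := k) hP
    (fun _ => wordState.{u} n) (fun _ => wordState_one n) (fun _ => wordState_nonneg n)
  apply h
  set L := List.ofFn (fun i => (s i, wordUnit.{u} i (g i))) with hL
  have hj : (j : ℕ) < L.length := by simp [hL]
  have hLj : L.drop j = (s j, d) :: L.drop (j + 1) := by
    rw [List.drop_eq_getElem_cons hj]
    simp [hL, hgj, d]
  have hmem : ∀ x ∈ L.drop (j + 1), ∃ q, j < q ∧ x = (s q, wordUnit q (g q)) := by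
    intro x hx
    obtain ⟨m, hm, rfl⟩ := List.mem_iff_getElem.1 hx
    rw [List.getElem_drop]
    have hm' : (j : ℕ) + 1 + m < n := by
      simp [hL] at hm; omega
    refine ⟨⟨j + 1 + m, hm'⟩, ?_, by simp [hL]⟩
    exact Fin.lt_def.2 (by simp; omega)
  rw [elementaryValue, ← hL, hval, ← List.take_append_drop j L, List.map_append, List.prod_append]
  refine apply_mul_eq_zero hψ ?_ _
  rw [hLj, List.map_cons, List.prod_cons, star_mul, hθ, mul_assoc, ← mul_assoc (θ _ _),
    ← map_mul, star_prod_map (fun p : (Fin (k + 1) × F) × WordAlgebra.{u} n => θ p.1 p.2)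
      (fun p => (p.1, star p.2)) (fun p => hθ _ _)]
  have hzero := wordValue_eq_zero_of_annihilated P (fun _ : Fin (k + 1) => wordState.{u} n)
    ((L.drop (j + 1)).reverse.map (fun p => (p.1, star p.2))) (L.drop (j + 1)) (s j) (star d * d)
    (by
      intro x hx
      rw [mul_assoc]
      rcases List.mem_append.1 hx with hx | hx
      · obtain ⟨y, hy, rfl⟩ := List.mem_map.1 hx
        obtain ⟨q, hq, rfl⟩ := hmem y (List.mem_reverse.1 hy)
        rw [hd2 q hq, mul_zero]
      · obtain ⟨q, hq, rfl⟩ := hmem x hx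
        rw [hd1 q hq, mul_zero])
    (fun x => by rw [← mul_assoc]; exact hd3 _)
  rw [hval, List.map_append, List.map_cons, List.prod_append, List.prod_cons] at hzero
  exact hzero

end Expansion

/-! ### Existence of the coefficients -/

section Existence

variable {F : Type v}

/-- The elements of the block of `i` in the partition `π`, in increasing order. -/
def blockWord {n : ℕ} (π : Finpartition (Finset.univ : Finset (Fin n))) (i : Fin n) :
    SimpleWord n :=
  ⟨(List.finRange n).filter (fun l => l ∈ π.part i), (List.nodup_finRange n).filter _⟩

theorem mem_blockWord {n : ℕ} {π : Finpartition (Finset.univ : Finset (Fin n))} {i j : Fin n} :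
    j ∈ (blockWord π i).1 ↔ j ∈ π.part i := by
  simp [blockWord]

theorem blockWord_injective {n : ℕ} : Function.Injective
    (blockWord : Finpartition (Finset.univ : Finset (Fin n)) → Fin n → SimpleWord n) := by
  have key : ∀ π π' : Finpartition (Finset.univ : Finset (Fin n)), blockWord π = blockWord π' →
      π.parts ⊆ π'.parts := by
    intro π π' h β hβ
    obtain ⟨i, hi⟩ := π.nonempty_of_mem_parts hβ
    have e : β = π'.part i := by
      rw [← (π.part_eq_iff_mem hβ).2 hi]
      ext j
      rw [← mem_blockWord, h, mem_blockWord]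
    rw [e]
    exact π'.part_mem.2 (Finset.mem_univ i)
  exact fun π π' h => Finpartition.ext (Finset.Subset.antisymm (key π π' h) (key π' π h.symm))

theorem coe_orderedProd {A : Type u} [NonUnitalRing A] [Module ℂ A] [IsScalarTower ℂ A A]
    [SMulCommClass ℂ A A] : ∀ l : List A, l ≠ [] →
      (l.map (fun a : A => (Unitization.inr a : Unitization ℂ A))).prod =
        Unitization.inr (orderedProd l)
  | [], h => absurd rfl h
  | [a], _ => by simp [orderedProd]
  | a :: b :: l, _ => by
    rw [List.map_cons, List.prod_cons, coe_orderedProd (b :: l) (by simp), orderedProd,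
      Unitization.inr_mul]

theorem extend_coe {A : MFAlg.{u} F} (φ : Functional A) (a : A) :
    extend φ (a : Unitization ℂ A) = φ a := by
  simp [extend, unitalExt]

/-- The inclusion of the algebra number `κ` into the product of the unitizations. -/
def singleHom {ι : Type*} [DecidableEq ι] (A : ι → MFAlg.{u} F) (κ : ι) :
    A κ →ₙₐ[ℂ] (∀ κ, Unitization ℂ (A κ)) where
  toFun := fun a => Pi.single κ (a : Unitization ℂ (A κ))
  map_smul' := fun c a => by rw [Unitization.inr_smul, Pi.single_smul]; rfl
  map_zero' := by rw [Unitization.inr_zero, Pi.single_zero]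
  map_add' := fun a b => by rw [Unitization.inr_add, Pi.single_add]
  map_mul' := fun a b => by rw [Unitization.inr_mul, Pi.single_mul]

variable [Finite F] (P : UniversalProduct.{u} F)

/-- The coefficient of `P` for a word `s` and a set partition `π` of its positions: the elementary
value in which the words are the blocks of `π`, with a factor for the normalization of
`wordState`. -/
def coefficient : CoeffFamily F := fun _ s π =>
  endsNorm.{u} s.length ^ π.parts.card * elementaryValue P s.get (blockWord π)

open scoped Classical in
/-- Elementary values which do not vanish come from adapted partitions. -/
theorem exists_blockWord_eq (hP : P.IsPositive) {k : ℕ} {s : List (Fin (k + 1) × F)}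
    {g : Fin s.length → SimpleWord s.length} (h : elementaryValue P s.get g ≠ 0) :
    ∃ π, Adapted s π ∧ blockWord π = g := by
  have h1 := coherent_of_elementaryValue_ne_zero h
  have h2 := isChain_of_elementaryValue_ne_zero hP h
  have hrel : ∀ i j, j ∈ (Finpartition.ofSetoid (Setoid.ker g)).part i ↔ g i = g j := fun i j =>
    Finpartition.mem_part_ofSetoid_iff_rel.trans Setoid.ker_def
  have hmem : ∀ i j, g i = g j ↔ j ∈ (g i).1 := fun i j =>
    ⟨fun e => by rw [e]; exact (h1 j).1, fun hj => ((h1 i).2 j hj).1.symm⟩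
  refine ⟨Finpartition.ofSetoid (Setoid.ker g), ⟨fun β hβ => ?_, fun i j hij hs => ?_⟩, ?_⟩
  · obtain ⟨i, hi⟩ := (Finpartition.ofSetoid (Setoid.ker g)).nonempty_of_mem_parts hβ
    refine ⟨(s.get i).1, fun j hj => ?_⟩
    rw [← (Finpartition.part_eq_iff_mem _ hβ).2 hi, hrel, hmem] at hj
    exact Finset.mem_filter.2 ⟨Finset.mem_univ _, ((h1 i).2 j hj).2⟩
  · have hg : g i = g j := by
      by_contra hne
      exact h (elementaryValue_eq_zero_of_neighbours hij hs hne)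
    exact ⟨_, Finpartition.part_mem _ |>.2 (Finset.mem_univ i),
      (Finpartition.mem_part_self _).2 (Finset.mem_univ i), (hrel i j).2 hg⟩
  · funext i
    apply Subtype.ext
    refine List.Pairwise.eq_of_mem_iff (r := (· < ·)) ?_ (List.isChain_iff_pairwise.1 (h2 i)) ?_
    · exact (List.pairwise_lt_finRange _).filter _
    · intro j
      rw [mem_blockWord, hrel, hmem]

open scoped Classical in
/-- The formula which defines the coefficients, for values of words. -/
theorem wordValue_eq_sum_adapted (hP : P.IsPositive) {C : Type u} [Ring C] [Algebra ℂ C] {k : ℕ}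
    (s : List (Fin (k + 1) × F)) (Φ : Fin (k + 1) → C →ₗ[ℂ] ℂ) (hΦ : ∀ κ, Φ κ 1 = 1)
    (c : Fin s.length → C) :
    wordValue P Φ (List.ofFn (fun i => (s.get i, c i))) =
      ∑ π ∈ Finset.univ.filter (Adapted s), coefficient P k s π *
        ∏ κ, ∏ β ∈ π.parts.filter (fun β => β ⊆ blockSet s κ),
          Φ κ (((List.finRange s.length).filter (fun l => l ∈ β)).map c).prod := by
  rw [wordValue_eq_sum P s.get Φ hΦ c]
  symm
  refine Finset.sum_of_injOn blockWord (blockWord_injective.injOn) (fun _ _ => Finset.mem_univ _)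
    (fun g _ hg => ?_) (fun π hπ => ?_)
  · by_cases h : elementaryValue P s.get g = 0
    · rw [h, mul_zero]
    · obtain ⟨π, h1, h2⟩ := exists_blockWord_eq P hP h
      exact absurd ⟨π, by simpa using h1, h2⟩ hg
  · have hπ' : Adapted s π := (Finset.mem_filter.1 hπ).2
    rw [coefficient, mul_right_comm]
    congr 1
    have e1 : ∏ κ, ∏ β ∈ π.parts.filter (fun β => β ⊆ blockSet s κ),
        Φ κ (((List.finRange s.length).filter (fun l => l ∈ β)).map c).prod =
        ∏ β ∈ π.parts, ∏ κ, if β ⊆ blockSet s κ then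
          Φ κ (((List.finRange s.length).filter (fun l => l ∈ β)).map c).prod else 1 := by
      simp only [Finset.prod_filter]
      exact Finset.prod_comm
    have e2 : ∀ f : Fin s.length → ℂ, ∏ i, f i = ∏ β ∈ π.parts, ∏ i ∈ β, f i := by
      intro f
      refine Eq.trans ?_ (Finset.prod_biUnion π.disjoint)
      exact Finset.prod_congr π.biUnion_parts.symm (fun _ _ => rfl)
    rw [e1, ← Finset.prod_const, ← Finset.prod_mul_distrib, e2]
    refine Finset.prod_congr rfl (fun β hβ => ?_)
    have hw : ∀ i ∈ β, (blockWord π i).1 = (List.finRange s.length).filter (fun l => l ∈ β) := by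
      intro i hi
      simp only [blockWord, (π.part_eq_iff_mem hβ).2 hi]
    obtain ⟨κ, hκ⟩ := hπ'.refines β hβ
    obtain ⟨i, w, hiw⟩ : ∃ i w, (List.finRange s.length).filter (fun l => l ∈ β) = i :: w := by
      obtain ⟨i, hi⟩ := π.nonempty_of_mem_parts hβ
      refine List.exists_cons_of_ne_nil (List.ne_nil_of_mem (a := i) ?_)
      simpa using hi
    have hi : i ∈ β := by
      have : i ∈ (List.finRange s.length).filter (fun l => l ∈ β) := by rw [hiw]; simp
      simpa using this
    have hblock : ∀ j ∈ β, ∀ κ', β ⊆ blockSet s κ' → (s.get j).1 = κ' := fun j hj κ' h =>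
      (Finset.mem_filter.1 (h hj)).2
    rw [Finset.prod_eq_single κ, if_pos hκ, Finset.prod_eq_single_of_mem i hi]
    · rw [hw i hi, hiw, if_pos (by simp), hblock i hi κ hκ]
    · intro j hj hji
      rw [hw j hj, hiw, if_neg]
      simpa using hji.symm
    · intro κ' _ hne
      rw [if_neg]
      intro h
      exact hne ((hblock i hi κ' h).symm.trans (hblock i hi κ hκ))
    · simp

/-- Products of functionals on arbitrary multi-faced algebras reduce to products of functionals
on multi-faced algebras all of whose faces are copies of the same algebra. -/
theorem iterProd_eq_wordValue {k : ℕ} (A : Fin (k + 1) → MFAlg.{u} F)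
    (φ : ∀ κ, Functional (A κ)) (s : List (Fin (k + 1) × F)) (hs : s ≠ [])
    (x : ∀ κ, Fin s.length → A κ)
    (hx : ∀ i, x (s.get i).1 i ∈ (A (s.get i).1).face (s.get i).2) :
    P.iterProd k A φ
        (orderedProd (List.ofFn (fun i => iterIncl k A (s.get i).1 (x (s.get i).1 i)))) =
      wordValue P (fun κ => extend (φ κ) ∘ₗ LinearMap.proj κ)
        (List.ofFn (fun i => (s.get i, singleHom A (s.get i).1 (x (s.get i).1 i)))) := by
  choose h hh using fun κ => (A κ).exists_hom (fun f => (emb (F := F) f).comp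
    ((singleHom A κ).comp (NonUnitalSubalgebraClass.subtype ((A κ).face f))))
  let g : ∀ κ, MFHom (A κ) (copies F (∀ κ, Unitization ℂ (A κ))) := fun κ =>
    ⟨h κ, fun f a ha => ⟨singleHom A κ a, (hh κ f ⟨a, ha⟩).symm⟩⟩
  obtain ⟨H, H1, H2⟩ := exists_iterMap P k A (fun _ => copies F (∀ κ, Unitization ℂ (A κ))) g
    (fun κ => pull F (extend (φ κ) ∘ₗ LinearMap.proj κ))
  have e : (fun κ => (pull F (extend (φ κ) ∘ₗ LinearMap.proj κ)).comp (g κ).hom) = φ := by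
    funext κ
    have e : (fold (F := F) (NonUnitalAlgHom.id ℂ (∀ κ, Unitization ℂ (A κ)))).comp (h κ) =
        singleHom A κ := (A κ).hom_ext (fun f a ha => by
      have := hh κ f ⟨a, ha⟩
      change fold _ (h κ a) = _
      rw [this]
      exact fold_emb _ _ _)
    ext a
    have e' : fold (F := F) (NonUnitalAlgHom.id ℂ (∀ κ, Unitization ℂ (A κ))) (h κ a) =
        singleHom A κ a := DFunLike.congr_fun e a
    change extend (φ κ) (fold (F := F) (NonUnitalAlgHom.id ℂ _) (h κ a) κ) = φ κ a
    rw [e']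
    change extend (φ κ) ((Pi.single κ (a : Unitization ℂ (A κ)) : ∀ κ, Unitization ℂ (A κ)) κ) = _
    rw [Pi.single_eq_same, extend_coe]
  rw [e] at H2
  have hne : List.ofFn (fun i => iterIncl k A (s.get i).1 (x (s.get i).1 i)) ≠ [] := by
    simpa using hs
  rw [← extend_coe, ← coe_orderedProd _ hne, H2, extend_comp, map_list_prod, wordValue,
    List.map_map, List.map_ofFn, List.map_ofFn]
  congr 3
  funext i
  simp only [Function.comp, unitMap_inr, H1]
  congr 2
  exact hh _ _ ⟨_, hx i⟩

theorem isCoefficients_coefficient (hP : P.IsPositive) : P.IsCoefficients (coefficient P) := by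
  intro k s hs A φ x hx
  rw [iterProd_eq_wordValue P A φ s hs x hx, wordValue_eq_sum_adapted P hP]
  · refine Finset.sum_congr rfl (fun π _ => ?_)
    congr 1
    refine Finset.prod_congr rfl (fun κ _ => Finset.prod_congr rfl (fun β hβ => ?_))
    obtain ⟨hβ1, hβ2⟩ := Finset.mem_filter.1 hβ
    have hne : ((List.finRange s.length).filter (fun l => l ∈ β)).map (x κ) ≠ [] := by
      obtain ⟨i, hi⟩ := π.nonempty_of_mem_parts hβ1
      refine List.ne_nil_of_mem (a := x κ i) (List.mem_map.2 ⟨i, ?_, rfl⟩)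
      simpa using hi
    rw [← extend_coe (φ κ), ← coe_orderedProd _ hne]
    change extend (φ κ) (Pi.evalRingHom (fun κ => Unitization ℂ (A κ)) κ _) = _
    rw [map_list_prod, List.map_map, List.map_map]
    congr 2
    refine List.map_congr_left (fun i hi => ?_)
    have hi' : i ∈ β := by simpa using hi
    obtain rfl : (s.get i).1 = κ := (Finset.mem_filter.1 (hβ2 hi')).2
    change (Pi.single _ _ : ∀ κ, Unitization ℂ (A κ)) _ = _
    exact Pi.single_eq_same _ _
  · intro κ
    simp [extend, unitalExt]

end Existence

/-! ### The highest coefficient as the value of a single word -/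

section Highest

variable {F : Type v}

theorem mem_maxPartition_parts {k : ℕ} {s : List (Fin (k + 1) × F)}
    {β : Finset (Fin s.length)} :
    β ∈ (maxPartition s).parts ↔ ∃ κ, (blockSet s κ).Nonempty ∧ β = blockSet s κ := by
  classical
  have hpart : ∀ i, (maxPartition s).part i = blockSet s (s.get i).1 := by
    intro i
    ext j
    rw [maxPartition, Finpartition.mem_part_ofSetoid_iff_rel, Setoid.ker_def, blockSet,
      Finset.mem_filter]
    simp [eq_comm]
  constructor
  · intro hβ
    obtain ⟨i, hi⟩ := (maxPartition s).nonempty_of_mem_parts hβ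
    rw [← (Finpartition.part_eq_iff_mem _ hβ).2 hi, hpart]
    exact ⟨_, ⟨i, by simp [blockSet]⟩, rfl⟩
  · rintro ⟨κ, ⟨i, hi⟩, rfl⟩
    obtain rfl : (s.get i).1 = κ := (Finset.mem_filter.1 hi).2
    rw [← hpart]
    exact (Finpartition.part_mem _).2 (Finset.mem_univ i)

theorem adapted_maxPartition {k : ℕ} (s : List (Fin (k + 1) × F)) :
    Adapted s (maxPartition s) := by
  refine ⟨fun β hβ => ?_, fun i j _ h => ?_⟩
  · obtain ⟨κ, _, rfl⟩ := mem_maxPartition_parts.1 hβ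
    exact ⟨κ, subset_rfl⟩
  · exact ⟨blockSet s (s.get i).1, mem_maxPartition_parts.2 ⟨_, ⟨i, by simp [blockSet]⟩, rfl⟩,
      by simp [blockSet], by simp only [blockSet, Finset.mem_filter, Finset.mem_univ, true_and, h]⟩

/-- A partition which is adapted to `s` and differs from the maximal one has a block which is
a proper part of the set of all positions of one factor. -/
theorem exists_ssubset_blockSet {k : ℕ} {s : List (Fin (k + 1) × F)}
    {π : Finpartition (Finset.univ : Finset (Fin s.length))} (h : Adapted s π)
    (hπ : π ≠ maxPartition s) : ∃ κ, ∃ β ∈ π.parts, β ⊆ blockSet s κ ∧ β ≠ blockSet s κ := by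
  by_contra! hcon
  have hsub : ∀ β ∈ π.parts, ∃ κ, β = blockSet s κ := fun β hβ => by
    obtain ⟨κ, hκ⟩ := h.refines β hβ
    exact ⟨κ, hcon κ β hβ hκ⟩
  refine hπ (Finpartition.ext (Finset.Subset.antisymm (fun β hβ => ?_) (fun β hβ => ?_)))
  · obtain ⟨κ, rfl⟩ := hsub β hβ
    exact mem_maxPartition_parts.2 ⟨κ, π.nonempty_of_mem_parts hβ, rfl⟩
  · obtain ⟨κ, ⟨i, hi⟩, rfl⟩ := mem_maxPartition_parts.1 hβ
    obtain ⟨κ', hκ'⟩ := hsub _ (π.part_mem.2 (Finset.mem_univ i))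
    have hi' : i ∈ blockSet s κ' := by
      rw [← hκ']
      exact π.mem_part (Finset.mem_univ i)
    obtain rfl : κ' = κ := (Finset.mem_filter.1 hi').2.symm.trans (Finset.mem_filter.1 hi).2
    rw [← hκ']
    exact π.part_mem.2 (Finset.mem_univ i)

variable [Finite F] {P : UniversalProduct.{u} F}

/-- The highest coefficient of a word in a family of coefficients. -/
def highest (α : CoeffFamily F) {k : ℕ} (s : List (Fin (k + 1) × F)) : ℂ := α k s (maxPartition s)

variable {α : CoeffFamily F} (hα : P.IsCoefficients α) {C : Type u} [Ring C] [Algebra ℂ C]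
include hα

open scoped Classical in
/-- Any family of coefficients computes the values of words. -/
theorem wordValue_eq_sum_of_isCoefficients {k : ℕ} (s : List (Fin (k + 1) × F)) (hs : s ≠ [])
    (Φ : Fin (k + 1) → C →ₗ[ℂ] ℂ) (c : Fin s.length → C) :
    wordValue P Φ (List.ofFn (fun i => (s.get i, c i))) =
      ∑ π ∈ Finset.univ.filter (Adapted s), α k s π *
        ∏ κ, ∏ β ∈ π.parts.filter (fun β => β ⊆ blockSet s κ),
          Φ κ (((List.finRange s.length).filter (fun l => l ∈ β)).map c).prod := by
  have key := hα k s hs (fun _ => copies F C) (fun κ => pull F (Φ κ))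
    (fun _ i => emb (s.get i).2 (c i)) (fun i => emb_mem _ _)
  have hne : List.ofFn (fun i => iterIncl k (fun _ => copies F C) (s.get i).1
      (emb (s.get i).2 (c i))) ≠ [] := by
    simpa using hs
  have e1 : wordValue P Φ (List.ofFn (fun i => (s.get i, c i))) =
      P.iterProd k (fun _ => copies F C) (fun κ => pull F (Φ κ)) (orderedProd (List.ofFn
        (fun i => iterIncl k (fun _ => copies F C) (s.get i).1 (emb (s.get i).2 (c i))))) := by
    rw [← extend_coe, ← coe_orderedProd _ hne, wordValue, List.map_ofFn, List.map_ofFn]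
    rfl
  have e2 : ∀ L : List (Fin s.length), L ≠ [] →
      fold (F := F) (NonUnitalAlgHom.id ℂ C)
        (orderedProd (L.map (fun i => (emb (s.get i).2 (c i) : copies F C)))) =
      (L.map c).prod := by
    intro L hL
    induction L with
    | nil => exact absurd rfl hL
    | cons a L ih =>
      cases L with
      | nil => simp [orderedProd]
      | cons b L =>
        rw [List.map_cons, List.map_cons, orderedProd, map_mul, ← List.map_cons (f := fun i =>
          (emb (s.get i).2 (c i) : copies F C)), ih (by simp), fold_emb, List.map_cons,
          List.prod_cons]
        rfl
  rw [e1, key]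
  refine Finset.sum_congr rfl (fun π _ => ?_)
  congr 1
  refine Finset.prod_congr rfl (fun κ _ => Finset.prod_congr rfl (fun β hβ => ?_))
  rw [pull_apply, e2]
  obtain ⟨i, hi⟩ := π.nonempty_of_mem_parts (Finset.mem_filter.1 hβ).1
  refine List.ne_nil_of_mem (a := i) ?_
  simpa using hi

theorem wordValue_ofFn_eq_highest {k : ℕ} (s : List (Fin (k + 1) × F)) (hs : s ≠ [])
    (Φ : Fin (k + 1) → C →ₗ[ℂ] ℂ) (hΦ : ∀ κ, Φ κ 1 = 1) (c : Fin s.length → C)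
    (h : ∀ κ, ∀ β ⊆ blockSet s κ, β.Nonempty → β ≠ blockSet s κ →
      Φ κ (((List.finRange s.length).filter (fun l => l ∈ β)).map c).prod = 0) :
    wordValue P Φ (List.ofFn (fun i => (s.get i, c i))) = highest α s *
      ∏ κ, Φ κ (((List.finRange s.length).filter (fun l => l ∈ blockSet s κ)).map c).prod := by
  classical
  rw [wordValue_eq_sum_of_isCoefficients hα s hs, Finset.sum_eq_single (maxPartition s), highest]
  · congr 1
    refine Finset.prod_congr rfl (fun κ _ => ?_)
    by_cases hκ : (blockSet s κ).Nonempty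
    · have hmem : blockSet s κ ∈ (maxPartition s).parts.filter (fun β => β ⊆ blockSet s κ) :=
        Finset.mem_filter.2 ⟨mem_maxPartition_parts.2 ⟨κ, hκ, rfl⟩, subset_rfl⟩
      rw [Finset.prod_eq_single_of_mem _ hmem]
      intro β hβ hne
      obtain ⟨hβ1, hβ2⟩ := Finset.mem_filter.1 hβ
      obtain ⟨κ', ⟨i, hi⟩, rfl⟩ := mem_maxPartition_parts.1 hβ1
      exact absurd (congrArg (blockSet s)
        ((Finset.mem_filter.1 hi).2.symm.trans (Finset.mem_filter.1 (hβ2 hi)).2)) hne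
    · rw [Finset.not_nonempty_iff_eq_empty] at hκ
      rw [hκ, Finset.prod_eq_one]
      · simp [hΦ]
      · intro β hβ
        obtain ⟨hβ1, hβ2⟩ := Finset.mem_filter.1 hβ
        obtain ⟨i, hi⟩ := (maxPartition s).nonempty_of_mem_parts hβ1
        exact absurd (hβ2 hi) (Finset.notMem_empty i)
  · intro π hπ hne
    obtain ⟨κ, β, hβ, h1, h2⟩ := exists_ssubset_blockSet (Finset.mem_filter.1 hπ).2 hne
    rw [Finset.prod_eq_zero (Finset.mem_univ κ), mul_zero]
    exact Finset.prod_eq_zero (Finset.mem_filter.2 ⟨hβ, h1⟩)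
      (h κ β h1 (π.nonempty_of_mem_parts hβ) h2)
  · intro hnot
    exact absurd (Finset.mem_filter.2 ⟨Finset.mem_univ _, adapted_maxPartition s⟩) hnot

/-- If the moments of all proper subwords of the subword of letters from one factor vanish, for
every factor, then only the maximal partition contributes to the value of a word. -/
theorem wordValue_eq_highest {k : ℕ} (Φ : Fin (k + 1) → C →ₗ[ℂ] ℂ) (hΦ : ∀ κ, Φ κ 1 = 1)
    (l : List ((Fin (k + 1) × F) × C)) (hl : l ≠ [])
    (h : ∀ κ, ∀ t, t.Sublist (l.filter (fun p => p.1.1 = κ)) → t ≠ [] →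
      t ≠ l.filter (fun p => p.1.1 = κ) → Φ κ (t.map Prod.snd).prod = 0) :
    wordValue P Φ l = highest α (l.map Prod.fst) *
      ∏ κ, Φ κ ((l.filter (fun p => p.1.1 = κ)).map Prod.snd).prod := by
  obtain ⟨s, c, hs, rfl⟩ : ∃ (s : List (Fin (k + 1) × F)) (c : Fin s.length → C),
      l.map Prod.fst = s ∧ l = (List.finRange s.length).map (fun i => (s.get i, c i)) := by
    refine ⟨l.map Prod.fst, fun i => (l.get (i.cast (by simp))).2, rfl, ?_⟩
    apply List.ext_getElem (by simp)
    intro i h1 h2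
    simp
  have hs' : s ≠ [] := by
    rintro rfl
    simp at hl
  have hfilter : ∀ κ, ((List.finRange s.length).map (fun i => (s.get i, c i))).filter
      (fun p => p.1.1 = κ) = ((List.finRange s.length).filter (fun i => i ∈ blockSet s κ)).map
        (fun i => (s.get i, c i)) := by
    intro κ
    rw [List.filter_map]
    congr 1
    refine List.filter_congr (fun i _ => ?_)
    simp [blockSet]
  have hmap : ∀ L : List (Fin s.length), (L.map (fun i => (s.get i, c i))).map Prod.snd =
      L.map c := by
    intro L
    rw [List.map_map]
    rfl
  rw [hs]
  simp only [hfilter, hmap] at h ⊢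
  rw [← List.ofFn_eq_map]
  refine wordValue_ofFn_eq_highest hα s hs' Φ hΦ c (fun κ β hβ hne hβ' => ?_)
  have hsub : ((List.finRange s.length).filter (fun i => i ∈ β)).Sublist
      ((List.finRange s.length).filter (fun i => i ∈ blockSet s κ)) := by
    refine List.monotone_filter_right _ (fun i hi => ?_)
    have : i ∈ β := by simpa using hi
    simpa using hβ this
  rw [← hmap]
  refine h κ _ (hsub.map _) ?_ ?_
  · obtain ⟨i, hi⟩ := hne
    rw [ne_eq, List.map_eq_nil_iff]
    refine List.ne_nil_of_mem (a := i) ?_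
    simpa using hi
  · intro e
    have e' := hsub.eq_of_length (by simpa using congrArg List.length e)
    refine hβ' (Finset.Subset.antisymm hβ (fun i hi => ?_))
    have : i ∈ (List.finRange s.length).filter (fun i => i ∈ β) := by
      rw [e']
      simpa using hi
    simpa using this

end Highest

/-! ### Roots of unity -/

section Roots

/-- The `*`-algebra of all functions on `ℂ`, lifted to the universe `u`. -/
abbrev RootAlgebra : Type u := ULift.{u} ℂ → ℂ

/-- The identity function on `ℂ`. -/
def rootVariable : RootAlgebra.{u} := ULift.down

/-- The mean over the `N`-th roots of unity, and the evaluation at `1` for `N = 0`. -/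
def rootState (N : ℕ) : RootAlgebra.{u} →ₗ[ℂ] ℂ :=
  ((max N 1 : ℕ) : ℂ)⁻¹ • ∑ j ∈ Finset.range (max N 1),
    LinearMap.proj (ULift.up (Complex.exp (2 * Real.pi * Complex.I / (max N 1 : ℕ)) ^ j))

theorem rootState_apply (N : ℕ) (x : RootAlgebra.{u}) :
    rootState N x = ((max N 1 : ℕ) : ℂ)⁻¹ * ∑ j ∈ Finset.range (max N 1),
      x (ULift.up (Complex.exp (2 * Real.pi * Complex.I / (max N 1 : ℕ)) ^ j)) := by
  simp [rootState]

theorem rootState_one (N : ℕ) : rootState N (1 : RootAlgebra.{u}) = 1 := by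
  have : ((max N 1 : ℕ) : ℂ) ≠ 0 := Nat.cast_ne_zero.2 (by omega)
  rw [rootState_apply]
  simp only [Pi.one_apply, Finset.sum_const, Finset.card_range, nsmul_eq_mul, mul_one]
  exact inv_mul_cancel₀ this

theorem rootState_nonneg (N : ℕ) (x : RootAlgebra.{u}) : 0 ≤ rootState N (star x * x) := by
  rw [rootState_apply]
  refine mul_nonneg (inv_nonneg.2 (Nat.cast_nonneg _)) (Finset.sum_nonneg (fun j _ => ?_))
  exact star_mul_self_nonneg _

theorem rootState_star (N : ℕ) (x : RootAlgebra.{u}) :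
    rootState N (star x) = conj (rootState N x) := by
  simp [rootState_apply]

theorem rootState_variable_pow {N m : ℕ} (h0 : 0 < m) (h1 : m < N) :
    rootState N (rootVariable.{u} ^ m) = 0 := by
  have hN : max N 1 = N := by omega
  have hζ := Complex.isPrimitiveRoot_exp N (by omega)
  rw [rootState_apply, hN]
  set ζ := Complex.exp (2 * Real.pi * Complex.I / N)
  have e : ∀ j, (rootVariable.{u} ^ m) (ULift.up (ζ ^ j)) = (ζ ^ m) ^ j := fun j => by
    rw [Pi.pow_apply, rootVariable, pow_right_comm]
  simp only [e]
  rw [geom_sum_eq (hζ.pow_ne_one_of_pos_of_lt h0.ne' h1), pow_right_comm, hζ.pow_eq_one]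
  simp

theorem rootState_variable_pow_self (N : ℕ) : rootState N (rootVariable.{u} ^ N) = 1 := by
  rw [← rootState_one.{u} N, rootState_apply, rootState_apply]
  congr 1
  refine Finset.sum_congr rfl (fun j _ => ?_)
  rw [Pi.pow_apply, rootVariable, Pi.one_apply, pow_right_comm]
  rcases Nat.eq_zero_or_pos N with rfl | hN
  · simp
  · have hN' : max N 1 = N := by omega
    rw [hN', (Complex.isPrimitiveRoot_exp N hN.ne').pow_eq_one, one_pow]

end Roots

/-! ### Words with letters from the algebra of functions on the roots of unity -/

section RootWords

variable {F : Type v}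

theorem sum_lt_of_sublist {β : Type*} (e : β → ℕ) {t l : List β} (h : t.Sublist l)
    (he : ∀ b ∈ l, 0 < e b) (hne : t ≠ l) : (t.map e).sum < (l.map e).sum := by
  induction h with
  | slnil => exact absurd rfl hne
  | @cons t l b h ih =>
    have hb := he b (by simp)
    have hle : (t.map e).sum ≤ (l.map e).sum := (h.map e).sum_le_sum (fun _ _ => Nat.zero_le _)
    simp only [List.map_cons, List.sum_cons]
    omega
  | @cons_cons t l b h ih =>
    have := ih (fun b hb => he b (by simp [hb])) (fun e => hne (by rw [e]))
    simp only [List.map_cons, List.sum_cons]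
    omega

/-- The number of letters of a word from the factor `κ`. -/
def blockSize {k : ℕ} (w : List (Fin (k + 1) × F)) (κ : Fin (k + 1)) : ℕ :=
  w.countP (fun p => p.1 = κ)

/-- The states used to detect the highest coefficient of the word `w`. -/
def rootStates {k : ℕ} (w : List (Fin (k + 1) × F)) (κ : Fin (k + 1)) :
    RootAlgebra.{u} →ₗ[ℂ] ℂ := rootState (blockSize w κ)

theorem sum_filter_const_one {k : ℕ} (w : List (Fin (k + 1) × F)) (κ : Fin (k + 1)) :
    (((w.map (fun p => (p, 1))).filter (fun p => p.1.1 = κ)).map Prod.snd).sum =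
      blockSize w κ := by
  induction w with
  | nil => rfl
  | cons a w ih =>
    by_cases h : a.1 = κ
    · simp [blockSize, h] at ih ⊢
      omega
    · simp [blockSize, h] at ih ⊢
      omega

variable [Finite F] {P : UniversalProduct.{u} F} {α : CoeffFamily F}

/-- The highest coefficient is the value of any word whose letters are powers of an element `x`,
provided that `x ^ N κ` is the first power of `x` with nonvanishing moment with respect to the
factor `κ`, where `N κ` is the sum of the exponents of the letters from the factor `κ`. -/
theorem wordValue_pow_eq_highest (hα : P.IsCoefficients α) {C : Type u} [Ring C] [Algebra ℂ C]
    {k : ℕ} (Φ : Fin (k + 1) → C →ₗ[ℂ] ℂ) (hΦ : ∀ κ, Φ κ 1 = 1) (x : C) (N : Fin (k + 1) → ℕ)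
    (h0 : ∀ κ m, 0 < m → m < N κ → Φ κ (x ^ m) = 0) (h1 : ∀ κ, Φ κ (x ^ N κ) = 1)
    (l : List ((Fin (k + 1) × F) × ℕ)) (hl : l ≠ []) (hpos : ∀ p ∈ l, 0 < p.2)
    (hN : ∀ κ, ((l.filter (fun p => p.1.1 = κ)).map Prod.snd).sum = N κ) :
    wordValue P Φ (l.map (fun p => (p.1, x ^ p.2))) = highest α (l.map Prod.fst) := by
  have hfilter : ∀ κ, (l.map (fun p => (p.1, x ^ p.2))).filter (fun p => p.1.1 = κ) =
      (l.filter (fun p => p.1.1 = κ)).map (fun p => (p.1, x ^ p.2)) := fun κ => by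
    rw [List.filter_map]
    rfl
  have hprod : ∀ t : List ((Fin (k + 1) × F) × ℕ),
      ((t.map (fun p => (p.1, x ^ p.2))).map Prod.snd).prod = x ^ (t.map Prod.snd).sum := by
    intro t
    induction t with
    | nil => simp
    | cons a t ih => simp only [List.map_cons, List.prod_cons, List.sum_cons, pow_add, ih]
  rw [wordValue_eq_highest hα Φ hΦ _ (by simpa using hl), List.map_map]
  · simp only [hfilter, hprod, hN, h1, Finset.prod_const_one, mul_one]
    rfl
  · intro κ t ht hne hne'
    rw [hfilter] at ht hne'
    obtain ⟨t, ht', rfl⟩ := List.sublist_map_iff.1 ht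
    have hpos' : ∀ p ∈ l.filter (fun p => p.1.1 = κ), 0 < p.2 := fun p hp =>
      hpos p (List.mem_of_mem_filter hp)
    rw [hprod]
    refine h0 κ _ ?_ ?_
    · obtain ⟨p, hp⟩ := List.exists_mem_of_ne_nil t (by simpa using hne)
      exact (hpos' p (ht'.subset hp)).trans_le
        (List.single_le_sum (fun _ _ => Nat.zero_le _) _ (List.mem_map.2 ⟨p, hp, rfl⟩))
    · rw [← hN]
      exact sum_lt_of_sublist _ ht' hpos' (fun e => hne' (by rw [e]))

theorem wordValue_rootVariable (hα : P.IsCoefficients α) {k : ℕ} (w : List (Fin (k + 1) × F))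
    (hw : w ≠ []) : wordValue P (rootStates.{u} w) (w.map (fun p => (p, rootVariable))) =
      highest α w := by
  have := wordValue_pow_eq_highest hα (rootStates.{u} w) (fun κ => rootState_one _) rootVariable
    (blockSize w) (fun κ m => rootState_variable_pow) (fun κ => rootState_variable_pow_self _)
    (w.map (fun p => (p, 1))) (by simpa using hw)
    (by
      intro p hp
      obtain ⟨q, _, rfl⟩ := List.mem_map.1 hp
      exact one_pos)
    (sum_filter_const_one w)
  simpa [Function.comp_def] using this

theorem wordValue_star_rootVariable (hα : P.IsCoefficients α) {k : ℕ}
    (w : List (Fin (k + 1) × F)) (hw : w ≠ []) :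
    wordValue P (rootStates.{u} w) (w.map (fun p => (p, star rootVariable))) = highest α w := by
  have := wordValue_pow_eq_highest hα (rootStates.{u} w) (fun κ => rootState_one _)
    (star rootVariable) (blockSize w)
    (fun κ m h h' => by
      rw [← star_pow, rootStates, rootState_star, rootState_variable_pow h h', map_zero])
    (fun κ => by
      rw [← star_pow, rootStates, rootState_star, rootState_variable_pow_self, map_one])
    (w.map (fun p => (p, 1))) (by simpa using hw)
    (by
      intro p hp
      obtain ⟨q, _, rfl⟩ := List.mem_map.1 hp
      exact one_pos)
    (sum_filter_const_one w)
  simpa [Function.comp_def] using this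

/-- A value of a word in the variable vanishes if some factor contributes too few letters. -/
theorem wordValue_rootVariable_eq_zero {k : ℕ} (N : Fin (k + 1) → ℕ)
    (w : List (Fin (k + 1) × F)) (κ : Fin (k + 1)) (h0 : 0 < blockSize w κ)
    (h1 : blockSize w κ < N κ) : wordValue P (fun κ => rootState.{u} (N κ))
      (w.map (fun p => (p, rootVariable))) = 0 := by
  obtain ⟨p, hp, hpκ⟩ := List.countP_pos_iff.1 h0
  obtain ⟨i, rfl⟩ := List.get_of_mem hp
  obtain rfl : (w.get i).1 = κ := by simpa using hpκ
  have e : w.map (fun p => (p, rootVariable.{u})) =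
      List.ofFn (fun i => (w.get i, rootVariable)) := by
    apply List.ext_getElem (by simp)
    intro i h1 h2
    simp
  rw [e]
  refine wordValue_eq_zero P w.get _ (fun _ => rootVariable) i (fun v hv hi hs => ?_)
  rw [List.map_const', List.prod_replicate]
  refine rootState_variable_pow (List.length_pos_of_mem hi) (lt_of_le_of_lt ?_ h1)
  have e2 : ∀ κ, blockSize w κ =
      ((List.finRange w.length).filter (fun j => (w.get j).1 = κ)).length := fun κ => by
    rw [blockSize, ← List.countP_eq_length_filter]
    conv_lhs => rw [← List.map_get_finRange w, List.countP_map]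
    rfl
  rw [e2]
  refine (List.subperm_of_subset hv (fun j hj => ?_)).length_le
  simpa using hs j hj

/-- Repeated neighbouring letters do not change the highest coefficient. -/
theorem highest_append_cons_cons (hα : P.IsCoefficients α) {k : ℕ}
    (w₁ w₂ : List (Fin (k + 1) × F)) (a : Fin (k + 1) × F) :
    highest α (w₁ ++ a :: a :: w₂) = highest α (w₁ ++ a :: w₂) := by
  have hmap : ∀ w : List (Fin (k + 1) × F), (w.map (fun p => (p, 1))).map
      (fun p => (p.1, rootVariable.{u} ^ p.2)) = w.map (fun p => (p, rootVariable)) := fun w => by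
    simp [Function.comp_def]
  have := wordValue_pow_eq_highest hα (rootStates.{u} (w₁ ++ a :: a :: w₂))
    (fun κ => rootState_one _) rootVariable (blockSize (w₁ ++ a :: a :: w₂))
    (fun κ m => rootState_variable_pow) (fun κ => rootState_variable_pow_self _)
    (w₁.map (fun p => (p, 1)) ++ (a, 2) :: w₂.map (fun p => (p, 1))) (by simp)
    (by
      intro p hp
      simp only [List.mem_append, List.mem_cons, List.mem_map] at hp
      rcases hp with ⟨q, _, rfl⟩ | rfl | ⟨q, _, rfl⟩ <;> simp)
    (fun κ => by
      rw [← sum_filter_const_one]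
      by_cases h : a.1 = κ <;> simp [h, ← add_assoc])
  rw [← wordValue_rootVariable hα _ (by simp)]
  simp only [List.map_append, List.map_cons, hmap] at this ⊢
  rw [wordValue_merge, ← pow_two, this]
  simp [Function.comp_def]

theorem highest_append_destutter' [DecidableEq F] (hα : P.IsCoefficients α) {k : ℕ} :
    ∀ (w₁ w₂ : List (Fin (k + 1) × F)) (a : Fin (k + 1) × F),
      highest α (w₁ ++ w₂.destutter' (· ≠ ·) a) = highest α (w₁ ++ a :: w₂)
  | w₁, [], a => rfl
  | w₁, b :: w₂, a => by
    by_cases h : a = b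
    · subst h
      rw [List.destutter'_cons_neg _ (by simp), highest_append_destutter' hα,
        highest_append_cons_cons hα]
    · rw [List.destutter'_cons_pos _ (by exact h), List.append_cons w₁ a,
        highest_append_destutter' hα, List.append_assoc]
      rfl

theorem highest_destutter [DecidableEq F] (hα : P.IsCoefficients α) {k : ℕ}
    (w : List (Fin (k + 1) × F)) : highest α (w.destutter (· ≠ ·)) = highest α w := by
  cases w with
  | nil => rfl
  | cons a w => exact highest_append_destutter' hα [] w a

theorem highest_one_block (hα : P.IsCoefficients α) (w : List (Fin 1 × F)) (hw : w ≠ []) :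
    highest α w = 1 := by
  have hs : blockSize w 0 = w.length :=
    List.countP_eq_length.2 (fun p _ => by simpa using Fin.fin_one_eq_zero p.1)
  rw [← wordValue_rootVariable hα w hw, wordValue_of_forall_eq P _ 0 (rootState_one _) _
    (fun p _ => Fin.fin_one_eq_zero _), List.map_map]
  change rootState _ (w.map (fun _ => rootVariable)).prod = 1
  rw [List.map_const', List.prod_replicate, ← hs]
  exact rootState_variable_pow_self _

end RootWords

/-! ### Mirror images and extremal letters -/

section Mirror

variable {F : Type v} [Finite F] {P : UniversalProduct.{u} F} {α : CoeffFamily F}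

/-- Product functionals of states are hermitian. -/
theorem wordValue_reverse (hP : P.IsPositive) {C : Type u} [Ring C] [Algebra ℂ C] [StarRing C]
    [StarModule ℂ C] {k : ℕ} (Φ : Fin (k + 1) → C →ₗ[ℂ] ℂ) (hΦ : ∀ κ, Φ κ 1 = 1)
    (hpos : ∀ κ x, 0 ≤ Φ κ (star x * x)) (l : List ((Fin (k + 1) × F) × C)) :
    wordValue P Φ (l.reverse.map (fun p => (p.1, star p.2))) = conj (wordValue P Φ l) := by
  obtain ⟨U, _, _, _, _, ψ, θ, hψ, hθ, h⟩ := exists_representation hP Φ hΦ hpos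
  rw [h, h, ← apply_star hψ, star_prod_map _ (fun p => (p.1, star p.2)) (fun p => hθ p.1 p.2)]

/-- In the cyclic representation, applying an element of one factor to the cyclic vector gives
the same vector for all faces. -/
theorem wordValue_append_singleton (hP : P.IsPositive) {C : Type u} [Ring C] [Algebra ℂ C]
    [StarRing C] [StarModule ℂ C] {k : ℕ} (Φ : Fin (k + 1) → C →ₗ[ℂ] ℂ) (hΦ : ∀ κ, Φ κ 1 = 1)
    (hpos : ∀ κ x, 0 ≤ Φ κ (star x * x)) (l : List ((Fin (k + 1) × F) × C)) (κ : Fin (k + 1))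
    (f g : F) (c : C) :
    wordValue P Φ (l ++ [((κ, f), c)]) = wordValue P Φ (l ++ [((κ, g), c)]) := by
  obtain ⟨U, _, _, _, _, ψ, θ, hψ, hθ, h⟩ := exists_representation hP Φ hΦ hpos
  have key : ∀ f g : F, ψ (star (θ (κ, f) c) * θ (κ, g) c) = Φ κ (star c * c) := by
    intro f g
    have e := h [((κ, f), star c), ((κ, g), c)]
    rw [wordValue_of_forall_eq P Φ κ (hΦ κ) _ (by simp)] at e
    rw [hθ]
    simpa using e.symm
  have hx : ψ (star (θ (κ, f) c - θ (κ, g) c) * (θ (κ, f) c - θ (κ, g) c)) = 0 := by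
    rw [star_sub, sub_mul, mul_sub, mul_sub, map_sub, map_sub, map_sub, key, key, key, key]
    ring
  have := apply_mul_eq_zero hψ hx (l.map (fun p => θ p.1 p.2)).prod
  rw [mul_sub, map_sub, sub_eq_zero] at this
  rw [h, h]
  simpa using this

theorem highest_reverse (hP : P.IsPositive) (hα : P.IsCoefficients α) {k : ℕ}
    (w : List (Fin (k + 1) × F)) (hw : w ≠ []) : highest α w.reverse = conj (highest α w) := by
  have e : rootStates.{u} w.reverse = rootStates w := by
    funext κ
    simp [rootStates, blockSize]
  rw [← wordValue_star_rootVariable hα w.reverse (by simpa using hw),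
    ← wordValue_rootVariable hα w hw, e, ← wordValue_reverse hP (rootStates.{u} w)
      (fun κ => rootState_one _) (fun κ => rootState_nonneg _), ← List.map_reverse, List.map_map]
  rfl

theorem highest_append_singleton (hP : P.IsPositive) (hα : P.IsCoefficients α) {k : ℕ}
    (w : List (Fin (k + 1) × F)) (κ : Fin (k + 1)) (f g : F) :
    highest α (w ++ [(κ, f)]) = highest α (w ++ [(κ, g)]) := by
  have e : rootStates.{u} (w ++ [(κ, f)]) = rootStates (w ++ [(κ, g)]) := by
    funext κ'
    simp [rootStates, blockSize]
  rw [← wordValue_rootVariable hα _ (by simp), ← wordValue_rootVariable hα _ (by simp), e,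
    List.map_append, List.map_append]
  exact wordValue_append_singleton hP _ (fun κ => rootState_one _) (fun κ => rootState_nonneg _)
    _ _ _ _ _

theorem highest_cons (hP : P.IsPositive) (hα : P.IsCoefficients α) {k : ℕ}
    (w : List (Fin (k + 1) × F)) (κ : Fin (k + 1)) (f g : F) :
    highest α ((κ, f) :: w) = highest α ((κ, g) :: w) := by
  have h := highest_append_singleton hP hα w.reverse κ f g
  rw [← List.reverse_cons, ← List.reverse_cons, highest_reverse hP hα _ (by simp),
    highest_reverse hP hα _ (by simp)] at h
  exact (starRingEnd ℂ).injective h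

theorem highest_eq_of_extremal (hP : P.IsPositive) (hα : P.IsCoefficients α) {k : ℕ}
    {w w' : List (Fin (k + 1) × F)} (h1 : w.map Prod.fst = w'.map Prod.fst)
    (h2 : ∀ i : ℕ, 0 < i → i + 1 < w.length → w[i]? = w'[i]?) : highest α w = highest α w' := by
  have hlen : w.length = w'.length := by simpa using congrArg List.length h1
  rcases List.eq_nil_or_concat w with rfl | ⟨v, x, rfl⟩
  · rw [List.eq_nil_of_length_eq_zero hlen.symm]
  rcases List.eq_nil_or_concat w' with rfl | ⟨v', x', rfl⟩
  · simp at hlen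
  obtain ⟨κ, f⟩ := x
  obtain ⟨κ', f'⟩ := x'
  have hlen' : v.length = v'.length := by simpa using hlen
  simp only [List.concat_eq_append] at h1 h2 ⊢
  simp only [List.map_append] at h1
  obtain ⟨h3, h4⟩ := List.append_inj h1 (by simpa using hlen')
  obtain rfl : κ = κ' := by simpa using h4
  rw [highest_append_singleton hP hα v κ f f']
  cases v with
  | nil =>
    rw [List.eq_nil_of_length_eq_zero hlen'.symm]
  | cons y v =>
    cases v' with
    | nil => simp at hlen'
    | cons y' v' =>
      have hv : v = v' := by
        have hlen'' : v.length = v'.length := by simpa using hlen'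
        apply List.ext_getElem?
        intro i
        by_cases hi : i < v.length
        · have := h2 (i + 1) (by omega) (by simpa using hi)
          simpa [List.getElem?_append_left hi, List.getElem?_append_left (hlen'' ▸ hi)] using this
        · rw [List.getElem?_eq_none (by omega), List.getElem?_eq_none (by omega)]
      obtain ⟨κ₀, g⟩ := y
      obtain ⟨κ₀', g'⟩ := y'
      obtain rfl : κ₀ = κ₀' := by
        have := congrArg List.head? h3
        simpa using this
      rw [hv, List.cons_append, List.cons_append]
      exact highest_cons hP hα _ _ _ _

theorem highest_two (hP : P.IsPositive) (hα : P.IsCoefficients α) {κ κ' : Fin 2} (h : κ ≠ κ')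
    (f g : F) : highest α [(κ, f), (κ', g)] = 1 := by
  have h1 : ∀ j, rootStates.{u} [(κ, f), (κ', g)] j = rootState 1 := by
    intro j
    have : blockSize [(κ, f), (κ', g)] j = 1 := by
      revert h
      fin_cases κ <;> fin_cases κ' <;> fin_cases j <;> simp [blockSize]
    rw [rootStates, this]
  have heval : ∀ x : RootAlgebra.{u}, rootState 1 x = x (ULift.up 1) := fun x => by
    simp [rootState_apply]
  have hone := fun j : Fin 2 => rootState_one.{u} (blockSize [(κ, f), (κ', g)] j)
  obtain ⟨U, _, _, _, _, ψ, θ, hψ, hθ, hv⟩ := exists_representation hP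
    (rootStates.{u} [(κ, f), (κ', g)]) hone (fun κ => rootState_nonneg _)
  have hval : ∀ (j : Fin 2) (l : List ((Fin 2 × F) × RootAlgebra.{u})), (∀ p ∈ l, p.1.1 = j) →
      ψ (l.map (fun p => θ p.1 p.2)).prod = (l.map Prod.snd).prod (ULift.up 1) := by
    intro j l hl
    rw [← hv, wordValue_of_forall_eq P _ j (hone j) l hl, h1, heval]
  have hu : rootVariable.{u} (ULift.up 1) = 1 := rfl
  -- The variable has the same moments as `1`, so it fixes the cyclic vector.
  have hx : ψ (star (1 - θ (κ', g) rootVariable) * (1 - θ (κ', g) rootVariable)) = 0 := by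
    have e0 := hval κ' [] (by simp)
    have e1 := hval κ' [((κ', g), rootVariable)] (by simp)
    have e2 := hval κ' [((κ', g), star rootVariable)] (by simp)
    have e3 := hval κ' [((κ', g), star rootVariable), ((κ', g), rootVariable)] (by simp)
    simp only [List.map_nil, List.map_cons, List.prod_nil, List.prod_cons, mul_one,
      Pi.star_apply, Pi.mul_apply, Pi.one_apply, hu, star_one] at e0 e1 e2 e3
    rw [star_sub, star_one, hθ, sub_mul, mul_sub, mul_sub, one_mul, one_mul, mul_one, map_sub,
      map_sub, map_sub, e0, e1, e2, e3]
    ring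
  have e := apply_mul_eq_zero hψ hx (θ (κ, f) rootVariable)
  have e1 := hval κ [((κ, f), rootVariable)] (by simp)
  simp only [List.map_nil, List.map_cons, List.prod_nil, List.prod_cons, mul_one, hu] at e1
  rw [mul_sub, map_sub, sub_eq_zero, mul_one, e1] at e
  rw [← wordValue_rootVariable hα _ (by simp), hv]
  simpa using e.symm

end Mirror

/-! ### Free products of neighbouring factors -/

section Unite

variable {F : Type v} [Finite F] (P : UniversalProduct.{u} F)

theorem predAbove_ne {k : ℕ} {κ : Fin (k + 1)} {j : Fin (k + 2)} (h1 : j ≠ κ.castSucc)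
    (h2 : j ≠ κ.succ) : κ.predAbove j ≠ κ := by
  intro h
  have := Fin.succ_succAbove_predAbove h2
  rw [h, Fin.succAbove_of_castSucc_lt _ _ Fin.castSucc_lt_succ] at this
  exact h1 this.symm

/-- A word with letters from `k + 2` factors is a word with letters from `k + 1` factors, where
two neighbouring factors are replaced by their free product, equipped with the product of the
two functionals.

The letters `c` of `C` become letters `ι (j, f) c` of a common algebra `D`, the unitization of the
free product of two copies of `copies F C`. Under the functional of the united factor, moments of
letters from the two factors are values of words for these two factors. -/
theorem exists_unite {C : Type u} [Ring C] [Algebra ℂ C] {k : ℕ}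
    (Φ : Fin (k + 2) → C →ₗ[ℂ] ℂ) (hΦ : ∀ κ, Φ κ 1 = 1) (κ : Fin (k + 1)) :
    ∃ (D : Type u) (_ : Ring D) (_ : Algebra ℂ D) (Ψ : Fin (k + 1) → D →ₗ[ℂ] ℂ)
      (ι : Fin (k + 2) × F → C → D), (∀ j, Ψ j 1 = 1) ∧
      (∀ j, j ≠ κ.castSucc → j ≠ κ.succ → ∀ l : List ((Fin (k + 2) × F) × C),
        (∀ p ∈ l, p.1.1 = j) →
          Ψ (κ.predAbove j) (l.map (fun p => ι p.1 p.2)).prod = Φ j (l.map Prod.snd).prod) ∧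
      (∀ l : List ((Fin (k + 2) × F) × C), (∀ p ∈ l, p.1.1 = κ.castSucc ∨ p.1.1 = κ.succ) →
        Ψ κ (l.map (fun p => ι p.1 p.2)).prod =
          wordValue P (k := 1) ![Φ κ.castSucc, Φ κ.succ] (l.map (fun p =>
            ((if p.1.1 = κ.succ then 1 else 0, p.1.2), p.2)))) ∧
      ∀ l, wordValue P Φ l =
        wordValue P Ψ (l.map (fun p => ((κ.predAbove p.1.1, p.1.2), ι p.1 p.2))) := by
  let A := copies F C
  let D := Unitization ℂ (A.coprod A)
  let φ : Functional (A.coprod A) := P.prod (pull F (Φ κ.castSucc)) (pull F (Φ κ.succ))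
  let R : D →ₐ[ℂ] C := Unitization.lift (MFAlg.coprodLift (A := A) (B := A)
    (fold (F := F) (NonUnitalAlgHom.id ℂ C)) (fold (F := F) (NonUnitalAlgHom.id ℂ C)))
  let ι : Fin (k + 2) → F → C →ₙₐ[ℂ] D := fun j f =>
    (Unitization.inrNonUnitalAlgHom ℂ (A.coprod A)).comp
      ((if j = κ.succ then (MFAlg.inr A A).hom else (MFAlg.inl A A).hom).comp (emb f))
  have hR : ∀ j f c, R (ι j f c) = c := by
    intro j f c
    have hlift : ∀ x : A.coprod A, R (Unitization.inr x) = MFAlg.coprodLift (A := A) (B := A)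
        (fold (F := F) (NonUnitalAlgHom.id ℂ C)) (fold (F := F) (NonUnitalAlgHom.id ℂ C)) x :=
      fun x => by
        change algebraMap ℂ C 0 + _ = _
        rw [map_zero, zero_add]
        rfl
    by_cases hj : j = κ.succ
    · have e : ι j f c = Unitization.inr ((MFAlg.inr A A).hom (emb f c)) := by simp [ι, hj]
      rw [e, hlift]
      exact (MFAlg.coprodLift_inr _ _ _).trans (fold_emb _ _ _)
    · have e : ι j f c = Unitization.inr ((MFAlg.inl A A).hom (emb f c)) := by simp [ι, hj]
      rw [e, hlift]
      exact (MFAlg.coprodLift_inl _ _ _).trans (fold_emb _ _ _)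
  let Ψ : Fin (k + 1) → D →ₗ[ℂ] ℂ := fun i =>
    if i = κ then extend φ else Φ (κ.succ.succAbove i) ∘ₗ R.toLinearMap
  have hΨκ : Ψ κ = extend φ := if_pos rfl
  have hΨ : ∀ j, j ≠ κ.castSucc → j ≠ κ.succ → Ψ (κ.predAbove j) = Φ j ∘ₗ R.toLinearMap := by
    intro j h1 h2
    simp only [Ψ]
    rw [if_neg (predAbove_ne h1 h2), Fin.succ_succAbove_predAbove h2]
  choose g hg using fun j => exists_copies_lift (F := F) (C := C) (D := copies F D)
    (fun f => (emb f).comp (ι j f))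
  let G : ∀ j, MFHom A (copies F D) := fun j => ⟨g j, by
    rintro f x ⟨c, rfl⟩
    exact ⟨ι j f c, (hg j f c).symm⟩⟩
  have hfold : ∀ j x, fold (F := F) (NonUnitalAlgHom.id ℂ D) (g j x) =
      (if j = κ.succ then (MFAlg.inr A A).hom x else (MFAlg.inl A A).hom x : A.coprod A) := by
    intro j x
    have e : (fold (F := F) (NonUnitalAlgHom.id ℂ D)).comp (g j) =
        (Unitization.inrNonUnitalAlgHom ℂ (A.coprod A)).comp
          (if j = κ.succ then (MFAlg.inr A A).hom else (MFAlg.inl A A).hom) := by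
      apply copies_hom_ext
      intro f c
      simp [hg, ι]
    have := DFunLike.congr_fun e x
    by_cases hj : j = κ.succ
    · simpa [hj] using this
    · simpa [hj] using this
  have hne : κ.castSucc ≠ κ.succ := Fin.castSucc_lt_succ.ne
  obtain ⟨H, H1, H2⟩ := exists_iterProd_unite P k κ A (copies F D) (fun j => pull F (Φ j))
    (fun i => pull F (Ψ i)) G
    (by
      intro j h1 h2
      ext x
      rw [Functional.comp_apply, pull_apply, pull_apply, hΨ j h1 h2]
      have e : (R : D →ₙₐ[ℂ] C).comp ((fold (F := F) (NonUnitalAlgHom.id ℂ D)).comp (g j)) =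
          fold (F := F) (NonUnitalAlgHom.id ℂ C) := by
        apply copies_hom_ext
        intro f c
        change R (fold (F := F) (NonUnitalAlgHom.id ℂ D) (g j (emb f c))) = _
        rw [hg, NonUnitalAlgHom.comp_apply, fold_emb, fold_emb]
        exact hR j f c
      exact congrArg (Φ j) (DFunLike.congr_fun e x).symm)
    (by
      ext x
      rw [Functional.comp_apply, pull_apply, hΨκ]
      have e : (fold (F := F) (NonUnitalAlgHom.id ℂ D)).comp
          ((G κ.castSucc).desc (G κ.succ)).hom =
          Unitization.inrNonUnitalAlgHom ℂ (A.coprod A) := by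
        apply MFAlg.coprod_hom_ext
        · intro a
          have e1 := hfold κ.castSucc a
          rw [if_neg hne] at e1
          exact (congrArg (fold (F := F) (NonUnitalAlgHom.id ℂ D))
            (MFHom.desc_inl (G κ.castSucc) (G κ.succ) a)).trans e1
        · intro a
          have e1 := hfold κ.succ a
          rw [if_pos rfl] at e1
          exact (congrArg (fold (F := F) (NonUnitalAlgHom.id ℂ D))
            (MFHom.desc_inr (G κ.castSucc) (G κ.succ) a)).trans e1
      have e1 := DFunLike.congr_fun e x
      exact ((congrArg (extend φ) e1).trans (extend_coe φ x)).symm)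
  refine ⟨D, inferInstance, inferInstance, Ψ, fun s c => ι s.1 s.2 c, fun j => ?_, ?_, ?_, ?_⟩
  · by_cases hj : j = κ
    · subst hj
      rw [hΨκ]
      simp [extend, unitalExt]
    · simp [Ψ, hj, hΦ]
  · intro j h1 h2 l hl
    rw [hΨ j h1 h2, LinearMap.comp_apply, AlgHom.toLinearMap_apply, map_list_prod, List.map_map]
    congr 3
    funext p
    exact hR _ _ _
  · intro l hl
    rw [hΨκ, wordValue, List.map_map]
    change _ = extend φ _
    congr 2
    refine List.map_congr_left (fun p hp => ?_)
    rcases hl p hp with h | h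
    · simp [ι, h, hne]
      rfl
    · simp [ι, h]
      rfl
  · intro l
    rw [wordValue_eq_of_hom P Φ _ H.hom H2, wordValue, List.map_map]
    congr 3
    funext p
    exact congrArg Unitization.inr ((H1 _ _).trans (congrArg (iterIncl k _ _) (hg _ _ _)))

end Unite

/-! ### Uniting neighbouring blocks -/

section Factorization

theorem eq_append_get_cons_get {β : Type*} {l : List β} {i j : Fin l.length}
    (h : (i : ℕ) + 1 = j) : l = l.take i ++ l.get i :: l.get j :: l.drop (j + 1) := by
  have hi : (i : ℕ) + 1 < l.length := h ▸ j.2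
  obtain rfl : j = ⟨i + 1, hi⟩ := Fin.ext h.symm
  simp only [List.get_eq_getElem, List.getElem_cons_drop, List.take_append_drop]

theorem sum_add_le_of_sublist {β : Type*} (e : β → ℕ) {t l : List β} (h : t.Sublist l) {x : β}
    (hx : x ∈ l) (hx' : x ∉ t) : (t.map e).sum + e x ≤ (l.map e).sum := by
  classical
  have h1 := h.erase x
  rw [List.erase_of_not_mem hx'] at h1
  have h2 : (t.map e).sum ≤ ((l.erase x).map e).sum :=
    (h1.map e).sum_le_sum (fun _ _ => Nat.zero_le _)
  have h3 := List.sum_map_erase e hx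
  omega

/-- If some entry `x` of a list has positive weight with respect to two weight functions, then any
proper nonempty sublist has a nontrivial total weight with respect to one of the weights. -/
theorem sum_lt_or_sum_lt_of_sublist {β : Type*} (e₀ e₁ : β → ℕ) {t l : List β} (h : t.Sublist l)
    (hne : t ≠ []) (hne' : t ≠ l) (hpos : ∀ x ∈ l, 0 < e₀ x + e₁ x) {x : β} (hx : x ∈ l)
    (h0 : 0 < e₀ x) (h1 : 0 < e₁ x) :
    (0 < (t.map e₀).sum ∧ (t.map e₀).sum < (l.map e₀).sum) ∨
      (0 < (t.map e₁).sum ∧ (t.map e₁).sum < (l.map e₁).sum) := by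
  have hsum : ∀ l : List β, (l.map (fun x => e₀ x + e₁ x)).sum =
      (l.map e₀).sum + (l.map e₁).sum := fun l => List.sum_map_add
  have hlt := sum_lt_of_sublist _ h hpos hne'
  rw [hsum, hsum] at hlt
  have hle₀ : (t.map e₀).sum ≤ (l.map e₀).sum := (h.map e₀).sum_le_sum (fun _ _ => Nat.zero_le _)
  have hle₁ : (t.map e₁).sum ≤ (l.map e₁).sum := (h.map e₁).sum_le_sum (fun _ _ => Nat.zero_le _)
  by_cases hxt : x ∈ t
  · have hx₀ : e₀ x ≤ (t.map e₀).sum :=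
      List.single_le_sum (fun _ _ => Nat.zero_le _) _ (List.mem_map.2 ⟨x, hxt, rfl⟩)
    have hx₁ : e₁ x ≤ (t.map e₁).sum :=
      List.single_le_sum (fun _ _ => Nat.zero_le _) _ (List.mem_map.2 ⟨x, hxt, rfl⟩)
    omega
  · have hx₀ := sum_add_le_of_sublist e₀ h hx hxt
    have hx₁ := sum_add_le_of_sublist e₁ h hx hxt
    obtain ⟨y, hy⟩ := List.exists_mem_of_ne_nil t hne
    have hy' := hpos y (h.subset hy)
    have hy₀ : e₀ y ≤ (t.map e₀).sum :=
      List.single_le_sum (fun _ _ => Nat.zero_le _) _ (List.mem_map.2 ⟨y, hy, rfl⟩)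
    have hy₁ : e₁ y ≤ (t.map e₁).sum :=
      List.single_le_sum (fun _ _ => Nat.zero_le _) _ (List.mem_map.2 ⟨y, hy, rfl⟩)
    omega

/-- Filtering a concatenation of lists by a property which is constant on each of these lists. -/
theorem flatMap_filter {β γ δ : Type*} [DecidableEq δ] (e : β → δ) (m : List (γ × List β))
    (d : γ → δ) (i : δ) (hm : ∀ x ∈ m, ∀ p ∈ x.2, e p = d x.1) :
    (m.filter (fun x => d x.1 = i)).flatMap Prod.snd =
      (m.flatMap Prod.snd).filter (fun p => e p = i) := by
  induction m with
  | nil => rfl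
  | cons x m ih =>
    have hx := hm x (by simp)
    have hm' := ih (fun y hy => hm y (by simp [hy]))
    by_cases h : d x.1 = i
    · have hx' : x.2.filter (fun p => e p = i) = x.2 :=
        List.filter_eq_self.2 (fun p hp => by simpa [h] using hx p hp)
      rw [List.filter_cons_of_pos (by simpa using h), List.flatMap_cons, hm', List.flatMap_cons,
        List.filter_append, hx']
    · have hx' : x.2.filter (fun p => e p = i) = [] :=
        List.filter_eq_nil_iff.2 (fun p hp => by simpa [hx p hp] using h)
      rw [List.filter_cons_of_neg (by simpa using h), hm', List.flatMap_cons,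
        List.filter_append, hx', List.nil_append]

theorem predAbove_eq_self_iff {k : ℕ} {κ : Fin (k + 1)} {j : Fin (k + 2)} :
    κ.predAbove j = κ ↔ j = κ.castSucc ∨ j = κ.succ := by
  constructor
  · intro h
    by_contra! hcon
    exact predAbove_ne hcon.1 hcon.2 h
  · rintro (rfl | rfl) <;> simp

variable {F : Type v}

/-- The letter of the pair partition `{β_κ < β_{κ+1}}` which corresponds to a letter from one of
these two blocks. -/
def pairLetter {k : ℕ} (κ : Fin (k + 1)) (p : Fin (k + 2) × F) : Fin 2 × F :=
  (if p.1 = κ.succ then 1 else 0, p.2)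

theorem restrictPair_word {k : ℕ} (π : OrderedPartition F (k + 1)) (κ : Fin (k + 1)) :
    (π.restrictPair κ).word =
      (π.word.filter (fun p => κ.predAbove p.1 = κ)).map (pairLetter κ) := by
  have hne : κ.castSucc ≠ κ.succ := Fin.castSucc_lt_succ.ne
  change π.word.filterMap _ = _
  induction π.word with
  | nil => rfl
  | cons p l ih =>
    by_cases h1 : p.1 = κ.castSucc
    · simp [h1, ih, hne, pairLetter]
    · by_cases h2 : p.1 = κ.succ
      · simp [h2, ih, hne.symm, pairLetter]
      · simp [h1, h2, ih, predAbove_ne]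

theorem blockSize_filter {k : ℕ} (w : List (Fin (k + 2) × F)) {κ i : Fin (k + 1)}
    {j : Fin (k + 2)} (h : κ.predAbove j = i) :
    (w.filter (fun p => κ.predAbove p.1 = i)).countP (fun p => p.1 = j) = blockSize w j := by
  rw [List.countP_filter, blockSize]
  refine List.countP_congr (fun p _ => ?_)
  simp only [Bool.and_eq_true, decide_eq_true_eq, and_iff_left_iff_imp]
  rintro rfl
  exact h

variable [Finite F] {P : UniversalProduct.{u} F} {α : CoeffFamily F}

/-- The highest coefficient factorizes if two blocks are united which have neighbouring legs `a`,
`b` in the same face.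

The two letters `a`, `b` from the factors `κ` and `κ + 1` are multiplied in the free product of
these factors; the product of the functionals of the two factors then kills all proper subwords,
since a subword without the letter `a b` contains too few letters from both factors, and a
subword with it misses some letter from one of them. -/
theorem highest_unite (hα : P.IsCoefficients α) {k : ℕ} (κ : Fin (k + 1))
    (w₁ w₂ : List (Fin (k + 2) × F)) (a b : Fin (k + 2) × F)
    (hab : (a.1 = κ.castSucc ∧ b.1 = κ.succ) ∨ (b.1 = κ.castSucc ∧ a.1 = κ.succ))
    (hf : a.2 = b.2) {w : List (Fin (k + 2) × F)} (hw : w = w₁ ++ a :: b :: w₂) :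
    highest α w = highest α (w.map (fun p => (κ.predAbove p.1, p.2))) *
      highest α ((w.filter (fun p => κ.predAbove p.1 = κ)).map (pairLetter κ)) := by
  have hne : κ.castSucc ≠ κ.succ := Fin.castSucc_lt_succ.ne
  have hw0 : w ≠ [] := by simp [hw]
  obtain ⟨D, _, _, Ψ, ι, hΨ1, hΨ, hΨκ, hE⟩ := exists_unite P (rootStates.{u} w)
    (fun κ => rootState_one _) κ
  -- The word after multiplication of `a` and `b`: its letters are lists of letters of `w`.
  let q : Fin (k + 2) × F → Fin (k + 1) × F := fun p => (κ.predAbove p.1, p.2)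
  let m : List ((Fin (k + 1) × F) × List (Fin (k + 2) × F)) :=
    w₁.map (fun p => (q p, [p])) ++ (q a, [a, b]) :: w₂.map (fun p => (q p, [p]))
  have hq : q b = q a := by
    refine Prod.ext ?_ hf.symm
    change κ.predAbove b.1 = κ.predAbove a.1
    rcases hab with ⟨h1, h2⟩ | ⟨h1, h2⟩ <;> simp [h1, h2]
  have hqκ : (q a).1 = κ := by
    change κ.predAbove a.1 = κ
    rcases hab with ⟨h1, h2⟩ | ⟨h1, h2⟩ <;> simp [h1, h2]
  have hm : ∀ x ∈ m, x.2 ≠ [] ∧ ∀ p ∈ x.2, q p = x.1 := by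
    intro x hx
    simp only [m, List.mem_append, List.mem_cons, List.mem_map] at hx
    rcases hx with ⟨p, _, rfl⟩ | rfl | ⟨p, _, rfl⟩ <;> simp [hq]
  have hflat : m.flatMap Prod.snd = w := by
    simp [m, hw, List.flatMap_map]
  have hfilter : ∀ i, (m.filter (fun x => x.1.1 = i)).flatMap Prod.snd =
      w.filter (fun p => κ.predAbove p.1 = i) := fun i => by
    rw [flatMap_filter (fun p : Fin (k + 2) × F => κ.predAbove p.1) m Prod.fst i
      (fun x hx p hp => congrArg Prod.fst ((hm x hx).2 p hp)), hflat]
  let val : (Fin (k + 1) × F) × List (Fin (k + 2) × F) → (Fin (k + 1) × F) × D := fun x =>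
    (x.1, (x.2.map (fun p => ι p rootVariable)).prod)
  have hval : ∀ t : List ((Fin (k + 1) × F) × List (Fin (k + 2) × F)),
      ((t.map val).map Prod.snd).prod =
        (((t.flatMap Prod.snd).map (fun p => (p, rootVariable))).map
          (fun p => ι p.1 p.2)).prod := by
    intro t
    induction t with
    | nil => rfl
    | cons x t ih =>
      rw [List.map_cons, List.map_cons, List.prod_cons, ih, List.flatMap_cons, List.map_append,
        List.map_append, List.prod_append, List.map_map (l := x.2)]
      rfl
  have hcount : ∀ (t : List ((Fin (k + 1) × F) × List (Fin (k + 2) × F))) (j : Fin (k + 2)),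
      (t.flatMap Prod.snd).countP (fun p => p.1 = j) =
        (t.map (fun x => x.2.countP (fun p => p.1 = j))).sum := fun t j => by
    rw [List.countP_flatMap]
    rfl
  have hother : ∀ j : Fin (k + 2), κ.predAbove j ≠ κ → ∀ p : Fin (k + 2) × F,
      κ.predAbove p.1 = κ.predAbove j → p.1 = j := by
    intro j hj p hp
    have h1 : j ≠ κ.succ := fun h => hj (predAbove_eq_self_iff.2 (Or.inr h))
    have h2 : p.1 ≠ κ.succ := fun h => hj (hp ▸ predAbove_eq_self_iff.2 (Or.inr h))
    rw [← Fin.succ_succAbove_predAbove h2, hp, Fin.succ_succAbove_predAbove h1]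
  have hΨother : ∀ j : Fin (k + 2), κ.predAbove j ≠ κ → ∀ T : List (Fin (k + 2) × F),
      T.Sublist (w.filter (fun p => κ.predAbove p.1 = κ.predAbove j)) →
      Ψ (κ.predAbove j) ((T.map (fun p => (p, rootVariable))).map (fun p => ι p.1 p.2)).prod =
        rootState (blockSize w j) (rootVariable.{u} ^ T.length) := by
    intro j hj T hT
    rw [hΨ j (fun h => hj (predAbove_eq_self_iff.2 (Or.inl h)))
      (fun h => hj (predAbove_eq_self_iff.2 (Or.inr h)))]
    · rw [List.map_map]
      change rootState _ (T.map (fun _ => rootVariable)).prod = _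
      rw [List.map_const', List.prod_replicate]
    · intro p hp
      obtain ⟨p, hp', rfl⟩ := List.mem_map.1 hp
      refine hother j hj p ?_
      simpa using (List.mem_filter.1 (hT.subset hp')).2
  have hlength : ∀ j : Fin (k + 2), κ.predAbove j ≠ κ →
      (w.filter (fun p => κ.predAbove p.1 = κ.predAbove j)).length = blockSize w j := by
    intro j hj
    rw [← blockSize_filter w (rfl : κ.predAbove j = _), eq_comm, List.countP_eq_length]
    intro p hp
    simpa using hother j hj p (by simpa using (List.mem_filter.1 hp).2)
  -- The numbers of letters from the two factors in the united factor.
  let N : Fin 2 → ℕ := ![blockSize w κ.castSucc, blockSize w κ.succ]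
  have hN : ![rootStates.{u} w κ.castSucc, rootStates w κ.succ] =
      fun j => rootState (N j) := by
    funext j
    fin_cases j <;> rfl
  have hpair : ∀ T : List (Fin (k + 2) × F),
      (∀ p ∈ T, κ.predAbove p.1 = κ) →
      (blockSize (T.map (pairLetter κ)) 0 = T.countP (fun p => p.1 = κ.castSucc) ∧
      blockSize (T.map (pairLetter κ)) 1 = T.countP (fun p => p.1 = κ.succ)) := by
    intro T hT
    simp only [blockSize, List.countP_map]
    constructor <;>
    · refine List.countP_congr (fun p hp => ?_)
      rcases predAbove_eq_self_iff.1 (hT p hp) with h | h <;> simp [pairLetter, h, hne, hne.symm]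
  have hΨκ' : ∀ T : List (Fin (k + 2) × F), (∀ p ∈ T, κ.predAbove p.1 = κ) →
      Ψ κ ((T.map (fun p => (p, rootVariable))).map (fun p => ι p.1 p.2)).prod =
        wordValue P (fun j => rootState.{u} (N j))
          ((T.map (pairLetter κ)).map (fun p => (p, rootVariable))) := by
    intro T hT
    rw [hΨκ, hN, List.map_map, List.map_map]
    · rfl
    · intro p hp
      obtain ⟨p, hp', rfl⟩ := List.mem_map.1 hp
      exact predAbove_eq_self_iff.1 (hT p hp')
  have hmem : ∀ i, ∀ p ∈ w.filter (fun p => κ.predAbove p.1 = i), κ.predAbove p.1 = i :=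
    fun i p hp => by simpa using (List.mem_filter.1 hp).2
  have hfilterval : ∀ i, (m.map val).filter (fun p => p.1.1 = i) =
      (m.filter (fun x => x.1.1 = i)).map val := fun i => by
    rw [List.filter_map]
    rfl
  have hflatsub : ∀ {t m : List ((Fin (k + 1) × F) × List (Fin (k + 2) × F))}, t.Sublist m →
      (t.flatMap Prod.snd).Sublist (m.flatMap Prod.snd) := fun h => h.flatMap _
  have key := wordValue_eq_highest hα Ψ hΨ1 (m.map val) (by simp [m]) (by
    intro i t ht htne htne'
    rw [hfilterval] at ht htne'
    obtain ⟨t, ht', rfl⟩ := List.sublist_map_iff.1 ht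
    have ht0 : t ≠ [] := by simpa using htne
    have ht1 : t ≠ m.filter (fun x => x.1.1 = i) := fun e => htne' (by rw [e])
    have hsub := hflatsub ht'
    have hpos : ∀ x ∈ m.filter (fun x => x.1.1 = i), 0 < x.2.length := fun x hx =>
      List.length_pos_iff.2 (hm x (List.mem_of_mem_filter hx)).1
    rw [hfilter] at hsub
    rw [hval]
    by_cases hi : i = κ
    · subst hi
      have hT := fun p hp => hmem i p (hsub.subset hp)
      rw [hΨκ' _ hT]
      have hxm : (q a, [a, b]) ∈ m.filter (fun x => x.1.1 = i) := by
        simp [m, hqκ]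
      have hcase := sum_lt_or_sum_lt_of_sublist
        (fun x => x.2.countP (fun p => p.1 = i.castSucc))
        (fun x => x.2.countP (fun p => p.1 = i.succ)) ht' ht0 ht1 (by
          intro x hx
          obtain ⟨p, hp⟩ := List.exists_mem_of_ne_nil _ (hm x (List.mem_of_mem_filter hx)).1
          have hp' : i.predAbove p.1 = i := by
            have e1 := congrArg Prod.fst ((hm x (List.mem_of_mem_filter hx)).2 p hp)
            exact e1.trans (by simpa using (List.mem_filter.1 hx).2)
          rcases predAbove_eq_self_iff.1 hp' with h | h
          · exact Nat.add_pos_left (List.countP_pos_iff.2 ⟨p, hp, by simpa using h⟩) _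
          · exact Nat.add_pos_right _ (List.countP_pos_iff.2 ⟨p, hp, by simpa using h⟩)) hxm
        (by rcases hab with ⟨h1, h2⟩ | ⟨h1, h2⟩ <;> simp [h1, h2])
        (by rcases hab with ⟨h1, h2⟩ | ⟨h1, h2⟩ <;> simp [h1, h2])
      simp only [← hcount, hfilter] at hcase
      rw [blockSize_filter w (predAbove_eq_self_iff.2 (Or.inl rfl)),
        blockSize_filter w (predAbove_eq_self_iff.2 (Or.inr rfl)), ← (hpair _ hT).1,
        ← (hpair _ hT).2] at hcase
      rcases hcase with ⟨h1, h2⟩ | ⟨h1, h2⟩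
      · exact wordValue_rootVariable_eq_zero N _ 0 h1 h2
      · exact wordValue_rootVariable_eq_zero N _ 1 h1 h2
    · obtain ⟨j, rfl⟩ := Fin.predAbove_surjective κ i
      rw [hΨother j hi _ hsub]
      have hlt := sum_lt_of_sublist _ ht' hpos ht1
      have hlen : ∀ t : List ((Fin (k + 1) × F) × List (Fin (k + 2) × F)),
          (t.flatMap Prod.snd).length = (t.map (fun x => x.2.length)).sum := fun t => by
        rw [List.length_flatMap]
      rw [← hlen, ← hlen, hfilter, hlength j hi] at hlt
      refine rootState_variable_pow ?_ hlt
      obtain ⟨x, hx⟩ := List.exists_mem_of_ne_nil t ht0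
      obtain ⟨p, hp⟩ :=
        List.exists_mem_of_ne_nil _ (hm x (List.mem_of_mem_filter (ht'.subset hx))).1
      exact List.length_pos_of_mem (List.mem_flatMap.2 ⟨x, hx, hp⟩))
  simp only [hfilterval, hval, hfilter] at key
  rw [Finset.prod_eq_single κ, hΨκ' _ (hmem κ)] at key
  · have e1 : rootStates.{u} ((w.filter (fun p => κ.predAbove p.1 = κ)).map (pairLetter κ)) =
        fun j => rootState (N j) := by
      funext j
      have h0 := (hpair _ (hmem κ)).1
      have h1 := (hpair _ (hmem κ)).2
      rw [blockSize_filter w (predAbove_eq_self_iff.2 (Or.inl rfl))] at h0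
      rw [blockSize_filter w (predAbove_eq_self_iff.2 (Or.inr rfl))] at h1
      fin_cases j
      · exact congrArg rootState h0
      · exact congrArg rootState h1
    have e2 : (w.filter (fun p => κ.predAbove p.1 = κ)).map (pairLetter κ) ≠ [] := by
      rw [ne_eq, List.map_eq_nil_iff]
      refine List.ne_nil_of_mem (a := a) (List.mem_filter.2 ⟨by simp [hw], ?_⟩)
      simpa using hqκ
    rw [← e1, wordValue_rootVariable hα _ e2] at key
    have e3 : highest α ((m.map val).map Prod.fst) = highest α (w.map q) := by
      have : (m.map val).map Prod.fst = w₁.map q ++ q a :: w₂.map q := by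
        simp [m, val, Function.comp_def]
      rw [this, hw, List.map_append, List.map_cons, List.map_cons, hq,
        highest_append_cons_cons hα]
    rw [e3] at key
    rw [← key, ← wordValue_rootVariable hα w hw0, hE, List.map_map, hw]
    simp only [List.map_append, List.map_cons, m]
    have := wordValue_merge P Ψ (w₁.map (fun p => (q p, ι p rootVariable)))
      (w₂.map (fun p => (q p, ι p rootVariable))) (q a) (ι a rootVariable) (ι b rootVariable)
    have hq' : (κ.predAbove b.1, b.2) = (κ.predAbove a.1, a.2) := hq
    simpa only [val, Function.comp_def, q, hq', List.map_map, List.map_cons, List.map_nil,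
      List.prod_cons, List.prod_nil, mul_one] using this
  · intro i _ hi
    obtain ⟨j, rfl⟩ := Fin.predAbove_surjective κ i
    rw [hΨother j hi _ (List.Sublist.refl _), hlength j hi]
    exact rootState_variable_pow_self _
  · simp

end Factorization

end MultiFaced

end

theorem theorem5p2 {F : Type v} [Finite F] (P : UniversalProduct.{u, v} F)
    (hP : P.IsPositive) :
    -- the family of highest coefficients exists and is unique
    (∃! α : Weights F, P.IsHighestCoefficients α) ∧
    ∀ α : Weights F, P.IsHighestCoefficients α →
      -- one-block partitions
      (∀ π : OrderedPartition F 0, α 0 π = 1) ∧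
      -- two-point partitions
      (∀ f g : F, α 1 (OrderedPartition.twoPoints f g) = 1 ∧
        α 1 (OrderedPartition.twoPointsRev f g) = 1) ∧
      -- reduction
      (∀ (k : ℕ) (π : OrderedPartition F k), α k π = α k π.red) ∧
      -- uniting neighbouring blocks with neighbouring legs in the same face
      (∀ (k : ℕ) (π : OrderedPartition F (k + 1)) (κ : Fin (k + 1)), π.HasNeighbouringLegs κ →
        α (k + 1) π = α k (π.unite κ) * α 1 (π.restrictPair κ)) ∧
      -- changing the faces of extremal legs
      (∀ (k : ℕ) (π σ : OrderedPartition F k), π.DifferInExtremalFaces σ → α k π = α k σ) ∧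
      -- mirror image
      (∀ (k : ℕ) (π : OrderedPartition F k), α k π.mirror = conj (α k π)) := by
  have hne : ∀ {k : ℕ} (π : OrderedPartition F k), π.word ≠ [] := fun π h => by
    obtain ⟨f, hf⟩ := π.block_nonempty 0
    rw [h] at hf
    exact List.not_mem_nil hf
  refine ⟨⟨fun _ π => highest (coefficient P) π.word,
    ⟨coefficient P, isCoefficients_coefficient P hP, fun _ _ => rfl⟩, ?_⟩, ?_⟩
  · rintro β ⟨α, hα, hβ⟩
    funext k π
    rw [hβ, ← wordValue_rootVariable (isCoefficients_coefficient P hP) _ (hne π)]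
    exact (wordValue_rootVariable hα _ (hne π)).symm
  rintro β ⟨α, hα, hβ⟩
  have hβ' : ∀ (k : ℕ) (π : OrderedPartition F k), β k π = highest α π.word := hβ
  simp only [hβ']
  refine ⟨fun π => ?_, fun f g => ⟨?_, ?_⟩, fun k π => ?_, fun k π κ h => ?_, fun k π σ h => ?_,
    fun k π => ?_⟩
  · exact highest_one_block hα π.word (hne π)
  · exact highest_two hP hα (by decide) f g
  · exact highest_two hP hα (by decide) f g
  · classical
    have := highest_destutter hα π.word
    rw [OrderedPartition.red]
    convert this.symm
  · rw [restrictPair_word]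
    obtain ⟨i, j, hij, hi, hj, hf⟩ := h
    rcases hij with hij | hij
    · exact highest_unite hα κ _ _ _ _ (Or.inl ⟨hi, hj⟩) hf (eq_append_get_cons_get hij)
    · exact highest_unite hα κ _ _ _ _ (Or.inr ⟨hi, hj⟩) hf.symm (eq_append_get_cons_get hij)
  · exact highest_eq_of_extremal hP hα h.1 h.2
  · exact highest_reverse hP hα _ (hne π)
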